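/- Let $K$ be a field of characteristic zero and let $n\ge 0$ be an integer. Let $\operatorname{Rep}(GL_n)$ be the symmetric monoidal category of finite-dimensional rational representations of $GL_n$ over $K$ (representations of $GL_n(K)$ whose matrix coefficients lie in $K[x_{ij},\det^{-1}]$), and let $\operatorname{Rep}(GL_n)^+\subset\operatorname{Rep}(GL_n)$ be the full symmetric monoidal subcategory of polynomial representations (matrix coefficients in $K[x_{ij}]$). Let $\mathcal C$ be a $K$-linear, additive (i.e. with finite direct sums), idempotent-complete symmetric monoidal category with $K$-bilinear tensor product. For an object $X$ and $k\ge 0$, let $\wedge^kX$ be the image of the antisymmetrizer $\frac1{k!}\sum_{\sigma\in S_k}\operatorname{sgn}(\sigma)\,\sigma$ acting on $X^{\otimes k}$. Let $X\in\mathcal C$ satisfy $\wedge^{n+1}X=0$. Then: (a) There is a $K$-linear symmetric monoidal functor $F:\operatorname{Rep}(GL_n)^+\to\mathcal C$ sending the standard $n$-dimensional representation to an object isomorphic to $X$. (b) Let $F$ be any functor as in (a). Suppose that $\mathcal C$ acts (as a monoidal category, $K$-bilinearly on morphisms) on a $K$-linear idempotent-complete category $\mathcal M$ in such a way that $\wedge^nX$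 acts by an equivalence $\mathcal M\to\mathcal M$. Then the action of $\operatorname{Rep}(GL_n)^+$ on $\mathcal M$ obtained by composing with $F$ extends to a $K$-linear action of $\operatorname{Rep}(GL_n)$ on $\mathcal M$; that is, there is a $K$-linear action of $\operatorname{Rep}(GL_n)$ on $\mathcal M$ whose restriction to $\operatorname{Rep}(GL_n)^+$ is isomorphic, as an action (by a monoidal natural isomorphism of the functors to endofunctors of $\mathcal M$), to the one given by $F$. -/

import Mathlib

open CategoryTheory MonoidalCategory

namespace RepGL

/-! ### Symmetric groups acting on tensor powers -/

/-- Monoids `G 0, G 1, …` with the formal properties of the chain of symmetric groups: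
`e k` is the shift map, putting a new point in front, and `t k` is the transposition of the first
two points. -/
structure SymTower (G : ℕ → Type*) [∀ k, Monoid (G k)] where
  e : ∀ k, G k →* G (k + 1)
  t : ∀ k, G (k + 2)
  sq : ∀ k, t k * t k = 1
  braid : ∀ k, t (k + 1) * e _ (t k) * t (k + 1) = e _ (t k) * t (k + 1) * e _ (t k)
  comm : ∀ k (g : G k), t k * e _ (e _ g) = e _ (e _ g) * t k

namespace SymTower

variable {G : ℕ → Type*} [∀ k, Monoid (G k)] (T : SymTower G)

/-- The adjacent transposition of the points `i` and `i + 1` (for `i + 1 < k`). -/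
def adj : ∀ k : ℕ, ℕ → G k
  | 0, _ => 1
  | 1, 0 => 1
  | k + 2, 0 => T.t k
  | k + 1, i + 1 => T.e k (adj k i)

/-- The cycle moving the point `0` to the place `p` and keeping the order of the others
(for `p ≤ k`). -/
def cyc : ∀ k : ℕ, ℕ → G (k + 1)
  | _, 0 => 1
  | 0, _ + 1 => 1
  | k + 1, p + 1 => T.e (k + 1) (cyc k p) * T.t k

lemma adj_succ_succ (k i : ℕ) : T.adj (k + 1) (i + 1) = T.e k (T.adj k i) := by
  cases k <;> rfl

lemma cyc_zero (k : ℕ) : T.cyc k 0 = 1 := by cases k <;> rfl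

lemma adj_mul_cyc : ∀ k p : ℕ, p + 1 ≤ k → T.adj (k + 1) p * T.cyc k p = T.cyc k (p + 1)
  | 0, _, h => by omega
  | k + 1, 0, _ => by simp [adj, cyc, cyc_zero]
  | k + 1, p + 1, h => by
    have ih := adj_mul_cyc k p (by omega)
    rw [adj_succ_succ, cyc, cyc, ← mul_assoc, ← map_mul, ih]

lemma adj_mul_adj : ∀ k i : ℕ, T.adj k i * T.adj k i = 1
  | 0, _ => by simp [adj]
  | 1, 0 => by simp [adj]
  | k + 2, 0 => by simp [adj, T.sq]
  | k + 1, i + 1 => by rw [adj_succ_succ, ← map_mul, adj_mul_adj k i, map_one]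

lemma adj_mul_cyc_succ (k p : ℕ) (h : p + 1 ≤ k) :
    T.adj (k + 1) p * T.cyc k (p + 1) = T.cyc k p := by
  rw [← T.adj_mul_cyc k p h, ← mul_assoc, adj_mul_adj, one_mul]

lemma adj_mul_cyc_of_lt : ∀ k i p : ℕ, i + 1 < p → p ≤ k →
    T.adj (k + 1) i * T.cyc k p = T.cyc k p * T.e k (T.adj k i)
  | k, i, 0, h, _ => by omega
  | k, i, 1, h, _ => by omega
  | 0, i, p + 2, _, h => by omega
  | 1, i, p + 2, _, h => by omega
  | k + 2, 0, p + 2, _, _ => by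
    simp only [adj, cyc, map_mul]
    calc _ = (T.t (k + 1) * T.e _ (T.e _ (T.cyc k p))) * T.e _ (T.t k) * T.t (k + 1) := by
            simp only [mul_assoc]
      _ = T.e _ (T.e _ (T.cyc k p)) * (T.t (k + 1) * T.e _ (T.t k) * T.t (k + 1)) := by
            rw [T.comm]; simp only [mul_assoc]
      _ = _ := by rw [T.braid]; simp only [mul_assoc]
  | k + 2, i + 1, p + 2, h, h' => by
    have ih := adj_mul_cyc_of_lt (k + 1) i (p + 1) (by omega) (by omega)
    rw [adj_succ_succ, adj_succ_succ, cyc, ← mul_assoc, ← map_mul, ih, map_mul, mul_assoc,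
      mul_assoc, T.comm]

lemma adj_mul_cyc_of_gt : ∀ k i p : ℕ, p ≤ i → i + 1 < k →
    T.adj (k + 1) (i + 1) * T.cyc k p = T.cyc k p * T.e k (T.adj k i)
  | k, i, 0, _, _ => by rw [cyc_zero, adj_succ_succ, mul_one, one_mul]
  | 0, i, p + 1, _, h => by omega
  | k, 0, p + 1, h, _ => by omega
  | k + 1, i + 1, p + 1, h, h' => by
    have ih := adj_mul_cyc_of_gt k i p (by omega) (by omega)
    rw [adj_succ_succ, cyc, ← mul_assoc, ← map_mul, ih, map_mul, mul_assoc,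
      mul_assoc, adj_succ_succ, T.comm]

end SymTower

/-- Shift of a permutation, fixing the new point `0`. -/
def permShift (k : ℕ) : Equiv.Perm (Fin k) →* Equiv.Perm (Fin (k + 1)) where
  toFun τ := Equiv.Perm.decomposeFin.symm (0, τ)
  map_one' := by
    simp
    rfl
  map_mul' σ τ := by
    ext j
    refine Fin.cases ?_ (fun j => ?_) j <;> simp

@[simp] lemma permShift_zero (k : ℕ) (τ : Equiv.Perm (Fin k)) : permShift k τ 0 = 0 := by
  simp [permShift]

@[simp] lemma permShift_succ (k : ℕ) (τ : Equiv.Perm (Fin k)) (j : Fin k) :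
    permShift k τ j.succ = (τ j).succ := by
  simp [permShift]

lemma permShift_swap (k : ℕ) (i j : Fin k) :
    permShift k (Equiv.swap i j) = Equiv.swap i.succ j.succ := by
  ext x
  refine Fin.cases ?_ (fun x => ?_) x
  · simp [Equiv.swap_apply_of_ne_of_ne (Fin.succ_ne_zero i).symm (Fin.succ_ne_zero j).symm]
  · rw [permShift_succ, ← (Fin.succ_injective k).swap_apply]

/-- The chain of symmetric groups. -/
def permTower : SymTower (fun k => Equiv.Perm (Fin k)) where
  e := permShift
  t k := Equiv.swap 0 1
  sq k := by simp
  braid k := by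
    have h2 : permShift (k + 2) (Equiv.swap 0 1) = Equiv.swap (Fin.succ 0) (Fin.succ 1) :=
      permShift_swap _ _ _
    rw [h2]
    have h01 : (0 : Fin (k + 3)) ≠ Fin.succ 0 := (Fin.succ_ne_zero _).symm
    have h02 : (0 : Fin (k + 3)) ≠ Fin.succ 1 := (Fin.succ_ne_zero _).symm
    have h12 : (Fin.succ 0 : Fin (k + 3)) ≠ Fin.succ 1 := by
      rw [Ne, Fin.succ_inj]
      exact Fin.zero_ne_one
    change Equiv.swap 0 (Fin.succ 0) * _ * Equiv.swap 0 (Fin.succ 0) =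
      _ * Equiv.swap 0 (Fin.succ 0) * _
    rw [Equiv.swap_comm 0 (Fin.succ 0), Equiv.swap_comm (Fin.succ 0) (Fin.succ 1)]
    generalize (Fin.succ 0 : Fin (k + 3)) = b at *
    generalize (Fin.succ 1 : Fin (k + 3)) = c at *
    generalize (0 : Fin (k + 3)) = a at *
    rw [Equiv.swap_comm b a, Equiv.swap_comm c b, Equiv.swap_mul_swap_mul_swap h01 h02,
      Equiv.swap_comm b c, Equiv.swap_comm a b,
      Equiv.swap_mul_swap_mul_swap h12.symm h02.symm, Equiv.swap_comm]
  comm k g := by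
    have e0 : permShift _ (permShift _ g) 0 = 0 := permShift_zero _ _
    have e1 : permShift _ (permShift _ g) 1 = 1 := by
      change permShift _ (permShift _ g) (Fin.succ 0) = Fin.succ 0
      rw [permShift_succ, permShift_zero]
    refine Equiv.ext fun x => ?_
    rw [Equiv.Perm.mul_apply, Equiv.Perm.mul_apply]
    by_cases hx0 : x = 0
    · rw [hx0, e0, Equiv.swap_apply_left, e1]
    by_cases hx1 : x = 1
    · rw [hx1, e1, Equiv.swap_apply_right, e0]
    rw [Equiv.swap_apply_of_ne_of_ne hx0 hx1, Equiv.swap_apply_of_ne_of_ne]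
    · exact fun h => hx0 ((permShift _ (permShift _ g)).injective (h.trans e0.symm))
    · exact fun h => hx1 ((permShift _ (permShift _ g)).injective (h.trans e1.symm))

lemma permTower_adj : ∀ (k : ℕ) (i : Fin k),
    permTower.adj (k + 1) i = Equiv.swap i.castSucc i.succ
  | 0, i => i.elim0
  | k + 1, i => by
    refine Fin.cases ?_ (fun j => ?_) i
    · rfl
    · rw [Fin.val_succ, SymTower.adj_succ_succ, permTower_adj k j]
      exact permShift_swap _ _ _

/-- The cycle `permTower.cyc k p` does move `0` to `p`. -/
lemma permTower_cyc_zero : ∀ (k : ℕ) (p : ℕ), p ≤ k → (permTower.cyc k p 0 : ℕ) = p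
  | k, 0, _ => by rw [SymTower.cyc_zero]; rfl
  | 0, p + 1, h => by omega
  | k + 1, p + 1, h => by
    have ih := permTower_cyc_zero k p (by omega)
    rw [SymTower.cyc, Equiv.Perm.mul_apply]
    change (permShift _ _ (Equiv.swap 0 1 0) : ℕ) = _
    rw [Equiv.swap_apply_left]
    change (permShift _ _ (Fin.succ 0) : ℕ) = _
    rw [permShift_succ, Fin.val_succ, ih]

/-- The relative order of the points other than `0`: the permutation `τ` such that `σ` is the
shift of `τ` followed by the cycle moving `0` to `σ 0`. -/
def permRest {k : ℕ} (σ : Equiv.Perm (Fin (k + 1))) : Equiv.Perm (Fin k) :=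
  (Equiv.Perm.decomposeFin ((permTower.cyc k (σ 0))⁻¹ * σ)).2

lemma cyc_mul_permRest {k : ℕ} (σ : Equiv.Perm (Fin (k + 1))) :
    permTower.cyc k (σ 0) * permShift k (permRest σ) = σ := by
  set ρ := (permTower.cyc k (σ 0))⁻¹ * σ with hρ
  have h0 : ρ 0 = 0 := by
    rw [hρ, Equiv.Perm.mul_apply, Equiv.Perm.inv_eq_iff_eq]
    exact Fin.ext (permTower_cyc_zero k _ (Nat.lt_succ_iff.mp (σ 0).2)).symm
  have h1 : (Equiv.Perm.decomposeFin ρ).1 = 0 := by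
    have := Equiv.Perm.decomposeFin_symm_apply_zero (Equiv.Perm.decomposeFin ρ).1
      (Equiv.Perm.decomposeFin ρ).2
    rw [Prod.mk.eta, Equiv.symm_apply_apply, h0] at this
    exact this.symm
  have h2 : permShift k (permRest σ) = ρ := by
    change Equiv.Perm.decomposeFin.symm (0, (Equiv.Perm.decomposeFin ρ).2) = ρ
    rw [← h1, Prod.mk.eta, Equiv.symm_apply_apply]
  rw [h2, hρ, mul_inv_cancel_left]

lemma cyc_mul_permShift_apply_zero {k p : ℕ} (hp : p ≤ k) (τ : Equiv.Perm (Fin k)) :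
    ((permTower.cyc k p * permShift k τ) 0 : ℕ) = p := by
  rw [Equiv.Perm.mul_apply, permShift_zero, permTower_cyc_zero k p hp]

lemma permRest_cyc_mul {k p : ℕ} (hp : p ≤ k) (τ : Equiv.Perm (Fin k)) :
    permRest (permTower.cyc k p * permShift k τ) = τ := by
  have h := cyc_mul_permRest (permTower.cyc k p * permShift k τ)
  rw [cyc_mul_permShift_apply_zero hp] at h
  have h' := mul_left_cancel h
  have h'' := Equiv.Perm.decomposeFin.symm.injective h'
  exact (Prod.mk.inj h'').2

namespace SymTower

variable {G : ℕ → Type*} [∀ k, Monoid (G k)] (T : SymTower G)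

/-- The action of permutations determined by the adjacent transpositions. -/
def lift : ∀ k : ℕ, Equiv.Perm (Fin k) → G k
  | 0, _ => 1
  | k + 1, σ => T.cyc k (σ 0) * T.e k (lift k (permRest σ))

lemma lift_cyc_mul {k p : ℕ} (hp : p ≤ k) (τ : Equiv.Perm (Fin k)) :
    T.lift (k + 1) (permTower.cyc k p * permShift k τ) = T.cyc k p * T.e k (T.lift k τ) := by
  rw [lift, permRest_cyc_mul hp, cyc_mul_permShift_apply_zero hp]

lemma lift_adj_mul : ∀ (k i : ℕ), i + 1 < k → ∀ σ : Equiv.Perm (Fin k),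
    T.lift k (permTower.adj k i * σ) = T.adj k i * T.lift k σ
  | 0, i, h, _ => by omega
  | k + 1, i, h, σ => by
    obtain ⟨p, τ, hp, rfl⟩ : ∃ (p : ℕ) (τ : Equiv.Perm (Fin k)), p ≤ k ∧
        σ = permTower.cyc k p * permShift k τ :=
      ⟨σ 0, permRest σ, Nat.lt_succ_iff.mp (σ 0).2, (cyc_mul_permRest σ).symm⟩
    rw [T.lift_cyc_mul hp, ← mul_assoc, ← mul_assoc]
    rcases lt_trichotomy i p with hip | rfl | hip
    · rcases Nat.lt_or_ge (i + 1) p with h1 | h1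
      · rw [permTower.adj_mul_cyc_of_lt k i p h1 hp, T.adj_mul_cyc_of_lt k i p h1 hp, mul_assoc,
          mul_assoc]
        change T.lift (k + 1) (_ * (permShift k _ * permShift k _)) = _
        rw [← map_mul, T.lift_cyc_mul hp, lift_adj_mul k i (by omega), map_mul]
      · obtain rfl : p = i + 1 := by omega
        rw [permTower.adj_mul_cyc_succ k i hp, T.adj_mul_cyc_succ k i hp,
          T.lift_cyc_mul (by omega)]
    · rw [permTower.adj_mul_cyc k i (by omega), T.adj_mul_cyc k i (by omega),
        T.lift_cyc_mul (by omega)]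
    · obtain ⟨j, rfl⟩ : ∃ j, i = j + 1 := ⟨i - 1, by omega⟩
      rw [permTower.adj_mul_cyc_of_gt k j p (by omega) (by omega),
        T.adj_mul_cyc_of_gt k j p (by omega) (by omega), mul_assoc, mul_assoc]
      change T.lift (k + 1) (_ * (permShift k _ * permShift k _)) = _
      rw [← map_mul, T.lift_cyc_mul hp, lift_adj_mul k j (by omega), map_mul]

lemma lift_one : ∀ k : ℕ, T.lift k 1 = 1
  | 0 => rfl
  | k + 1 => by
    have h := T.lift_cyc_mul (Nat.zero_le k) 1
    rw [permTower.cyc_zero, T.cyc_zero, map_one, one_mul, one_mul, lift_one k, map_one] at h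
    exact h

lemma lift_mul (k : ℕ) (σ τ : Equiv.Perm (Fin k)) :
    T.lift k (σ * τ) = T.lift k σ * T.lift k τ := by
  cases k with
  | zero => simp [lift]
  | succ k =>
    have hσ : σ ∈ Submonoid.closure
        (Set.range fun i : Fin k ↦ Equiv.swap i.castSucc i.succ) := by
      rw [Equiv.Perm.mclosure_swap_castSucc_succ]; trivial
    induction hσ using Submonoid.closure_induction generalizing τ with
    | mem x hx =>
      obtain ⟨i, rfl⟩ := hx
      dsimp only
      have h := T.lift_adj_mul (k + 1) i (by omega)
      rw [← permTower_adj k i, h, ← mul_one (permTower.adj (k + 1) i), h, lift_one, mul_one]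
    | one => rw [lift_one, one_mul, one_mul]
    | mul x y _ _ hx hy => rw [mul_assoc, hx, hy, hx, mul_assoc]

lemma lift_swap (k : ℕ) (i : Fin k) :
    T.lift (k + 1) (Equiv.swap i.castSucc i.succ) = T.adj (k + 1) i := by
  have h := T.lift_adj_mul (k + 1) i (by omega) 1
  rwa [mul_one, lift_one, mul_one, permTower_adj] at h

end SymTower

section TensorPower

universe v₁ u₁

variable {C : Type u₁} [Category.{v₁} C] [MonoidalCategory C]

/-- The tensor power `X ⊗ (X ⊗ (⋯ ⊗ 𝟙))`. -/
def tensorPow (X : C) : ℕ → C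
  | 0 => 𝟙_ C
  | k + 1 => X ⊗ tensorPow X k

/-- The exchange `A ⊗ (B ⊗ Y) ⟶ B ⊗ (A ⊗ Y)` of the first two factors. -/
def exch [BraidedCategory C] (A B Y : C) : A ⊗ (B ⊗ Y) ⟶ B ⊗ (A ⊗ Y) :=
  (α_ A B Y).inv ≫ (β_ A B).hom ▷ Y ≫ (α_ B A Y).hom

lemma exch_natural [BraidedCategory C] (A B : C) {Y Z : C} (f : Y ⟶ Z) :
    A ◁ (B ◁ f) ≫ exch A B Z = exch A B Y ≫ B ◁ (A ◁ f) := by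
  simp only [exch, Category.assoc]
  rw [associator_inv_naturality_right_assoc, whisker_exchange_assoc,
    associator_naturality_right]

lemma exch_exch [SymmetricCategory C] (A B Y : C) : exch A B Y ≫ exch B A Y = 𝟙 _ := by
  simp [exch, ← comp_whiskerRight_assoc]

lemma exch_braid [BraidedCategory C] (A B D Y : C) :
    exch A B (D ⊗ Y) ≫ B ◁ exch A D Y ≫ exch B D (A ⊗ Y) =
      A ◁ exch B D Y ≫ exch A D (B ⊗ Y) ≫ D ◁ exch A B Y := by
  have h' : (α_ A B (D ⊗ Y)).inv ≫ (α_ (A ⊗ B) D Y).inv ≫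
      (((β_ A B).hom ▷ D ⊗≫ B ◁ (β_ A D).hom ⊗≫ (β_ B D).hom ▷ A) ▷ Y) ≫
      (α_ (D ⊗ B) A Y).hom ≫ (α_ D B (A ⊗ Y)).hom =
      (α_ A B (D ⊗ Y)).inv ≫ (α_ (A ⊗ B) D Y).inv ≫
      ((𝟙 _ ⊗≫ (A ◁ (β_ B D).hom ⊗≫ (β_ A D).hom ▷ B ⊗≫ D ◁ (β_ A B).hom) ⊗≫ 𝟙 _) ▷ Y) ≫
      (α_ (D ⊗ B) A Y).hom ≫ (α_ D B (A ⊗ Y)).hom := by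
    rw [BraidedCategory.yang_baxter' A B D]
  calc _ = _ := by
        simp only [exch]
        monoidal
    _ = _ := h'
    _ = _ := by
        simp only [exch]
        monoidal

/-- The endomorphism monoids of the tensor powers of an object of a symmetric monoidal
category. -/
def endTower [SymmetricCategory C] (X : C) : SymTower (fun k => End (tensorPow X k)) where
  e k :=
    { toFun f := X ◁ f
      map_one' := whiskerLeft_id _ _
      map_mul' _ _ := whiskerLeft_comp _ _ _ }
  t k := exch X X (tensorPow X k)
  sq k := exch_exch X X _
  braid k := by
    simp only [End.mul_def]
    exact (exch_braid X X X (tensorPow X k))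
  comm k g := (exch_natural X X g)

/-- The endomorphism `1 ⊗ ⋯ ⊗ β ⊗ ⋯ ⊗ 1` of a tensor power, exchanging the factors number `i` and
`i + 1` (counted from `0`). -/
abbrev exchAt [SymmetricCategory C] (X : C) (k i : ℕ) : End (tensorPow X k) :=
  (endTower X).adj k i

/-- The action of the symmetric group on the `k`-th tensor power of an object of a symmetric
monoidal category. By `permAct_swap` it is the homomorphism that sends the transposition of `i` and
`i + 1` to the exchange of these two factors. -/
def permAct [SymmetricCategory C] (X : C) (k : ℕ) :
    Equiv.Perm (Fin k) →* End (tensorPow X k) where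
  toFun := (endTower X).lift k
  map_one' := (endTower X).lift_one k
  map_mul' := (endTower X).lift_mul k

lemma permAct_swap [SymmetricCategory C] (X : C) (k : ℕ) (i : Fin k) :
    permAct X (k + 1) (Equiv.swap i.castSucc i.succ) = exchAt X (k + 1) i :=
  (endTower X).lift_swap k i

lemma exchAt_zero [SymmetricCategory C] (X : C) (k : ℕ) :
    exchAt X (k + 2) 0 = exch X X (tensorPow X k) := rfl

lemma exchAt_succ [SymmetricCategory C] (X : C) (k i : ℕ) :
    exchAt X (k + 1) (i + 1) = X ◁ exchAt X k i := (endTower X).adj_succ_succ k i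

end TensorPower

/-! ### Exterior powers -/

section ExteriorPower

universe v₁ u₁ u

variable (K : Type u) [Field K] {C : Type u₁} [Category.{v₁} C] [Preadditive C] [Linear K C]
  [MonoidalCategory C] [SymmetricCategory C]

/-- The antisymmetrizer `(1 / k!) ∑ sign(σ) σ` on the `k`-th tensor power. -/
noncomputable def antisymmetrizer (X : C) (k : ℕ) : End (tensorPow X k) :=
  ((k.factorial : K)⁻¹) • ∑ σ : Equiv.Perm (Fin k), Equiv.Perm.sign σ • permAct X k σ

lemma antisymmetrizer_mul_self [CharZero K] (X : C) (k : ℕ) :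
    antisymmetrizer K X k * antisymmetrizer K X k = antisymmetrizer K X k := by
  set S : End (tensorPow X k) :=
    ∑ σ : Equiv.Perm (Fin k), Equiv.Perm.sign σ • permAct X k σ with hS
  have h1 : ∀ τ : Equiv.Perm (Fin k), (Equiv.Perm.sign τ • permAct X k τ) * S = S := by
    intro τ
    rw [hS, Finset.mul_sum]
    refine Fintype.sum_equiv (Equiv.mulLeft τ) _ _ fun σ => ?_
    rw [Equiv.coe_mulLeft, map_mul, map_mul, smul_mul_smul_comm]
  have h2 : S * S = (k.factorial : K) • S := by
    conv_lhs => rw [hS]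
    rw [Finset.sum_mul, ← hS, Finset.sum_congr rfl (fun τ _ => h1 τ), Finset.sum_const,
      Finset.card_univ, Fintype.card_perm, Fintype.card_fin, Nat.cast_smul_eq_nsmul]
  have h3 : (k.factorial : K) ≠ 0 := Nat.cast_ne_zero.mpr k.factorial_ne_zero
  change ((k.factorial : K)⁻¹ • S) * ((k.factorial : K)⁻¹ • S) = (k.factorial : K)⁻¹ • S
  rw [smul_mul_smul_comm, h2, smul_smul, mul_assoc, inv_mul_cancel₀ h3, mul_one]

lemma antisymmetrizer_split [CharZero K] [IsIdempotentComplete C] (X : C) (k : ℕ) :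
    ∃ (Y : C) (i : Y ⟶ tensorPow X k) (e : tensorPow X k ⟶ Y),
      i ≫ e = 𝟙 Y ∧ e ≫ i = antisymmetrizer K X k :=
  IsIdempotentComplete.idempotents_split _ _ (antisymmetrizer_mul_self K X k)

/-- The exterior power `∧ᵏ X`: the image of the antisymmetrizer on the `k`-th tensor power. -/
noncomputable def extPow [CharZero K] [IsIdempotentComplete C] (X : C) (k : ℕ) : C :=
  (antisymmetrizer_split K X k).choose

lemma extPow_spec [CharZero K] [IsIdempotentComplete C] (X : C) (k : ℕ) :
    ∃ (i : extPow K X k ⟶ tensorPow X k) (e : tensorPow X k ⟶ extPow K X k),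
      i ≫ e = 𝟙 _ ∧ e ≫ i = antisymmetrizer K X k :=
  (antisymmetrizer_split K X k).choose_spec

end ExteriorPower

/-! ### Rational and polynomial representations of the general linear group -/

section Representations

universe u

variable (K : Type u) [Field K] (n : ℕ)

/-- The polynomial functions on `GL n K`, generated by the matrix entries. -/
def polyFun : Subalgebra K (GL (Fin n) K → K) :=
  Algebra.adjoin K (Set.range fun (ij : Fin n × Fin n) (g : GL (Fin n) K) => g.1 ij.1 ij.2)

/-- The regular functions on `GL n K`, generated by the matrix entries and the inverse of the
determinant. -/
def regFun : Subalgebra K (GL (Fin n) K → K) :=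
  Algebra.adjoin K ((Set.range fun (ij : Fin n × Fin n) (g : GL (Fin n) K) => g.1 ij.1 ij.2) ∪
    {fun g : GL (Fin n) K => (g.1.det)⁻¹})

variable {K n}

/-- The finite dimensional representations all of whose matrix coefficients lie in a given algebra
of functions on the group. -/
def hasCoeffIn (A : Subalgebra K (GL (Fin n) K → K)) : ObjectProperty (FDRep K (GL (Fin n) K)) :=
  fun V => ∀ (f : Module.Dual K V) (v : V), (fun g => f (V.ρ g v)) ∈ A

lemma hasCoeffIn_mono {A B : Subalgebra K (GL (Fin n) K → K)} (h : A ≤ B) :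
    hasCoeffIn A ≤ hasCoeffIn B :=
  fun _ hV f v => h (hV f v)

instance (A : Subalgebra K (GL (Fin n) K → K)) : (hasCoeffIn A).IsMonoidal where
  prop_unit := fun f v => by
    have : (fun g : GL (Fin n) K => f ((𝟙_ (FDRep K (GL (Fin n) K))).ρ g v)) =
        algebraMap K (GL (Fin n) K → K) (f v) := rfl
    rw [this]
    exact A.algebraMap_mem _
  prop_tensor := fun V W hV hW f x => by
    change (fun g => f (TensorProduct.map (V.ρ g) (W.ρ g) x)) ∈ A
    revert f x
    change ∀ (f : Module.Dual K (TensorProduct K V W)) (x : TensorProduct K V W), _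
    intro f x
    induction x using TensorProduct.induction_on with
    | zero =>
      simp only [map_zero]
      exact A.zero_mem
    | add x y hx hy =>
      simp only [map_add]
      exact A.add_mem hx hy
    | tmul v w =>
      let b := Module.finBasis K V
      let c := Module.finBasis K W
      have : (fun g => f (TensorProduct.map (V.ρ g) (W.ρ g) (v ⊗ₜ[K] w))) =
          ∑ i, ∑ j, f (b i ⊗ₜ[K] c j) •
            ((fun g => b.coord i (V.ρ g v)) * (fun g => c.coord j (W.ρ g w))) := by
        funext g
        rw [TensorProduct.map_tmul]
        conv_lhs => rw [← b.sum_repr (V.ρ g v), ← c.sum_repr (W.ρ g w)]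
        simp only [TensorProduct.sum_tmul, TensorProduct.tmul_sum, map_sum,
          TensorProduct.smul_tmul_smul, map_smul, Finset.sum_apply, Pi.smul_apply, Pi.mul_apply,
          Module.Basis.coord_apply, smul_eq_mul]
        rw [Finset.sum_comm]
        simp only [mul_comm]
      rw [this]
      exact A.sum_mem fun i _ => A.sum_mem fun j _ =>
        A.smul_mem (A.mul_mem (hV _ _) (hW _ _)) _

variable (K n)

/-- `Rep(GL_n)⁺`: the symmetric monoidal category of (finite dimensional) polynomial
representations of `GL_n`. -/
abbrev PolyRep := (hasCoeffIn (polyFun K n)).FullSubcategory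

/-- `Rep(GL_n)`: the symmetric monoidal category of (finite dimensional) rational representations
of `GL_n`. -/
abbrev RatRep := (hasCoeffIn (regFun K n)).FullSubcategory

lemma polyFun_le_regFun : polyFun K n ≤ regFun K n := Algebra.adjoin_mono Set.subset_union_left

/-- The inclusion of `Rep(GL_n)⁺` in `Rep(GL_n)`. -/
abbrev polyToRat : PolyRep K n ⥤ RatRep K n :=
  ObjectProperty.ιOfLE (hasCoeffIn_mono (polyFun_le_regFun K n))

/-- The action of `GL n K` on column vectors. -/
def stdRho : Representation K (GL (Fin n) K) (Fin n → K) :=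
  (Matrix.toLinAlgEquiv' : Matrix (Fin n) (Fin n) K ≃ₐ[K] _).toAlgHom.toMonoidHom.comp
    (Units.coeHom _)

lemma stdRho_apply (g : GL (Fin n) K) (v : Fin n → K) : stdRho K n g v = g.1.mulVec v := rfl

/-- The standard `n`-dimensional representation of `GL_n`. -/
noncomputable def stdRep : PolyRep K n where
  obj := FDRep.of (stdRho K n)
  property := fun f v => by
    change (fun g => f (stdRho K n g v)) ∈ polyFun K n
    have : (fun g : GL (Fin n) K => f (stdRho K n g v)) =
        ∑ i, ∑ j, (f (Pi.single i 1) * v j) • (fun g : GL (Fin n) K => g.1 i j) := by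
      funext g
      rw [stdRho_apply]
      conv_lhs => rw [← Finset.univ_sum_single (g.1.mulVec v)]
      rw [map_sum, Finset.sum_apply]
      refine Finset.sum_congr rfl fun i _ => ?_
      have hs : (Pi.single i (g.1.mulVec v i) : Fin n → K) =
          (g.1.mulVec v i) • Pi.single i (1 : K) := by
        rw [← Pi.single_smul, smul_eq_mul, mul_one]
      rw [hs, map_smul, smul_eq_mul, Finset.sum_apply, Matrix.mulVec, dotProduct,
        Finset.sum_mul]
      refine Finset.sum_congr rfl fun j _ => ?_
      rw [Pi.smul_apply, smul_eq_mul]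
      ring
    rw [this]
    exact Subalgebra.sum_mem _ fun i _ => Subalgebra.sum_mem _ fun j _ =>
      Subalgebra.smul_mem _ (Algebra.subset_adjoin (Set.mem_range_self (i, j))) _

end Representations

/-! ### Linear actions -/

section Actions

open MonoidalLeftAction

/-- The action of a `K`-linear monoidal category `A` on a `K`-linear category `M` is `K`-linear:
it is `K`-bilinear on morphisms. -/
class LinearLeftAction (K A M : Type*) [Semiring K]
    [Category* A] [Preadditive A] [Linear K A] [MonoidalCategory A]
    [Category* M] [Preadditive M] [Linear K M] [MonoidalLeftAction A M] : Prop where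
  actionHomLeft_add : ∀ {a b : A} (f g : a ⟶ b) (m : M), (f + g) ⊵ₗ m = f ⊵ₗ m + g ⊵ₗ m
  actionHomLeft_smul : ∀ (r : K) {a b : A} (f : a ⟶ b) (m : M), (r • f) ⊵ₗ m = r • f ⊵ₗ m
  actionHomRight_add : ∀ (a : A) {m m' : M} (f g : m ⟶ m'), a ⊴ₗ (f + g) = a ⊴ₗ f + a ⊴ₗ g
  actionHomRight_smul : ∀ (r : K) (a : A) {m m' : M} (f : m ⟶ m'), a ⊴ₗ (r • f) = r • a ⊴ₗ f

attribute [local instance] endofunctorMonoidalCategory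

/-- Given monoidal functors `I : A ⥤ B` and `F : A ⥤ C`, and actions of `B` and of `C` on `M`: the
action of `B` extends, along `I`, the action of `A` given by `F`. That is, the monoidal functors
from `A` to the endofunctors of `M` obtained from the two actions are isomorphic, as monoidal
functors. (The monoidal opposite accounts for the order of composition in `M ⥤ M`.) -/
def ActionExtends {A B C : Type*} (M : Type*) [Category* A] [MonoidalCategory A]
    [Category* B] [MonoidalCategory B] [Category* C] [MonoidalCategory C] [Category* M]
    (I : A ⥤ B) [I.Monoidal] (F : A ⥤ C) [F.Monoidal]
    [MonoidalLeftAction B M] [MonoidalLeftAction C M] : Prop :=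
  ∃ θ : I ⋙ curriedActionMop B M ≅ F ⋙ curriedActionMop C M, NatTrans.IsMonoidal θ.hom

end Actions

end RepGL

/-! Let `V` be the standard representation.

Part (a). By the first fundamental theorem, the endomorphisms of `V^{⊗k}` are spanned by the
permutations of the factors, and there are no nonzero morphisms between tensor powers of different
degrees (`mem_span_permAct`, `stdPow_hom_eq_zero`). By the second, all linear relations between
these permutations come from the antisymmetrizer on `n + 1` places, so they also hold on `X^{⊗k}` as
soon as `∧^{n+1} X = 0` (`linearCombination_permAct_eq_zero`). Hence sending a permutation on
`V^{⊗k}` to the same permutation on `X^{⊗k}` is a well defined linear functor on tensor powers.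
Every polynomial representation is a direct summand of a finite sum of tensor powers
(`exists_retract_stdPow`), and `C` has finite sums and split idempotents, so the functor extends to
all of them (`WordFunctor.exists_braided`).

The first theorem combines the double commutant theorem for the symmetric group with the fact that
the commutant of the permutations is spanned by `GL_n`, which rests on the vanishing of polynomials
that are zero on `GL_n`. The second is a straightening argument: the antisymmetrizer relations
rewrite every permutation in terms of those without a decreasing subsequence of length `n + 1`, and
these are linearly independent on `V^{⊗k}`. To keep the monoidal structure strictly under control,
the functor is first built on bracketed tensor words. A structural morphism between words evaluates
to one permutation, the same in every symmetric monoidal category (`FHom.exists_perm`).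

Part (b). A rational representation becomes polynomial after tensoring with a high power of the
determinant, and `F` takes the determinant to `∧^n X`, which acts invertibly. So `W` has to act on
`m` as `d⁻¹ · ((d ⊗ W) · m)` for a high power `d` of the determinant. Rather than comparing
different choices of `d`, the object `W · m` is characterised by a `Frame`: an object `Y` with
isomorphisms `a · Y ≅ (a ⊗ W) · m` for the admissible polynomial `a`, natural in `a` and compatible
with multiplication by further objects. Frames exist (`Frame.nonempty`), and morphisms `W ⟶ W'` and
`m ⟶ m'` induce exactly one morphism between them (`Frame.exists_isMap`, `Frame.IsMap.eq`), because
a compatibility at a single invertible `d` spreads to all `a` through the braiding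
(`Frame.EqAt.isMap`). Each axiom of an action then holds because its two sides are induced by the
same data. -/

namespace RepGL

/-! ### Formal symmetric monoidal morphisms -/

/-- Tensor words in one generator. -/
inductive Word : Type
  | one : Word
  | gen : Word
  | ten : Word → Word → Word

namespace Word

/-- The words `gen ⊗ (gen ⊗ (⋯ ⊗ one))`. -/
@[reducible] def pow : ℕ → Word
  | 0 => one
  | k + 1 => ten gen (pow k)

/-- Length of a word, with accumulator. -/
@[reducible] def len : Word → ℕ → ℕ
  | one, k => k
  | gen, k => k + 1
  | ten w u, k => len w (len u k)

end Word

/-- Formal morphisms of the free symmetric monoidal category on one object. -/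
inductive FHom : Word → Word → Type
  | id (w : Word) : FHom w w
  | comp {w u v : Word} (f : FHom w u) (g : FHom u v) : FHom w v
  | tensor {w w' u u' : Word} (f : FHom w w') (g : FHom u u') : FHom (w.ten u) (w'.ten u')
  | assoc (w u v : Word) : FHom ((w.ten u).ten v) (w.ten (u.ten v))
  | assocInv (w u v : Word) : FHom (w.ten (u.ten v)) ((w.ten u).ten v)
  | left (w : Word) : FHom (Word.one.ten w) w
  | leftInv (w : Word) : FHom w (Word.one.ten w)
  | right (w : Word) : FHom (w.ten Word.one) w
  | rightInv (w : Word) : FHom w (w.ten Word.one)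
  | braid (w u : Word) : FHom (w.ten u) (u.ten w)

/-- Formal compositions of exchanges of adjacent factors. -/
inductive PHom : ℕ → ℕ → Type
  | id (a : ℕ) : PHom a a
  | comp {a b c : ℕ} (p : PHom a b) (q : PHom b c) : PHom a c
  | exch (a : ℕ) : PHom (a + 2) (a + 2)
  | whisk {a b : ℕ} (p : PHom a b) : PHom (a + 1) (b + 1)

namespace PHom

/-- Whiskering by a word. -/
def whiskWord : ∀ (w : Word) {a b : ℕ}, PHom a b → PHom (w.len a) (w.len b)
  | .one, _, _, p => p
  | .gen, _, _, p => p.whisk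
  | .ten w u, _, _, p => whiskWord w (whiskWord u p)

/-- Moving the generator past a word. -/
def braidGen : ∀ (u : Word) (k : ℕ), PHom (u.len k + 1) (u.len (k + 1))
  | .one, k => .id (k + 1)
  | .gen, k => .exch k
  | .ten u v, k => .comp (braidGen u (v.len k)) (whiskWord u (braidGen v k))

/-- Moving a word past a word. -/
def braid : ∀ (w u : Word) (k : ℕ), PHom (w.len (u.len k)) (u.len (w.len k))
  | .one, u, k => .id (u.len k)
  | .gen, u, k => braidGen u k
  | .ten w v, u, k => .comp (whiskWord w (braid v u k)) (braid w u (v.len k))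

/-- The formal adjacent transpositions. -/
def adj : ∀ k : ℕ, ℕ → PHom k k
  | 0, _ => .id 0
  | 1, 0 => .id 1
  | k + 2, 0 => .exch k
  | k + 1, i + 1 => .whisk (adj k i)

lemma adj_succ_succ (k i : ℕ) : adj (k + 1) (i + 1) = .whisk (adj k i) := by
  cases k <;> rfl

/-- A composition of exchanges, as a formal morphism. -/
def toFHom : ∀ {a b : ℕ}, PHom a b → FHom (.pow a) (.pow b)
  | _, _, .id a => .id _
  | _, _, .comp p q => .comp p.toFHom q.toFHom
  | _, _, .exch a => .comp (.assocInv .gen .gen (.pow a))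
      (.comp (.tensor (.braid .gen .gen) (.id _)) (.assoc .gen .gen (.pow a)))
  | _, _, .whisk p => .tensor (.id .gen) p.toFHom

end PHom

namespace FHom

/-- Normal form of a formal morphism. -/
def toPHom : ∀ {w u : Word}, FHom w u → ∀ k : ℕ, PHom (w.len k) (u.len k)
  | _, _, .id _, _ => .id _
  | _, _, .comp f g, k => .comp (f.toPHom k) (g.toPHom k)
  | _, _, .tensor (w := _) (w' := w') (u := u) f g, k =>
      .comp (f.toPHom (u.len k)) (.whiskWord w' (g.toPHom k))
  -- Thanks to the accumulator, the lengths of the two sides of a structural isomorphism are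
  -- definitionally equal, so all of these normalise to identities without transport.
  | _, _, .assoc w u v, k => .id (w.len (u.len (v.len k)))
  | _, _, .assocInv w u v, k => .id (w.len (u.len (v.len k)))
  | _, _, .left w, k => .id (w.len k)
  | _, _, .leftInv w, k => .id (w.len k)
  | _, _, .right w, k => .id (w.len k)
  | _, _, .rightInv w, k => .id (w.len k)
  | _, _, .braid w u, k => .braid w u k

/-- The normalisation of a word. -/
def norm : ∀ (w : Word) (k : ℕ), FHom (w.ten (.pow k)) (.pow (w.len k))
  | .one, _ => .left _
  | .gen, k => .id (Word.gen.ten (.pow k))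
  | .ten w u, k => .comp (.assoc w u (.pow k))
      (.comp (.tensor (.id w) (norm u k)) (norm w (u.len k)))

/-- The inverse of the normalisation of a word. -/
def normInv : ∀ (w : Word) (k : ℕ), FHom (.pow (w.len k)) (w.ten (.pow k))
  | .one, _ => .leftInv _
  | .gen, k => .id (Word.gen.ten (.pow k))
  | .ten w u, k => .comp (normInv w (u.len k))
      (.comp (.tensor (.id w) (normInv u k)) (.assocInv w u (.pow k)))

end FHom

section Evaluation

universe v₁ u₁ v₂ u₂

variable {C : Type u₁} [Category.{v₁} C] [MonoidalCategory C]

lemma comp_square {A B D A' B' D' : C} {f : A ⟶ B} {f' : B ⟶ D} {g : A' ⟶ B'} {g' : B' ⟶ D'}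
    {a : A ⟶ A'} {b : B ⟶ B'} {d : D ⟶ D'} (h : f ≫ b = a ≫ g) (h' : f' ≫ d = b ≫ g') :
    (f ≫ f') ≫ d = a ≫ g ≫ g' := by
  rw [Category.assoc, h', reassoc_of% h]

lemma id_square {A B : C} (a : A ⟶ B) : 𝟙 A ≫ a = a ≫ 𝟙 B := by simp

/-- Evaluation of a word. -/
@[reducible] def Word.ev (X : C) : Word → C
  | .one => 𝟙_ C
  | .gen => X
  | .ten w u => w.ev X ⊗ u.ev X

/-- The tensor powers as words. -/
@[reducible] def powIso (X : C) : ∀ k : ℕ, (Word.pow k).ev X ≅ tensorPow X k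
  | 0 => Iso.refl _
  | k + 1 => whiskerLeftIso X (powIso X k)

variable [SymmetricCategory C]

/-- Evaluation of a formal morphism. -/
def FHom.ev (X : C) : ∀ {w u : Word}, FHom w u → (w.ev X ⟶ u.ev X)
  | _, _, .id w => 𝟙 _
  | _, _, .comp f g => f.ev X ≫ g.ev X
  | _, _, .tensor f g => f.ev X ⊗ₘ g.ev X
  | _, _, .assoc w u v => (α_ (w.ev X) (u.ev X) (v.ev X)).hom
  | _, _, .assocInv w u v => (α_ (w.ev X) (u.ev X) (v.ev X)).inv
  | _, _, .left w => (λ_ (w.ev X)).hom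
  | _, _, .leftInv w => (λ_ (w.ev X)).inv
  | _, _, .right w => (ρ_ (w.ev X)).hom
  | _, _, .rightInv w => (ρ_ (w.ev X)).inv
  | _, _, .braid w u => (β_ (w.ev X) (u.ev X)).hom

/-- Evaluation of a composition of exchanges. -/
def PHom.ev (X : C) : ∀ {a b : ℕ}, PHom a b → ((Word.pow a).ev X ⟶ (Word.pow b).ev X)
  | _, _, .id a => 𝟙 _
  | _, _, .comp p q => p.ev X ≫ q.ev X
  | _, _, .exch a => RepGL.exch X X ((Word.pow a).ev X)
  | _, _, .whisk p => X ◁ p.ev X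

variable (X : C)

lemma PHom.ev_toFHom {a b : ℕ} (p : PHom a b) : p.toFHom.ev X = p.ev X := by
  induction p with
  | id a => rfl
  | comp p q hp hq => simp only [toFHom, FHom.ev, hp, hq, ev]
  | exch a =>
    simp only [toFHom, FHom.ev, ev, RepGL.exch, Word.ev, tensorHom_id]
  | whisk p hp =>
    simp only [toFHom, FHom.ev, hp, ev, id_tensorHom]

lemma FHom.norm_normInv (w : Word) (k : ℕ) :
    (norm w k).ev X ≫ (normInv w k).ev X = 𝟙 _ := by
  induction w generalizing k with
  | one => exact (λ_ _).hom_inv_id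
  | gen => exact Category.id_comp _
  | ten w u hw hu =>
    simp only [norm, normInv, ev, Category.assoc, id_tensorHom]
    rw [reassoc_of% (hw (u.len k)), ← whiskerLeft_comp_assoc, hu, whiskerLeft_id,
      Category.id_comp, Iso.hom_inv_id]

lemma FHom.normInv_norm (w : Word) (k : ℕ) :
    (normInv w k).ev X ≫ (norm w k).ev X = 𝟙 _ := by
  induction w generalizing k with
  | one => exact (λ_ _).inv_hom_id
  | gen => exact Category.id_comp _
  | ten w u hw hu =>
    simp only [norm, normInv, ev, Category.assoc, id_tensorHom]
    rw [Iso.inv_hom_id_assoc, ← whiskerLeft_comp_assoc, hu, whiskerLeft_id,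
      Category.id_comp, hw]

/-- Naturality of the normalisation in the tensor power behind the word. -/
lemma PHom.ev_whiskWord (w : Word) {a b : ℕ} (p : PHom a b) :
    w.ev X ◁ p.ev X ≫ (FHom.norm w b).ev X =
      (FHom.norm w a).ev X ≫ (whiskWord w p).ev X := by
  induction w generalizing a b with
  | one => exact leftUnitor_naturality _
  | gen => exact (Category.comp_id _).trans (Category.id_comp _).symm
  | ten w u hw hu =>
    simp only [FHom.norm, FHom.ev, whiskWord, Category.assoc, id_tensorHom, Word.ev]
    rw [associator_naturality_right_assoc, ← whiskerLeft_comp_assoc, hu, whiskerLeft_comp_assoc,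
      hw]

/-- The hexagon axiom splits the braiding past `u ⊗ v` into the braidings past `u` and past `v`,
which are the two factors of `braidGen`. -/
lemma PHom.ev_braidGen (u : Word) (k : ℕ) :
    (β_ X (u.ev X)).hom ▷ (Word.pow k).ev X ≫ (α_ _ _ _).hom ≫ (FHom.norm u (k + 1)).ev X =
      (α_ _ _ _).hom ≫ X ◁ (FHom.norm u k).ev X ≫ (braidGen u k).ev X := by
  induction u generalizing k with
  | one =>
    simp only [Word.ev, FHom.norm, FHom.ev, braidGen, ev]
    simp [braiding_tensorUnit_right]
  | gen =>
    simp only [Word.ev, FHom.norm, FHom.ev, braidGen, ev, whiskerLeft_id]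
    simp only [RepGL.exch, Word.ev, Word.pow]
    erw [Category.comp_id, Category.id_comp, Iso.hom_inv_id_assoc]
  | ten u v hu hv =>
    simp only [Word.ev, FHom.norm, FHom.ev, braidGen, ev, id_tensorHom]
    have h1 := hu (v.len k)
    have h2 := hv k
    calc _ = (α_ _ _ _).hom ≫ X ◁ (α_ _ _ _).hom ≫ (α_ _ _ _).inv ≫
        (β_ X (u.ev X)).hom ▷ (v.ev X ⊗ (Word.pow k).ev X) ≫ (α_ _ _ _).hom ≫
        u.ev X ◁ ((α_ _ _ _).inv ≫ ((β_ X (v.ev X)).hom ▷ (Word.pow k).ev X ≫ (α_ _ _ _).hom ≫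
          (FHom.norm v (k + 1)).ev X)) ≫ (FHom.norm u (v.len (k + 1))).ev X := by
            rw [BraidedCategory.braiding_tensor_right_hom]
            simp only [Word.pow, Word.ev]
            monoidal
      _ = _ := by
        rw [h2, Iso.inv_hom_id_assoc, whiskerLeft_comp, Category.assoc, ev_whiskWord,
          ← associator_naturality_right_assoc, ← whisker_exchange_assoc]
        simp only [Word.ev, Word.pow] at h1 ⊢
        rw [reassoc_of% h1]
        simp

/-- The other hexagon, splitting the word that moves; a single generator is the case of
`ev_braidGen`. -/
lemma PHom.ev_braid (w u : Word) (k : ℕ) :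
    (β_ (w.ev X) (u.ev X)).hom ▷ (Word.pow k).ev X ≫ (FHom.norm (u.ten w) k).ev X =
      (FHom.norm (w.ten u) k).ev X ≫ (braid w u k).ev X := by
  induction w generalizing k with
  | one =>
    simp only [Word.ev, FHom.norm, FHom.ev, braid, ev, id_tensorHom]
    simp [braiding_tensorUnit_left]
  | gen =>
    have h := ev_braidGen X u k
    simp only [Word.ev, FHom.norm, FHom.ev, braid, id_tensorHom, Category.assoc]
    simp only [Word.ev, Word.pow] at h
    erw [whiskerLeft_id, Category.id_comp, Category.id_comp]
    exact h
  | ten w v hw hv =>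
    have h1 := hw (v.len k)
    have h2 := hv k
    simp only [FHom.norm, FHom.ev, id_tensorHom] at h1 h2
    simp only [Word.ev, FHom.norm, FHom.ev, braid, ev, id_tensorHom]
    calc _ = (α_ _ _ _).hom ≫ (α_ _ _ _).hom ≫ w.ev X ◁ ((α_ _ _ _).inv ≫
        (β_ (v.ev X) (u.ev X)).hom ▷ (Word.pow k).ev X) ≫ w.ev X ◁ (α_ _ _ _).hom ≫
        w.ev X ◁ u.ev X ◁ (FHom.norm v k).ev X ≫ (α_ _ _ _).inv ≫
        (β_ (w.ev X) (u.ev X)).hom ▷ _ ≫ (α_ _ _ _).hom ≫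
        u.ev X ◁ (FHom.norm w (v.len k)).ev X ≫ (FHom.norm u (w.len (v.len k))).ev X := by
            rw [BraidedCategory.braiding_tensor_left_hom,
              associator_inv_naturality_right_assoc, whisker_exchange_assoc]
            simp only [Word.len]
            monoidal
      _ = _ := by
        have h3 := congrArg (fun t => w.ev X ◁ t) h2
        simp only [whiskerLeft_comp, Category.assoc] at h3
        rw [h1]
        simp only [Category.assoc, Iso.inv_hom_id_assoc, whiskerLeft_comp]
        rw [reassoc_of% h3, reassoc_of% ev_whiskWord]
        monoidal

/-- The normal form of a formal morphism computes its evaluation. -/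
lemma FHom.ev_norm {w u : Word} (f : FHom w u) (k : ℕ) :
    f.ev X ▷ (Word.pow k).ev X ≫ (norm u k).ev X = (norm w k).ev X ≫ (f.toPHom k).ev X := by
  induction f generalizing k with
  | id w => simp [ev, toPHom, PHom.ev]
  | comp f g hf hg => simp only [ev, toPHom, PHom.ev, comp_whiskerRight_assoc, hg,
      reassoc_of% (hf k)]
  | tensor f g hf hg =>
    simp only [ev, toPHom, PHom.ev, norm, id_tensorHom, Category.assoc]
    rw [← reassoc_of% (hf (_ : ℕ)), ← PHom.ev_whiskWord, ← whisker_exchange_assoc,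
      ← whiskerLeft_comp_assoc, ← hg, tensorHom_def', comp_whiskerRight, Category.assoc,
      associator_naturality_left_assoc, associator_naturality_middle_assoc,
      ← whisker_exchange_assoc, whiskerLeft_comp_assoc]
  | assoc w u v =>
    simp only [ev, toPHom, PHom.ev, norm, id_tensorHom]
    monoidal
  | assocInv w u v =>
    simp only [ev, toPHom, PHom.ev, norm, id_tensorHom]
    monoidal
  | left w =>
    simp only [ev, toPHom, PHom.ev, norm, id_tensorHom]
    monoidal
  | leftInv w =>
    simp only [ev, toPHom, PHom.ev, norm, id_tensorHom]
    monoidal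
  | right w =>
    simp only [ev, toPHom, PHom.ev, norm, id_tensorHom]
    monoidal
  | rightInv w =>
    simp only [ev, toPHom, PHom.ev, norm, id_tensorHom]
    monoidal
  | braid w u => exact PHom.ev_braid X w u k

/-- The normalisation of a word, as an isomorphism. -/
def normIso (w : Word) : w.ev X ≅ tensorPow X (w.len 0) :=
  (ρ_ _).symm ≪≫ ⟨(FHom.norm w 0).ev X, (FHom.normInv w 0).ev X, FHom.norm_normInv X w 0,
    FHom.normInv_norm X w 0⟩ ≪≫ powIso X _

lemma comp_powIso_hom_succ {a b : ℕ} {f : (Word.pow a).ev X ⟶ (Word.pow b).ev X}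
    {g : tensorPow X a ⟶ tensorPow X b} (h : f ≫ (powIso X b).hom = (powIso X a).hom ≫ g) :
    CategoryStruct.comp (Y := (Word.pow (b + 1)).ev X) (X ◁ f) (powIso X (b + 1)).hom =
      CategoryStruct.comp (Y := tensorPow X (a + 1)) (powIso X (a + 1)).hom (X ◁ g) :=
  (whiskerLeft_comp X f _).symm.trans ((congrArg (X ◁ ·) h).trans (whiskerLeft_comp X _ g))

lemma PHom.ev_adj : ∀ k i : ℕ, (PHom.adj k i).ev X ≫ (powIso X k).hom =
    (powIso X k).hom ≫ exchAt X k i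
  | 0, _ => id_square _
  | 1, 0 => id_square _
  | k + 2, 0 => (exch_natural X X (powIso X k).hom).symm
  | k + 1, i + 1 => by
    rw [exchAt_succ, adj_succ_succ]
    exact comp_powIso_hom_succ X (ev_adj k i)

lemma permAct_permShift (k : ℕ) (τ : Equiv.Perm (Fin k)) :
    permAct X (k + 1) (permShift k τ) = X ◁ permAct X k τ := by
  have h := (endTower X).lift_cyc_mul (Nat.zero_le k) τ
  rw [permTower.cyc_zero, one_mul, SymTower.cyc_zero, one_mul] at h
  exact h

end Evaluation

/-! ### Formal morphisms and permutations, simultaneously in two categories -/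

section Comparison

universe v₁ u₁ v₂ u₂

variable {C : Type u₁} [Category.{v₁} C] [MonoidalCategory C] [SymmetricCategory C]
  {D : Type u₂} [Category.{v₂} D] [MonoidalCategory D] [SymmetricCategory D] (X : C) (Y : D)

/-- A composition of exchanges is the action of a permutation, which does not depend on the
category. -/
lemma PHom.exists_perm {a b : ℕ} (p : PHom a b) : ∃ (h : a = b) (σ : Equiv.Perm (Fin a)),
    p.ev X ≫ (powIso X b).hom = (powIso X a).hom ≫ permAct X a σ ≫ eqToHom (by rw [h]) ∧
    p.ev Y ≫ (powIso Y b).hom = (powIso Y a).hom ≫ permAct Y a σ ≫ eqToHom (by rw [h]) := by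
  induction p with
  | id a =>
    refine ⟨rfl, 1, ?_, ?_⟩ <;> rw [map_one, eqToHom_refl, Category.comp_id] <;>
    exact id_square _
  | comp p q hp hq =>
    obtain ⟨rfl, σ, h1, h2⟩ := hp
    obtain ⟨rfl, τ, h3, h4⟩ := hq
    rw [eqToHom_refl, Category.comp_id] at h1 h2 h3 h4
    refine ⟨rfl, τ * σ, ?_, ?_⟩ <;> rw [map_mul, eqToHom_refl, Category.comp_id]
    · exact comp_square h1 h3
    · exact comp_square h2 h4
  | exch a =>
    refine ⟨rfl, Equiv.swap (Fin.castSucc 0) (Fin.succ 0), ?_, ?_⟩ <;>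
    rw [permAct_swap _ (a + 1) 0, eqToHom_refl, Category.comp_id] <;>
    exact PHom.ev_adj _ (a + 2) 0
  | whisk p hp =>
    obtain ⟨rfl, σ, h1, h2⟩ := hp
    rw [eqToHom_refl, Category.comp_id] at h1 h2
    refine ⟨rfl, permShift _ σ, ?_, ?_⟩ <;>
    rw [eqToHom_refl, Category.comp_id, permAct_permShift]
    · exact comp_powIso_hom_succ X h1
    · exact comp_powIso_hom_succ Y h2

/-- Every permutation is a composition of exchanges. -/
lemma PHom.exists_of_perm (a : ℕ) (σ : Equiv.Perm (Fin a)) : ∃ p : PHom a a,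
    p.ev X ≫ (powIso X a).hom = (powIso X a).hom ≫ permAct X a σ ∧
    p.ev Y ≫ (powIso Y a).hom = (powIso Y a).hom ≫ permAct Y a σ := by
  cases a with
  | zero =>
    obtain rfl : σ = 1 := Subsingleton.elim _ _
    exact ⟨.id 0, by rw [map_one]; exact id_square _, by rw [map_one]; exact id_square _⟩
  | succ k =>
    have hσ : σ ∈ Submonoid.closure
        (Set.range fun i : Fin k ↦ Equiv.swap i.castSucc i.succ) := by
      rw [Equiv.Perm.mclosure_swap_castSucc_succ]; trivial
    induction hσ using Submonoid.closure_induction with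
    | mem x hx =>
      obtain ⟨i, rfl⟩ := hx
      dsimp only
      exact ⟨adj _ i, by rw [permAct_swap, ev_adj], by rw [permAct_swap, ev_adj]⟩
    | one => exact ⟨.id _, by rw [map_one]; exact id_square _, by rw [map_one]; exact id_square _⟩
    | mul x y _ _ hx hy =>
      obtain ⟨p, h1, h2⟩ := hx
      obtain ⟨q, h3, h4⟩ := hy
      exact ⟨.comp q p, by rw [map_mul]; exact comp_square h3 h1,
        by rw [map_mul]; exact comp_square h4 h2⟩

/-- Formal morphisms evaluate to actions of permutations. -/
lemma FHom.exists_perm {w u : Word} (f : FHom w u) :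
    ∃ (h : w.len 0 = u.len 0) (σ : Equiv.Perm (Fin (w.len 0))),
    f.ev X ≫ (normIso X u).hom = (normIso X w).hom ≫ permAct X _ σ ≫ eqToHom (by rw [h]) ∧
    f.ev Y ≫ (normIso Y u).hom = (normIso Y w).hom ≫ permAct Y _ σ ≫ eqToHom (by rw [h]) := by
  obtain ⟨h, σ, h1, h2⟩ := (f.toPHom 0).exists_perm X Y
  refine ⟨h, σ, ?_, ?_⟩
  · have := f.ev_norm X 0
    simp only [normIso, Iso.trans_hom, Iso.symm_hom, Category.assoc, ← h1]
    rw [← reassoc_of% this]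
    simp
  · have := f.ev_norm Y 0
    simp only [normIso, Iso.trans_hom, Iso.symm_hom, Category.assoc, ← h2]
    rw [← reassoc_of% this]
    simp

/-- Actions of permutations come from formal morphisms. -/
lemma FHom.exists_of_perm (w u : Word) (h : w.len 0 = u.len 0)
    (σ : Equiv.Perm (Fin (w.len 0))) : ∃ f : FHom w u,
    f.ev X ≫ (normIso X u).hom = (normIso X w).hom ≫ permAct X _ σ ≫ eqToHom (by rw [h]) ∧
    f.ev Y ≫ (normIso Y u).hom = (normIso Y w).hom ≫ permAct Y _ σ ≫ eqToHom (by rw [h]) := by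
  obtain ⟨p, h1, h2⟩ := PHom.exists_of_perm X Y _ σ
  obtain ⟨q, h3, h4⟩ : ∃ q : PHom (w.len 0) (u.len 0),
      q.ev X ≫ (powIso X _).hom = (powIso X _).hom ≫ permAct X _ σ ≫ eqToHom (by rw [h]) ∧
      q.ev Y ≫ (powIso Y _).hom = (powIso Y _).hom ≫ permAct Y _ σ ≫ eqToHom (by rw [h]) := by
    generalize u.len 0 = b at h
    subst h
    exact ⟨p, by simpa using h1, by simpa using h2⟩
  -- Conjugation with the normalisations; the unit added on the right is the power of degree zero on
  -- which they start.
  refine ⟨.comp (.rightInv w) (.comp (norm w 0) (.comp q.toFHom (.comp (normInv u 0)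
    (.right u)))), ?_, ?_⟩
  · have := FHom.normInv_norm X u 0
    simp [ev, normIso, PHom.ev_toFHom, reassoc_of% this, h3]
  · have := FHom.normInv_norm Y u 0
    simp [ev, normIso, PHom.ev_toFHom, reassoc_of% this, h4]

end Comparison
end RepGL

/-! ### Extension of functors from words to retracts of sums of words -/

namespace RepGL

section Extension

open Limits

universe v₁ u₁ v₂ u₂ u

variable {K : Type u} [Field K]
  {A : Type u₁} [Category.{v₁} A] [Preadditive A] [Linear K A] [MonoidalCategory A]
  [SymmetricCategory A]
  {C : Type u₂} [Category.{v₂} C] [Preadditive C] [Linear K C] [MonoidalCategory C]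
  [SymmetricCategory C]

variable (K) in
/-- A linear functor defined on the evaluations of words, compatible with the structure of a
symmetric monoidal category. -/
structure WordFunctor (V : A) (X : C) where
  /-- the action on morphisms -/
  map : ∀ {w u : Word}, (w.ev V ⟶ u.ev V) →ₗ[K] (w.ev X ⟶ u.ev X)
  map_ev : ∀ {w u : Word} (f : FHom w u), map (f.ev V) = f.ev X
  map_comp : ∀ {w u v : Word} (f : w.ev V ⟶ u.ev V) (g : u.ev V ⟶ v.ev V),
    map (f ≫ g) = map f ≫ map g
  map_tensor : ∀ {w w' u u' : Word} (f : w.ev V ⟶ w'.ev V) (g : u.ev V ⟶ u'.ev V),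
    map (w := w.ten u) (u := w'.ten u') (f ⊗ₘ g) = map f ⊗ₘ map g

/-- A presentation of an object as a retract of a finite direct sum of evaluations of words. -/
structure WordPresentation (V W : A) where
  /-- the index set -/
  ι : Type
  [fintype : Fintype ι]
  /-- the words -/
  word : ι → Word
  /-- the components of the inclusion -/
  inc : ∀ i, W ⟶ (word i).ev V
  /-- the components of the retraction -/
  ret : ∀ i, (word i).ev V ⟶ W
  sum_eq : ∑ i, inc i ≫ ret i = 𝟙 W

attribute [instance] WordPresentation.fintype

/-- An object of the target corresponding to an object `W` of the source. -/
structure WordHull {V : A} {X : C} (G : WordFunctor K V X) {W : A} (P : WordPresentation V W) where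
  /-- the object -/
  obj : C
  /-- the images of the morphisms from words to `W` -/
  into : ∀ {w : Word}, (w.ev V ⟶ W) →ₗ[K] (w.ev X ⟶ obj)
  /-- the images of the morphisms from `W` to words -/
  out : ∀ {w : Word}, (W ⟶ w.ev V) →ₗ[K] (obj ⟶ w.ev X)
  map_into : ∀ {w u : Word} (f : w.ev V ⟶ u.ev V) (a : u.ev V ⟶ W),
    G.map f ≫ into a = into (f ≫ a)
  out_map : ∀ {w u : Word} (b : W ⟶ w.ev V) (f : w.ev V ⟶ u.ev V),
    out b ≫ G.map f = out (b ≫ f)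
  into_out : ∀ {w u : Word} (a : w.ev V ⟶ W) (b : W ⟶ u.ev V), into a ≫ out b = G.map (a ≫ b)
  sum_eq : ∑ i, out (P.inc i) ≫ into (P.ret i) = 𝟙 obj

/-- In the source, `W` is the image of the idempotent matrix with entries `ret k ≫ inc l` on the sum
of its words. Applying `G` to the entries gives an idempotent `e` on the sum `B` of the evaluations
at `X`, and the hull is the object splitting `e`. -/
lemma WordHull.nonempty [HasFiniteBiproducts C] [IsIdempotentComplete C] {V : A} {X : C}
    (G : WordFunctor K V X) {W : A} (P : WordPresentation V W) : Nonempty (WordHull G P) := by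
  let B : C := ⨁ fun i => (P.word i).ev X
  have key : ∀ {w u : Word} (a : w.ev V ⟶ W) (b : W ⟶ u.ev V),
      ∑ i, G.map (a ≫ P.inc i) ≫ G.map (P.ret i ≫ b) = G.map (a ≫ b) := by
    intro w u a b
    simp only [← G.map_comp, ← map_sum]
    congr 1
    simp only [Category.assoc, ← Preadditive.comp_sum]
    simp only [← Category.assoc (P.inc _), ← Preadditive.sum_comp, P.sum_eq, Category.id_comp]
  let j : ∀ {w : Word}, (w.ev V ⟶ W) →ₗ[K] (w.ev X ⟶ B) := fun {w} =>
    { toFun a := biproduct.lift fun i => G.map (a ≫ P.inc i)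
      map_add' a b := by ext; simp
      map_smul' r a := by ext; simp }
  let p : ∀ {w : Word}, (W ⟶ w.ev V) →ₗ[K] (B ⟶ w.ev X) := fun {w} =>
    { toFun b := biproduct.desc fun i => G.map (P.ret i ≫ b)
      map_add' a b := by ext; simp
      map_smul' r a := by ext; simp }
  have hjp : ∀ {w u : Word} (a : w.ev V ⟶ W) (b : W ⟶ u.ev V), j a ≫ p b = G.map (a ≫ b) := by
    intro w u a b
    change biproduct.lift _ ≫ biproduct.desc _ = _
    rw [biproduct.lift_desc, key]
  have hGj : ∀ {w u : Word} (f : w.ev V ⟶ u.ev V) (a : u.ev V ⟶ W), G.map f ≫ j a = j (f ≫ a) := by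
    intro w u f a
    apply biproduct.hom_ext
    intro i
    change (_ ≫ biproduct.lift _) ≫ _ = biproduct.lift _ ≫ _
    simp [G.map_comp]
  have hpG : ∀ {w u : Word} (b : W ⟶ w.ev V) (f : w.ev V ⟶ u.ev V), p b ≫ G.map f = p (b ≫ f) := by
    intro w u f a
    apply biproduct.hom_ext'
    intro i
    change _ ≫ (biproduct.desc _ ≫ _) = _ ≫ biproduct.desc _
    rw [biproduct.ι_desc_assoc, biproduct.ι_desc, ← G.map_comp, Category.assoc]
  let e : B ⟶ B := ∑ i, p (P.inc i) ≫ j (P.ret i)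
  have hje : ∀ {w : Word} (a : w.ev V ⟶ W), j a ≫ e = j a := by
    intro w a
    simp only [e, Preadditive.comp_sum]
    simp only [← Category.assoc, hjp, hGj, ← map_sum]
    congr 1
    simp only [Category.assoc, ← Preadditive.comp_sum, P.sum_eq, Category.comp_id]
  have hep : ∀ {w : Word} (b : W ⟶ w.ev V), e ≫ p b = p b := by
    intro w b
    simp only [e, Preadditive.sum_comp, Category.assoc, hjp, hpG, ← map_sum]
    congr 1
    simp only [← Category.assoc, ← Preadditive.sum_comp, P.sum_eq, Category.id_comp]
  have hee : e ≫ e = e := by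
    conv_lhs => enter [1]; simp only [e]
    simp only [Preadditive.sum_comp, Category.assoc, hje]
    rfl
  obtain ⟨Y, i, q, h1, h2⟩ := IsIdempotentComplete.idempotents_split B e hee
  refine ⟨⟨Y, (Linear.rightComp K _ q).comp j, (Linear.leftComp K _ i).comp p, ?_, ?_, ?_, ?_⟩⟩
  · intro w u f a
    change _ ≫ j a ≫ q = j _ ≫ q
    rw [← hGj, Category.assoc]
  · intro w u f a
    change (i ≫ p f) ≫ _ = i ≫ p _
    rw [← hpG, Category.assoc]
  · intro w u a b
    change (j a ≫ q) ≫ (i ≫ p b) = _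
    rw [Category.assoc, reassoc_of% h2, hep, hjp]
  · change ∑ k, (i ≫ p _) ≫ (j _ ≫ q) = _
    have : ∑ k, (i ≫ p (P.inc k)) ≫ (j (P.ret k) ≫ q) = i ≫ e ≫ q := by
      simp only [e, Preadditive.sum_comp, Preadditive.comp_sum, Category.assoc]
    rw [this, ← h2, Category.assoc, h1, Category.comp_id, h1]

namespace WordHull

variable {V : A} {X : C} {G : WordFunctor K V X}

section

variable {W : A} {P : WordPresentation V W} (H : WordHull G P)

-- By `sum_eq` the morphisms `into a` are jointly epimorphic, so identities of morphisms out of a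
-- hull can be tested on words.
include H in
lemma hom_ext {Y : C} {f g : H.obj ⟶ Y}
    (h : ∀ (w : Word) (a : w.ev V ⟶ W), H.into a ≫ f = H.into a ≫ g) : f = g := by
  rw [← Category.id_comp f, ← Category.id_comp g, ← H.sum_eq, Preadditive.sum_comp,
    Preadditive.sum_comp]
  simp only [Category.assoc, h]

/-- The morphism out of a hull determined by a compatible family. -/
def desc {Y : C} (φ : ∀ w : Word, (w.ev V ⟶ W) →ₗ[K] (w.ev X ⟶ Y)) : H.obj ⟶ Y :=
  ∑ i, H.out (P.inc i) ≫ φ _ (P.ret i)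

lemma into_desc {Y : C} (φ : ∀ w : Word, (w.ev V ⟶ W) →ₗ[K] (w.ev X ⟶ Y))
    (hφ : ∀ {w u : Word} (f : w.ev V ⟶ u.ev V) (a : u.ev V ⟶ W), G.map f ≫ φ _ a = φ _ (f ≫ a))
    {w : Word} (a : w.ev V ⟶ W) : H.into a ≫ H.desc φ = φ _ a := by
  simp only [desc, Preadditive.comp_sum, reassoc_of% H.into_out, hφ, ← map_sum]
  congr 1
  simp only [Category.assoc, ← Preadditive.comp_sum, P.sum_eq, Category.comp_id]

end

variable {W₁ W₂ W₃ : A} {P₁ : WordPresentation V W₁} {P₂ : WordPresentation V W₂}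
  {P₃ : WordPresentation V W₃} (H₁ : WordHull G P₁) (H₂ : WordHull G P₂) (H₃ : WordHull G P₃)

/-- The morphism between hulls induced by a morphism. -/
def map (f : W₁ ⟶ W₂) : H₁.obj ⟶ H₂.obj :=
  H₁.desc fun _ => H₂.into.comp (Linear.rightComp K _ f)

@[simp]
lemma into_map (f : W₁ ⟶ W₂) {w : Word} (a : w.ev V ⟶ W₁) :
    H₁.into a ≫ H₁.map H₂ f = H₂.into (a ≫ f) := by
  rw [map, into_desc]
  · rfl
  · intro w u g a
    change _ ≫ H₂.into (_ ≫ _) = H₂.into (_ ≫ _)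
    rw [H₂.map_into, Category.assoc]

lemma map_add (f g : W₁ ⟶ W₂) : H₁.map H₂ (f + g) = H₁.map H₂ f + H₁.map H₂ g :=
  H₁.hom_ext fun w a => by simp

lemma map_smul (r : K) (f : W₁ ⟶ W₂) : H₁.map H₂ (r • f) = r • H₁.map H₂ f :=
  H₁.hom_ext fun w a => by simp

variable [MonoidalPreadditive C] [MonoidalPreadditive A]

-- Tensor products of the morphisms `into` are jointly epimorphic as well: the two decompositions of
-- the identity are tensored.
include H₁ H₂ in
lemma tensor_hom_ext {Y : C} {f g : H₁.obj ⊗ H₂.obj ⟶ Y}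
    (h : ∀ (w u : Word) (a : w.ev V ⟶ W₁) (b : u.ev V ⟶ W₂),
      (H₁.into a ⊗ₘ H₂.into b) ≫ f = (H₁.into a ⊗ₘ H₂.into b) ≫ g) : f = g := by
  have : (𝟙 (H₁.obj ⊗ H₂.obj)) = ∑ i, ∑ j, (H₁.out (P₁.inc i) ⊗ₘ H₂.out (P₂.inc j)) ≫
      (H₁.into (P₁.ret i) ⊗ₘ H₂.into (P₂.ret j)) := by
    simp only [tensorHom_comp_tensorHom, ← tensor_sum, ← sum_tensor, H₁.sum_eq, H₂.sum_eq,
      id_tensorHom_id]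
  rw [← Category.id_comp f, ← Category.id_comp g, this]
  simp only [Preadditive.sum_comp, Category.assoc, h]

include H₁ H₂ H₃ in
lemma tensor_tensor_hom_ext {Y : C} {f g : (H₁.obj ⊗ H₂.obj) ⊗ H₃.obj ⟶ Y}
    (h : ∀ (w u v : Word) (a : w.ev V ⟶ W₁) (b : u.ev V ⟶ W₂) (c : v.ev V ⟶ W₃),
      ((H₁.into a ⊗ₘ H₂.into b) ⊗ₘ H₃.into c) ≫ f =
        ((H₁.into a ⊗ₘ H₂.into b) ⊗ₘ H₃.into c) ≫ g) : f = g := by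
  have : (𝟙 ((H₁.obj ⊗ H₂.obj) ⊗ H₃.obj)) = ∑ i, ∑ j, ∑ k,
      ((H₁.out (P₁.inc i) ⊗ₘ H₂.out (P₂.inc j)) ⊗ₘ H₃.out (P₃.inc k)) ≫
      ((H₁.into (P₁.ret i) ⊗ₘ H₂.into (P₂.ret j)) ⊗ₘ H₃.into (P₃.ret k)) := by
    simp only [tensorHom_comp_tensorHom, ← tensor_sum, ← sum_tensor, H₁.sum_eq, H₂.sum_eq,
      H₃.sum_eq, id_tensorHom_id]
  rw [← Category.id_comp f, ← Category.id_comp g, this]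
  simp only [Preadditive.sum_comp, Category.assoc, h]

variable {P : WordPresentation V (W₁ ⊗ W₂)} (H : WordHull G P)

/-- The tensorator. -/
def mu : H₁.obj ⊗ H₂.obj ⟶ H.obj :=
  ∑ i, ∑ j, (H₁.out (P₁.inc i) ⊗ₘ H₂.out (P₂.inc j)) ≫
    H.into (w := (P₁.word i).ten (P₂.word j)) (P₁.ret i ⊗ₘ P₂.ret j)

/-- The inverse of the tensorator. -/
def delta : H.obj ⟶ H₁.obj ⊗ H₂.obj :=
  ∑ i, ∑ j, H.out (w := (P₁.word i).ten (P₂.word j)) (P₁.inc i ⊗ₘ P₂.inc j) ≫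
    (H₁.into (P₁.ret i) ⊗ₘ H₂.into (P₂.ret j))

/-- This characterises the tensorator. `into_out` turns the composites into values of `G`,
`map_tensor` merges them, and the two presentations sum to identities. -/
lemma into_mu {w u : Word} (a : w.ev V ⟶ W₁) (b : u.ev V ⟶ W₂) :
    (H₁.into a ⊗ₘ H₂.into b) ≫ H₁.mu H₂ H = H.into (w := w.ten u) (a ⊗ₘ b) := by
  simp only [mu, Preadditive.comp_sum, tensorHom_comp_tensorHom_assoc, H₁.into_out, H₂.into_out,
    ← G.map_tensor]
  have : ∀ i j, (G.map (w := w.ten u) (u := (P₁.word i).ten (P₂.word j))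
      ((a ≫ P₁.inc i) ⊗ₘ (b ≫ P₂.inc j))) ≫
      H.into (w := (P₁.word i).ten (P₂.word j)) (P₁.ret i ⊗ₘ P₂.ret j) =
      H.into (w := w.ten u) ((a ≫ P₁.inc i ≫ P₁.ret i) ⊗ₘ (b ≫ P₂.inc j ≫ P₂.ret j)) := by
    intro i j
    rw [H.map_into]
    congr 1
    erw [tensorHom_comp_tensorHom]
    simp
  erw [Finset.sum_congr rfl fun i _ => Finset.sum_congr rfl fun j _ => this i j]
  simp only [← map_sum]
  congr 1
  simp only [← tensor_sum, ← sum_tensor, ← Preadditive.comp_sum, P₁.sum_eq, P₂.sum_eq,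
    Category.comp_id]

lemma delta_mu : H₁.delta H₂ H ≫ H₁.mu H₂ H = 𝟙 _ := by
  refine H.hom_ext fun w a => ?_
  simp only [delta, Preadditive.sum_comp, Preadditive.comp_sum, Category.assoc, into_mu,
    reassoc_of% H.into_out, Category.comp_id]
  have : ∀ i j, (G.map (u := (P₁.word i).ten (P₂.word j)) (a ≫ (P₁.inc i ⊗ₘ P₂.inc j))) ≫
      H.into (w := (P₁.word i).ten (P₂.word j)) (P₁.ret i ⊗ₘ P₂.ret j) =
      H.into (a ≫ ((P₁.inc i ≫ P₁.ret i) ⊗ₘ (P₂.inc j ≫ P₂.ret j))) := by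
    intro i j
    rw [H.map_into, Category.assoc]
    congr 2
    erw [tensorHom_comp_tensorHom]
  erw [Finset.sum_congr rfl fun i _ => Finset.sum_congr rfl fun j _ => this i j]
  simp only [← map_sum]
  congr 1
  simp only [← tensor_sum, ← sum_tensor, ← Preadditive.comp_sum, P₁.sum_eq, P₂.sum_eq,
    Category.comp_id, id_tensorHom_id]

lemma mu_delta : H₁.mu H₂ H ≫ H₁.delta H₂ H = 𝟙 _ := by
  refine tensor_hom_ext H₁ H₂ fun w u a b => ?_
  rw [reassoc_of% into_mu]
  simp only [delta, Preadditive.comp_sum, reassoc_of% H.into_out, Category.comp_id]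
  have : ∀ i j, G.map (w := w.ten u) (u := (P₁.word i).ten (P₂.word j))
      ((a ⊗ₘ b) ≫ (P₁.inc i ⊗ₘ P₂.inc j)) ≫ (H₁.into (P₁.ret i) ⊗ₘ H₂.into (P₂.ret j)) =
      (H₁.into (a ≫ P₁.inc i ≫ P₁.ret i)) ⊗ₘ (H₂.into (b ≫ P₂.inc j ≫ P₂.ret j)) := by
    intro i j
    rw [tensorHom_comp_tensorHom, G.map_tensor, tensorHom_comp_tensorHom, H₁.map_into,
      H₂.map_into, Category.assoc, Category.assoc]
  erw [Finset.sum_congr rfl fun i _ => Finset.sum_congr rfl fun j _ => this i j]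
  simp only [← tensor_sum, ← sum_tensor, ← map_sum, ← Preadditive.comp_sum, P₁.sum_eq, P₂.sum_eq,
    Category.comp_id]

/-- The hull of the evaluation of a word. -/
def wordIso {w : Word} {P : WordPresentation V (w.ev V)} (H : WordHull G P) : w.ev X ≅ H.obj where
  hom := H.into (𝟙 _)
  inv := H.out (𝟙 _)
  hom_inv_id := by
    rw [H.into_out, Category.comp_id]
    exact G.map_ev (.id w)
  inv_hom_id := by
    refine H.hom_ext fun u a => ?_
    rw [reassoc_of% H.into_out, H.map_into, Category.comp_id, Category.comp_id, Category.comp_id]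

section Coherence

variable (J : ∀ W : A, Σ P : WordPresentation V W, WordHull G P)

lemma map_mu_left {W₁ W₂ : A} (f : W₁ ⟶ W₂) (W : A) :
    (J W₁).2.map (J W₂).2 f ▷ (J W).2.obj ≫ (J W₂).2.mu (J W).2 (J (W₂ ⊗ W)).2 =
      (J W₁).2.mu (J W).2 (J (W₁ ⊗ W)).2 ≫ (J _).2.map (J _).2 (f ▷ W) := by
  refine tensor_hom_ext (J W₁).2 (J W).2 fun w u a b => ?_
  rw [← tensorHom_id, tensorHom_comp_tensorHom_assoc, into_map, Category.comp_id,
    into_mu, reassoc_of% into_mu, into_map]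
  congr 1
  rw [← tensorHom_id]
  erw [tensorHom_comp_tensorHom]
  rw [Category.comp_id]

lemma map_mu_right {W₁ W₂ : A} (W : A) (f : W₁ ⟶ W₂) :
    (J W).2.obj ◁ (J W₁).2.map (J W₂).2 f ≫ (J W).2.mu (J W₂).2 (J (W ⊗ W₂)).2 =
      (J W).2.mu (J W₁).2 (J (W ⊗ W₁)).2 ≫ (J _).2.map (J _).2 (W ◁ f) := by
  refine tensor_hom_ext (J W).2 (J W₁).2 fun w u a b => ?_
  rw [← id_tensorHom, tensorHom_comp_tensorHom_assoc, into_map, Category.comp_id,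
    into_mu, reassoc_of% into_mu, into_map]
  congr 1
  rw [← id_tensorHom]
  erw [tensorHom_comp_tensorHom]
  rw [Category.comp_id]

/-- Tested on words, both sides become a value of `into`; what remains is that `G` respects the
formal associator, together with naturality of the associators. The unit and braiding laws below
follow the same pattern. -/
lemma mu_assoc (W₁ W₂ W₃ : A) :
    (J W₁).2.mu (J W₂).2 (J (W₁ ⊗ W₂)).2 ▷ (J W₃).2.obj ≫
        (J _).2.mu (J W₃).2 (J ((W₁ ⊗ W₂) ⊗ W₃)).2 ≫ (J _).2.map (J _).2 (α_ W₁ W₂ W₃).hom =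
      (α_ _ _ _).hom ≫ (J W₁).2.obj ◁ (J W₂).2.mu (J W₃).2 (J (W₂ ⊗ W₃)).2 ≫
        (J W₁).2.mu (J _).2 (J (W₁ ⊗ W₂ ⊗ W₃)).2 := by
  refine tensor_tensor_hom_ext (J W₁).2 (J W₂).2 (J W₃).2 fun w u v a b c => ?_
  have h := G.map_ev (.assoc w u v)
  simp only [FHom.ev] at h
  rw [← tensorHom_id, ← id_tensorHom, tensorHom_comp_tensorHom_assoc, Category.comp_id,
    into_mu, reassoc_of% into_mu, into_map, associator_naturality_assoc,
    tensorHom_comp_tensorHom_assoc, Category.comp_id, into_mu, into_mu, ← h]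
  erw [map_into, associator_naturality]

lemma mu_left_unit (W : A) :
    (λ_ (J W).2.obj).hom = (wordIso (w := .one) (J (𝟙_ A)).2).hom ▷ (J W).2.obj ≫
      (J (𝟙_ A)).2.mu (J W).2 (J (𝟙_ A ⊗ W)).2 ≫ (J _).2.map (J W).2 (λ_ W).hom := by
  rw [← cancel_epi (λ_ (J W).2.obj).inv]
  refine hom_ext (J W).2 fun w a => ?_
  have h := G.map_ev (.left w)
  simp only [FHom.ev] at h
  rw [leftUnitor_inv_naturality_assoc, leftUnitor_inv_naturality_assoc, ← id_tensorHom,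
    ← tensorHom_id, tensorHom_comp_tensorHom_assoc, Category.id_comp, Category.comp_id]
  dsimp only [wordIso]
  rw [reassoc_of% into_mu, into_map]
  erw [id_tensorHom, leftUnitor_naturality, id_tensorHom, leftUnitor_naturality, ← map_into, h]

lemma mu_right_unit (W : A) :
    (ρ_ (J W).2.obj).hom = (J W).2.obj ◁ (wordIso (w := .one) (J (𝟙_ A)).2).hom ≫
      (J W).2.mu (J (𝟙_ A)).2 (J (W ⊗ 𝟙_ A)).2 ≫ (J _).2.map (J W).2 (ρ_ W).hom := by
  rw [← cancel_epi (ρ_ (J W).2.obj).inv]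
  refine hom_ext (J W).2 fun w a => ?_
  have h := G.map_ev (.right w)
  simp only [FHom.ev] at h
  rw [rightUnitor_inv_naturality_assoc, rightUnitor_inv_naturality_assoc, ← id_tensorHom,
    ← tensorHom_id, tensorHom_comp_tensorHom_assoc, Category.id_comp, Category.comp_id]
  dsimp only [wordIso]
  rw [reassoc_of% into_mu, into_map]
  erw [tensorHom_id, rightUnitor_naturality, tensorHom_id, rightUnitor_naturality, ← map_into, h]

lemma mu_braiding (W₁ W₂ : A) :
    (J W₁).2.mu (J W₂).2 (J (W₁ ⊗ W₂)).2 ≫ (J _).2.map (J _).2 (β_ W₁ W₂).hom =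
      (β_ _ _).hom ≫ (J W₂).2.mu (J W₁).2 (J (W₂ ⊗ W₁)).2 := by
  refine tensor_hom_ext (J W₁).2 (J W₂).2 fun w u a b => ?_
  have h := G.map_ev (.braid w u)
  simp only [FHom.ev] at h
  rw [reassoc_of% into_mu, into_map, BraidedCategory.braiding_naturality_assoc, into_mu, ← h]
  erw [map_into, BraidedCategory.braiding_naturality]

end Coherence

end WordHull

namespace WordFunctor

variable {V : A} {X : C} (G : WordFunctor K V X)
  (J : ∀ W : A, Σ P : WordPresentation V W, WordHull G P)

/-- The extension of a functor defined on words. -/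
@[simps]
def extend : A ⥤ C where
  obj W := (J W).2.obj
  map f := (J _).2.map (J _).2 f
  map_id W := (J W).2.hom_ext fun w a => by simp
  map_comp f g := (J _).2.hom_ext fun w a => by
    rw [reassoc_of% (J _).2.into_map, WordHull.into_map, WordHull.into_map, Category.assoc]

lemma extend_additive : (G.extend J).Additive where
  map_add := WordHull.map_add _ _ _ _

lemma extend_linear : (G.extend J).Linear K where
  map_smul f r := WordHull.map_smul _ _ r f

variable [MonoidalPreadditive C] [MonoidalPreadditive A]

/-- The extension of a functor defined on words is monoidal. -/
def extendCore : (G.extend J).CoreMonoidal where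
  εIso := WordHull.wordIso (w := .one) (J (𝟙_ A)).2
  μIso W₁ W₂ :=
    { hom := (J W₁).2.mu (J W₂).2 (J _).2
      inv := (J W₁).2.delta (J W₂).2 (J _).2
      hom_inv_id := WordHull.mu_delta _ _ _
      inv_hom_id := WordHull.delta_mu _ _ _ }
  μIso_hom_natural_left f W := WordHull.map_mu_left J f W
  μIso_hom_natural_right W f := WordHull.map_mu_right J W f
  associativity W₁ W₂ W₃ := WordHull.mu_assoc J W₁ W₂ W₃
  left_unitality W := WordHull.mu_left_unit J W
  right_unitality W := WordHull.mu_right_unit J W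

/-- A functor defined on words extends to a braided functor, if every object has a presentation by
words. -/
theorem exists_braided (G : WordFunctor K V X) [HasFiniteBiproducts C] [IsIdempotentComplete C]
    (hP : ∀ W : A, Nonempty (WordPresentation V W)) :
    ∃ (F : A ⥤ C) (_ : F.Braided), F.Additive ∧ F.Linear K ∧ Nonempty (F.obj V ≅ X) := by
  let J : ∀ W : A, Σ P : WordPresentation V W, WordHull G P := fun W =>
    ⟨(hP W).some, (WordHull.nonempty G _).some⟩
  let _ : (G.extend J).Monoidal := (G.extendCore J).toMonoidal
  exact ⟨G.extend J, { braided := fun W₁ W₂ => WordHull.mu_braiding J W₁ W₂ },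
    G.extend_additive J, G.extend_linear J, ⟨(WordHull.wordIso (w := .gen) (J V).2).symm⟩⟩

end WordFunctor

end Extension
end RepGL

/-! ### Tensor powers of the standard representation in coordinates -/

namespace RepGL

section LinearMaps

universe u

variable {K : Type u} [Field K] {n : ℕ}

namespace PolyRep

/-- The linear map underlying a morphism of polynomial representations. -/
def lin {W U : PolyRep K n} (f : W ⟶ U) : W.obj →ₗ[K] U.obj := f.hom.hom.hom.hom

/-- The morphism of polynomial representations given by an equivariant linear map. -/
def ofLin {W U : PolyRep K n} (L : W.obj →ₗ[K] U.obj)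
    (h : ∀ g v, L (W.obj.ρ g v) = U.obj.ρ g (L v)) : W ⟶ U :=
  ObjectProperty.homMk ⟨ObjectProperty.homMk (ModuleCat.ofHom L), fun g => by
    ext v
    exact h g v⟩

lemma lin_injective {W U : PolyRep K n} {f g : W ⟶ U} (h : lin f = lin g) : f = g := by
  apply ObjectProperty.hom_ext
  apply Action.Hom.ext
  apply ObjectProperty.hom_ext
  exact ModuleCat.hom_ext h

lemma lin_comm {W U : PolyRep K n} (f : W ⟶ U) (g : GL (Fin n) K) (v : W.obj) :
    lin f (W.obj.ρ g v) = U.obj.ρ g (lin f v) :=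
  congrArg (fun t => t.hom.hom v) (f.hom.comm g)

@[simp] lemma lin_comp {W U T : PolyRep K n} (f : W ⟶ U) (g : U ⟶ T) :
    lin (f ≫ g) = (lin g).comp (lin f) := rfl

@[simp] lemma lin_smul {W U : PolyRep K n} (r : K) (f : W ⟶ U) : lin (r • f) = r • lin f := rfl

@[simp] lemma lin_zero {W U : PolyRep K n} : lin (0 : W ⟶ U) = 0 := rfl

variable (K n) in
/-- `lin` as a linear map. -/
def linHom (W U : PolyRep K n) : (W ⟶ U) →ₗ[K] (W.obj →ₗ[K] U.obj) where
  toFun := lin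
  map_add' _ _ := rfl
  map_smul' _ _ := rfl

@[simp] lemma lin_sum {W U : PolyRep K n} {ι : Type*} (s : Finset ι) (f : ι → (W ⟶ U)) :
    lin (∑ i ∈ s, f i) = ∑ i ∈ s, lin (f i) := map_sum (linHom K n W U) f s

lemma lin_whiskerLeft (T : PolyRep K n) {W U : PolyRep K n} (f : W ⟶ U) (t : T.obj) (w : W.obj) :
    lin (T ◁ f) (t ⊗ₜ[K] w) = t ⊗ₜ[K] (lin f w) := rfl

lemma lin_exch (T W U : PolyRep K n) (t : T.obj) (w : W.obj) (v : U.obj) :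
    lin (exch T W U) (t ⊗ₜ[K] (w ⊗ₜ[K] v)) = w ⊗ₜ[K] (t ⊗ₜ[K] v) := rfl

end PolyRep

open PolyRep

variable (K n)

/-- The tensor powers of the standard representation. -/
noncomputable abbrev stdPow (k : ℕ) : PolyRep K n := tensorPow (stdRep K n) k

/-- The basis of a tensor power of the standard representation. -/
noncomputable def stdPowBasis : ∀ k : ℕ, Module.Basis (Fin k → Fin n) K (stdPow K n k).obj
  | 0 => (Module.Basis.singleton (Fin 0 → Fin n) K :)
  | k + 1 => (((Pi.basisFun K (Fin n)).tensorProduct (stdPowBasis k)).reindex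
      (Fin.consEquiv fun _ => Fin n) :)

lemma stdPowBasis_succ (k : ℕ) (i : Fin (k + 1) → Fin n) :
    stdPowBasis K n (k + 1) i =
      (Pi.single (i 0) 1 : Fin n → K) ⊗ₜ[K] stdPowBasis K n k (Fin.tail i) := by
  change (((Pi.basisFun K (Fin n)).tensorProduct (stdPowBasis K n k)).reindex
      (Fin.consEquiv fun _ => Fin n)) i = _
  rw [Module.Basis.reindex_apply, Module.Basis.tensorProduct_apply']
  simp [Fin.consEquiv]

lemma exchAt_stdPowBasis : ∀ (k i : ℕ) (j : Fin k → Fin n),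
    lin (exchAt (stdRep K n) k i) (stdPowBasis K n k j) =
      stdPowBasis K n k (j ∘ permTower.adj k i)
  | 0, _, _ => rfl
  | 1, 0, _ => rfl
  | k + 2, 0, j => by
    rw [exchAt_zero, stdPowBasis_succ, stdPowBasis_succ, stdPowBasis_succ, stdPowBasis_succ]
    erw [lin_exch]
    have h0 : (j ∘ permTower.adj (k + 2) 0) 0 = j 1 := congrArg j (Equiv.swap_apply_left 0 1)
    have h1 : Fin.tail (j ∘ permTower.adj (k + 2) 0) 0 = j 0 :=
      congrArg j (Equiv.swap_apply_right 0 1)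
    have h2 : Fin.tail (Fin.tail (j ∘ permTower.adj (k + 2) 0)) = Fin.tail (Fin.tail j) := by
      funext x
      refine congrArg j (Equiv.swap_apply_of_ne_of_ne (Fin.succ_ne_zero _) ?_)
      rw [← Fin.succ_zero_eq_one]
      exact fun h => Fin.succ_ne_zero _ (Fin.succ_injective _ h)
    rw [h0, h1, h2]
    rfl
  | k + 1, i + 1, j => by
    rw [exchAt_succ, stdPowBasis_succ, stdPowBasis_succ, SymTower.adj_succ_succ]
    erw [lin_whiskerLeft, exchAt_stdPowBasis k i]
    have h0 : (j ∘ permTower.e k (permTower.adj k i)) 0 = j 0 :=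
      congrArg j (permShift_zero _ _)
    have h1 : Fin.tail (j ∘ permTower.e k (permTower.adj k i)) =
        Fin.tail j ∘ permTower.adj k i :=
      funext fun x => congrArg j (permShift_succ _ _ x)
    rw [h0, h1]
    rfl

/-- The factor in place `a` moves to place `σ a`, so afterwards place `b` carries the index `i (σ⁻¹
b)`. -/
lemma permAct_stdPowBasis (k : ℕ) (σ : Equiv.Perm (Fin k)) (i : Fin k → Fin n) :
    lin (permAct (stdRep K n) k σ) (stdPowBasis K n k i) = stdPowBasis K n k (i ∘ ⇑σ⁻¹) := by
  cases k with
  | zero =>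
    obtain rfl : σ = 1 := Subsingleton.elim _ _
    rw [map_one]
    rfl
  | succ k =>
    have hσ : σ ∈ Submonoid.closure
        (Set.range fun i : Fin k ↦ Equiv.swap i.castSucc i.succ) := by
      rw [Equiv.Perm.mclosure_swap_castSucc_succ]; trivial
    induction hσ using Submonoid.closure_induction generalizing i with
    | mem x hx =>
      obtain ⟨j, rfl⟩ := hx
      dsimp only
      rw [permAct_swap, exchAt_stdPowBasis, permTower_adj, Equiv.swap_inv]
    | one =>
      rw [map_one]
      rfl
    | mul x y _ _ hx hy =>
      rw [map_mul, End.mul_def, lin_comp, LinearMap.comp_apply, hy, hx, mul_inv_rev]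
      rfl

variable {K} in
lemma sum_smul_tmul_sum_smul {M N ι κ : Type*} [AddCommGroup M] [Module K M] [AddCommGroup N]
    [Module K N] [Fintype ι] [Fintype κ] (x : ι → K) (y : κ → K) (m : ι → M) (l : κ → N) :
    (∑ a, x a • m a) ⊗ₜ[K] (∑ b, y b • l b) = ∑ a, ∑ b, (x a * y b) • (m a ⊗ₜ[K] l b) := by
  simp_rw [TensorProduct.sum_tmul, TensorProduct.tmul_sum, TensorProduct.smul_tmul_smul]

lemma rho_stdPowBasis (k : ℕ) (g : GL (Fin n) K) (j : Fin k → Fin n) :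
    (stdPow K n k).obj.ρ g (stdPowBasis K n k j) =
      ∑ i : Fin k → Fin n, (∏ a, g.1 (i a) (j a)) • stdPowBasis K n k i := by
  induction k with
  | zero =>
    rw [Fintype.sum_unique, Finset.univ_eq_empty, Finset.prod_empty, one_smul,
      Subsingleton.elim j default]
    rfl
  | succ k ih =>
    let e : Fin n → (stdRep K n).obj := fun a => (Pi.single a 1 : Fin n → K)
    have h1 : (stdRep K n).obj.ρ g (e (j 0)) = ∑ a, g.1 a (j 0) • e a := by
      change g.1.mulVec (Pi.single (j 0) 1) =
        ∑ a, g.1 a (j 0) • (Pi.single a 1 : Fin n → K)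
      ext a
      simp [Finset.sum_apply, Pi.single_apply]
    have h2 : ∀ i, stdPowBasis K n (k + 1) i = e (i 0) ⊗ₜ[K] stdPowBasis K n k (Fin.tail i) :=
      stdPowBasis_succ K n k
    have h3 : (stdPow K n (k + 1)).obj.ρ g (e (j 0) ⊗ₜ[K] stdPowBasis K n k (Fin.tail j)) =
        ((stdRep K n).obj.ρ g (e (j 0))) ⊗ₜ[K]
          ((stdPow K n k).obj.ρ g (stdPowBasis K n k (Fin.tail j))) := rfl
    simp_rw [h2]
    rw [h3, h1, ih]
    refine (sum_smul_tmul_sum_smul _ _ _ _).trans ?_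
    rw [← Fintype.sum_prod_type']
    refine Fintype.sum_equiv (Fin.consEquiv fun _ : Fin (k + 1) => Fin n) _ _ fun p => ?_
    rw [Fin.prod_univ_succ]
    rfl

end LinearMaps
end RepGL

/-! ### The double commutant theorem and semisimplicity -/

namespace RepGL

section DoubleCommutant

variable {K : Type*} [Field K] {H Γ : Type*} [Group H] [Monoid Γ] {U : Type*} [AddCommGroup U]
  [Module K U] (ρ : Representation K H U) (τ : Representation K Γ U)

lemma asAlgebraHom_mem_span (r : MonoidAlgebra K Γ) :
    τ.asAlgebraHom r ∈ Submodule.span K (Set.range τ) := by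
  induction r using MonoidAlgebra.induction_on with
  | of g =>
    rw [Representation.asAlgebraHom_of]
    exact Submodule.subset_span ⟨g, rfl⟩
  | add a b ha hb =>
    rw [map_add]
    exact Submodule.add_mem _ ha hb
  | smul r a ha =>
    rw [map_smul]
    exact Submodule.smul_mem _ _ ha

/-- The module over the group algebra given by a representation, on the same type. -/
noncomputable abbrev repModule : Module (MonoidAlgebra K Γ) U := Module.compHom U τ.asAlgebraHom.toRingHom

lemma repModule_single_smul (g : Γ) (v : U) :
    letI := repModule τ
    (MonoidAlgebra.single g (1 : K)) • v = τ g v := by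
  change τ.asAlgebraHom (MonoidAlgebra.single g 1) v = _
  rw [Representation.asAlgebraHom_single, one_smul]

lemma repModule_isScalarTower :
    letI := repModule τ
    IsScalarTower K (MonoidAlgebra K Γ) U := by
  let _ := repModule τ
  refine ⟨fun r a v => ?_⟩
  change τ.asAlgebraHom (r • a) v = r • τ.asAlgebraHom a v
  rw [map_smul, LinearMap.smul_apply]

/-- A linear map commuting with representations, as a map of modules. -/
def equivariantMap {U' : Type*} [AddCommGroup U'] [Module K U'] {τ' : Representation K Γ U'}
    (L : U →ₗ[K] U') (hL : ∀ h v, L (τ h v) = τ' h (L v)) :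
    letI := repModule τ
    letI := repModule τ'
    U →ₗ[MonoidAlgebra K Γ] U' :=
  letI := repModule τ
  letI := repModule τ'
  { toFun := L
    map_add' := L.map_add
    map_smul' := fun r v => by
      change L (τ.asAlgebraHom r v) = τ'.asAlgebraHom r (L v)
      induction r using MonoidAlgebra.induction_on generalizing v with
      | of g => simp only [Representation.asAlgebraHom_of, hL]
      | add a b ha hb => simp only [map_add, LinearMap.add_apply, ha, hb]
      | smul r a ha => simp only [map_smul, LinearMap.smul_apply, ha] }

variable {τ} in
lemma map_rho_of_linear {U' : Type*} [AddCommGroup U'] [Module K U'] {τ' : Representation K Γ U'} :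
    letI := repModule τ
    letI := repModule τ'
    ∀ (φ : U →ₗ[MonoidAlgebra K Γ] U') (g : Γ) (v : U), φ (τ g v) = τ' g (φ v) := by
  let _ := repModule τ
  let _ := repModule τ'
  intro φ g v
  rw [← repModule_single_smul τ, ← repModule_single_smul τ']
  exact φ.map_smul _ _

lemma exists_linearMap_of_end :
    letI := repModule ρ
    ∀ (φ : Module.End (MonoidAlgebra K H) U), ∃ L : U →ₗ[K] U,
      (∀ h v, L (ρ h v) = ρ h (L v)) ∧ ∀ v, φ v = L v := by
  let _ := repModule ρ
  intro φ
  have := repModule_isScalarTower ρ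
  exact ⟨φ.restrictScalars K, map_rho_of_linear φ, fun _ => rfl⟩

variable [Finite H] [CharZero K] [FiniteDimensional K U]

/-- The double commutant theorem for representations of finite groups. -/
theorem mem_span_range_of_commute (T : U →ₗ[K] U)
    (hT : ∀ L : U →ₗ[K] U, (∀ h v, L (ρ h v) = ρ h (L v)) → ∀ v, T (L v) = L (T v)) :
    T ∈ Submodule.span K (Set.range ρ) := by
  classical
  -- Invertibility of the group order makes Maschke's theorem available, hence the semisimplicity
  -- needed for the density theorem.
  have : NeZero (Nat.card H : K) := ⟨Nat.cast_ne_zero.mpr Nat.card_pos.ne'⟩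
  let _ := repModule ρ
  -- The hypothesis says that `T` is linear over the endomorphism ring of the `H`-module `U`. By
  -- density it agrees on a finite basis with an element of the group algebra.
  let f : Module.End (Module.End (MonoidAlgebra K H) U) U :=
    { toFun := T
      map_add' := T.map_add
      map_smul' := fun φ v => by
        obtain ⟨L, hL, hφ⟩ := exists_linearMap_of_end ρ φ
        change T (φ v) = φ (T v)
        rw [hφ, hφ, hT L hL] }
  obtain ⟨r, hr⟩ := jacobson_density f (Finset.univ.image (Module.finBasis K U))
  have : T = ρ.asAlgebraHom r :=
    (Module.finBasis K U).ext fun i => hr _ (Finset.mem_image_of_mem _ (Finset.mem_univ i))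
  rw [this]
  exact asAlgebraHom_mem_span ρ r

/-- A representation whose span is the commutant of a representation of a finite group is
semisimple. -/
theorem isSemisimpleModule_of_commutant (hc : ∀ g h v, τ g (ρ h v) = ρ h (τ g v))
    (hs : ∀ L : U →ₗ[K] U, (∀ h v, L (ρ h v) = ρ h (L v)) →
      L ∈ Submodule.span K (Set.range τ)) :
    letI := repModule τ
    IsSemisimpleModule (MonoidAlgebra K Γ) U := by
  have : NeZero (Nat.card H : K) := ⟨Nat.cast_ne_zero.mpr Nat.card_pos.ne'⟩
  let i1 := repModule ρ
  let i2 := repModule τ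
  have := repModule_isScalarTower ρ
  have := repModule_isScalarTower τ
  have : Module.Finite (MonoidAlgebra K H) U := Module.Finite.of_restrictScalars_finite K _ _
  -- The endomorphism ring of a finite semisimple module is semisimple, so `U` is semisimple over
  -- it.
  have : IsSemisimpleRing (Module.End (MonoidAlgebra K H) U) := IsSemisimpleRing.moduleEnd _ _
  have hspan : ∀ (N : Submodule (MonoidAlgebra K Γ) U) (L : U →ₗ[K] U),
      L ∈ Submodule.span K (Set.range τ) → ∀ v ∈ N, L v ∈ N := by
    intro N L hL v hv
    induction hL using Submodule.span_induction with
    | mem x hx =>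
      obtain ⟨g, rfl⟩ := hx
      rw [← repModule_single_smul τ]
      exact N.smul_mem _ hv
    | zero => exact N.zero_mem
    | add x y _ _ hx hy => exact N.add_mem hx hy
    | smul r x _ hx => exact (N.restrictScalars K).smul_mem r hx
  -- Submodules for `Γ` and for the commutant of `H` are the same: the commutant lies in the span of
  -- `τ` by `hs`, and `τ` takes values in the commutant by `hc`. Complements therefore transfer.
  let toS (N : Submodule (MonoidAlgebra K Γ) U) :
      Submodule (Module.End (MonoidAlgebra K H) U) U :=
    { carrier := N
      add_mem' := N.add_mem
      zero_mem' := N.zero_mem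
      smul_mem' := fun φ v hv => by
        obtain ⟨L, hL, hφ⟩ := exists_linearMap_of_end ρ φ
        change φ v ∈ N
        rw [hφ]
        exact hspan N L (hs L hL) v hv }
  refine { exists_isCompl := fun N => ?_ }
  obtain ⟨Q, hQ⟩ := exists_isCompl (toS N)
  let Q' : Submodule (MonoidAlgebra K Γ) U :=
    { carrier := Q
      add_mem' := Q.add_mem
      zero_mem' := Q.zero_mem
      smul_mem' := fun r v hv => by
        have h1 : ∀ h v, τ.asAlgebraHom r (ρ h v) = ρ h (τ.asAlgebraHom r v) := by
          intro h v
          induction r using MonoidAlgebra.induction_on with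
          | of g => simp only [Representation.asAlgebraHom_of, hc]
          | add a b ha hb => simp only [map_add, LinearMap.add_apply, ha, hb]
          | smul r a ha => simp only [map_smul, LinearMap.smul_apply, ha]
        exact Q.smul_mem (equivariantMap ρ (τ.asAlgebraHom r) h1) hv }
  refine ⟨Q', ?_, ?_⟩
  · rw [Submodule.disjoint_def]
    exact fun x hx hx' => Submodule.disjoint_def.mp hQ.1 x hx hx'
  · rw [codisjoint_iff, eq_top_iff]
    rintro v -
    obtain ⟨a, ha, b, hb, hab⟩ := Submodule.mem_sup.mp
      ((codisjoint_iff.mp hQ.2).symm ▸ Submodule.mem_top : v ∈ toS N ⊔ Q)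
    exact Submodule.mem_sup.mpr ⟨a, ha, b, hb, hab⟩

end DoubleCommutant

/-! ### Polynomial identities on the general linear group -/

section Polynomials

open MvPolynomial

variable {K : Type*} [Field K]

lemma prod_X_eq_monomial {ι : Type*} {k : ℕ} [DecidableEq ι] (f : Fin k → ι) :
    ∏ a, (X (f a) : MvPolynomial ι K) =
      monomial (Multiset.toFinsupp (Finset.univ.val.map f)) 1 := by
  have : (Multiset.toFinsupp (Finset.univ.val.map f)) = ∑ a, Finsupp.single (f a) 1 := by
    rw [← Multiset.sum_map_singleton (Finset.univ.val.map f), map_multiset_sum,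
      Multiset.map_map, Multiset.map_map]
    simp [Finset.sum]
  rw [this, monomial_sum_one]
  rfl

/-- Equal multisets of values mean fibres of equal size; bijections between the fibres assemble to a
permutation. -/
lemma exists_perm_of_map_eq {ι : Type*} {k : ℕ} {f g : Fin k → ι}
    (h : (Finset.univ.val.map f : Multiset ι) = Finset.univ.val.map g) :
    ∃ σ : Equiv.Perm (Fin k), f = g ∘ σ := by
  classical
  have h1 : ∀ i, Nonempty ({a // f a = i} ≃ {a // g a = i}) := fun i => by
    have := congrArg (Multiset.count i) h
    rw [Multiset.count_map, Multiset.count_map] at this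
    refine ⟨Fintype.equivOfCardEq ?_⟩
    rw [Fintype.card_subtype, Fintype.card_subtype]
    simp only [eq_comm (a := i)] at this
    exact this
  refine ⟨Equiv.ofFiberEquiv fun i => (h1 i).some, funext fun a => ?_⟩
  exact (Equiv.ofFiberEquiv_map _ a).symm

/-- If a combination of the monomials `X_{f 0} ⋯ X_{f (k - 1)}` vanishes, its coefficients are
orthogonal to every symmetric function of `f`. -/
lemma sum_mul_eq_zero_of_symmetric {ι : Type*} [Fintype ι] {k : ℕ} (φ T : (Fin k → ι) → K)
    (hT : ∀ (f : Fin k → ι) (σ : Equiv.Perm (Fin k)), T (f ∘ σ) = T f)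
    (h : ∑ f : Fin k → ι, C (φ f) * ∏ a, (X (f a) : MvPolynomial ι K) = 0) :
    ∑ f, φ f * T f = 0 := by
  classical
  let m : (Fin k → ι) → Multiset ι := fun f => Finset.univ.val.map f
  -- Comparing coefficients of the monomial given by `s`: the functions with multiset of values `s`
  -- are those contributing to it.
  have h1 : ∀ s : Multiset ι, ∑ f with m f = s, φ f = 0 := by
    intro s
    have := congrArg (coeff (Multiset.toFinsupp s)) h
    rw [coeff_sum, coeff_zero] at this
    rw [← this, Finset.sum_filter]
    refine Finset.sum_congr rfl fun f _ => ?_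
    rw [prod_X_eq_monomial, C_mul_monomial, coeff_monomial, mul_one]
    simp only [EmbeddingLike.apply_eq_iff_eq, m]
  rw [← Finset.sum_fiberwise_of_maps_to (s := Finset.univ) (t := Finset.univ.image m) (g := m)
    fun f _ => Finset.mem_image_of_mem _ (Finset.mem_univ f)]
  refine Finset.sum_eq_zero fun s hs => ?_
  obtain ⟨f₀, -, rfl⟩ := Finset.mem_image.mp hs
  -- Such a set of functions is a single orbit of permutations, so `T` is constant on it.
  have h2 : ∀ f ∈ Finset.univ.filter (fun f => m f = m f₀), φ f * T f = φ f * T f₀ := by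
    intro f hf
    obtain ⟨σ, hσ⟩ := exists_perm_of_map_eq (Finset.mem_filter.mp hf).2
    rw [hσ, hT]
  rw [Finset.sum_congr rfl h2, ← Finset.sum_mul, h1, zero_mul]

/-- A polynomial vanishing on the general linear group is zero. -/
lemma eq_zero_of_eval_GL [Infinite K] {n : ℕ} (p : MvPolynomial (Fin n × Fin n) K)
    (h : ∀ g : GL (Fin n) K, eval (fun ij => g.1 ij.1 ij.2) p = 0) : p = 0 := by
  -- Multiplication by the generic determinant makes the polynomial vanish at singular matrices too,
  -- so it vanishes everywhere.
  have h1 : p * (Matrix.mvPolynomialX (Fin n) (Fin n) K).det = 0 := by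
    refine MvPolynomial.funext fun x => ?_
    have h2 : eval x (Matrix.mvPolynomialX (Fin n) (Fin n) K).det =
        (Matrix.of fun i j => x (i, j)).det := by
      rw [RingHom.map_det]
      congr 1
      ext i j
      simp
    rw [map_mul, map_zero, h2]
    by_cases hx : (Matrix.of fun i j => x (i, j)).det = 0
    · rw [hx, mul_zero]
    · have := h (Matrix.GeneralLinearGroup.mkOfDetNeZero _ hx)
      rw [show eval x p = 0 from this, zero_mul]
  exact (mul_eq_zero.mp h1).resolve_right (Matrix.det_mvPolynomialX_ne_zero _ _)

end Polynomials

/-! ### The first fundamental theorem -/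

section FundamentalTheorem

universe u

variable (K : Type u) [Field K] [CharZero K] (n : ℕ)

open PolyRep

/-- The action of the symmetric group on a tensor power of the standard representation. -/
noncomputable def permRep (k : ℕ) :
    Representation K (Equiv.Perm (Fin k)) (stdPow K n k).obj where
  toFun σ := lin (permAct (stdRep K n) k σ)
  map_one' := by rw [map_one]; rfl
  map_mul' σ τ := by rw [map_mul]; rfl

/-- A linear endomorphism of a tensor power commuting with permutations is a combination of
group elements. -/
theorem mem_span_rho_of_commute_perm (k : ℕ) (L : (stdPow K n k).obj →ₗ[K] (stdPow K n k).obj)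
    (hL : ∀ σ v, L (permRep K n k σ v) = permRep K n k σ (L v)) :
    L ∈ Submodule.span K (Set.range (stdPow K n k).obj.ρ) := by
  classical
  by_contra hmem
  -- A functional that vanishes on the group elements but not on `L`; the aim is to show that it
  -- vanishes on `L`.
  obtain ⟨φ, hφL, hφ⟩ := Submodule.exists_le_ker_of_notMem hmem
  let b := stdPowBasis K n k
  -- One function `f` into pairs encodes a row and a column multi-index. Here `c` lists the
  -- coefficients of `φ`, and `T` below those of `L`.
  let c : (Fin k → Fin n × Fin n) → K := fun f =>
    φ (Matrix.toLin b b (Matrix.single (fun a => (f a).1) (fun a => (f a).2) 1))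
  let T : (Fin k → Fin n × Fin n) → K := fun f =>
    LinearMap.toMatrix b b L (fun a => (f a).1) (fun a => (f a).2)
  have key : ∀ M : (stdPow K n k).obj →ₗ[K] (stdPow K n k).obj, φ M = ∑ f, c f *
      LinearMap.toMatrix b b M (fun a => (f a).1) (fun a => (f a).2) := by
    intro M
    conv_lhs => rw [← Matrix.toLin_toMatrix b b M,
      Matrix.matrix_eq_sum_single (LinearMap.toMatrix b b M)]
    simp only [map_sum]
    rw [← Fintype.sum_prod_type']
    refine (Fintype.sum_equiv (Equiv.arrowProdEquivProdArrow _ _ _) _ _ fun f => ?_).symm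
    have : ∀ (i j : Fin k → Fin n) (x : K), Matrix.single i j x = x • Matrix.single i j 1 := by
      intro i j x
      rw [Matrix.smul_single, smul_eq_mul, mul_one]
    rw [this, map_smul, map_smul, smul_eq_mul, mul_comm]
    rfl
  -- Commuting with permutations means that matrix entries do not change when both multi-indices are
  -- permuted simultaneously.
  have hT : ∀ f (σ : Equiv.Perm (Fin k)), T (f ∘ σ) = T f := by
    intro f σ
    have h1 := hL σ⁻¹ (b (fun a => (f a).2))
    have h2 : ∀ i, permRep K n k σ⁻¹ (b i) = b (i ∘ σ) := fun i => by
      have := permAct_stdPowBasis K n k σ⁻¹ i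
      rwa [inv_inv] at this
    rw [h2] at h1
    have h3 : ∀ (i : Fin k → Fin n) v, b.repr (permRep K n k σ⁻¹ v) (i ∘ σ) = b.repr v i := by
      intro i v
      rw [← b.sum_repr v]
      simp only [map_sum, map_smul, h2, b.repr_self, Finsupp.coe_finsetSum, Finset.sum_apply,
        Finsupp.smul_apply, Finsupp.single_apply, σ.surjective.injective_comp_right.eq_iff]
    change LinearMap.toMatrix b b L ((fun a => (f a).1) ∘ σ) ((fun a => (f a).2) ∘ σ) =
      LinearMap.toMatrix b b L (fun a => (f a).1) (fun a => (f a).2)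
    rw [LinearMap.toMatrix_apply, LinearMap.toMatrix_apply, h1, h3]
  -- That `φ` vanishes at every `g` is a polynomial identity in the entries of `g`, valid on `GL_n`
  -- and hence formal. So `c` is orthogonal to the symmetric function `T`.
  have hp := sum_mul_eq_zero_of_symmetric c T hT (eq_zero_of_eval_GL _ fun g => by
    have h1 : φ ((stdPow K n k).obj.ρ g) = 0 := hφ (Submodule.subset_span ⟨g, rfl⟩)
    rw [key] at h1
    rw [map_sum, ← h1]
    refine Finset.sum_congr rfl fun f _ => ?_
    have h2 := rho_stdPowBasis K n k g (fun a => (f a).2)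
    rw [LinearMap.toMatrix_apply]
    have h3 : b.repr ((stdPow K n k).obj.ρ g (b (fun a => (f a).2))) (fun a => (f a).1) =
        ∏ a, g.1 (f a).1 (f a).2 := by
      rw [show (stdPow K n k).obj.ρ g (b (fun a => (f a).2)) = _ from h2]
      simp only [map_sum, map_smul, Finsupp.coe_finsetSum, Finset.sum_apply,
        Finsupp.smul_apply]
      rw [Finset.sum_eq_single (fun a => (f a).1)]
      · rw [show stdPowBasis K n k (fun a => (f a).1) = b (fun a => (f a).1) from rfl,
          b.repr_self, Finsupp.single_eq_same, smul_eq_mul, mul_one]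
      · intro i _ hi
        rw [show stdPowBasis K n k i = b i from rfl,
          b.repr_self, Finsupp.single_eq_of_ne hi.symm, smul_zero]
      · intro h
        exact absurd (Finset.mem_univ _) h
    rw [h3, map_mul, map_prod]
    simp only [MvPolynomial.eval_C, MvPolynomial.eval_X])
  exact hφL ((key L).trans hp)

/-- The first fundamental theorem: the endomorphisms of a tensor power of the standard
representation are spanned by the permutations. -/
theorem mem_span_permAct (k : ℕ) (T : stdPow K n k ⟶ stdPow K n k) :
    T ∈ Submodule.span K (Set.range (permAct (stdRep K n) k)) := by
  have h1 : lin T ∈ Submodule.span K (Set.range (permRep K n k)) := by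
    -- An `L` commuting with all permutations is a combination of group elements, and `T` is
    -- equivariant, so `T` commutes with `L`.
    refine mem_span_range_of_commute (permRep K n k) (lin T) fun L hL => ?_
    have hL' := mem_span_rho_of_commute_perm K n k L hL
    clear hL
    induction hL' using Submodule.span_induction with
    | mem x hx =>
      obtain ⟨g, rfl⟩ := hx
      exact lin_comm T g
    | zero => exact fun v => map_zero _
    | add x y _ _ hx hy =>
      intro v
      rw [LinearMap.add_apply, LinearMap.add_apply, map_add, hx, hy]
    | smul r x _ hx =>
      intro v
      rw [LinearMap.smul_apply, LinearMap.smul_apply, map_smul, hx]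
  have h2 : Set.range (permRep K n k) =
      linHom K n _ _ '' Set.range (permAct (stdRep K n) k) := by
    rw [← Set.range_comp]
    rfl
  rw [h2, Submodule.span_image] at h1
  obtain ⟨T', hT', h3⟩ := h1
  rwa [← lin_injective h3]

/-- The scalar matrix `2` detects the degree, since the powers of `2` are distinct in characteristic
zero. -/
lemma rho_two (k : ℕ) (g : GL (Fin n) K) (hg : g.1 = (2 : K) • 1) (v : (stdPow K n k).obj) :
    (stdPow K n k).obj.ρ g v = (2 : K) ^ k • v := by
  have : (stdPow K n k).obj.ρ g = (2 : K) ^ k • LinearMap.id := by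
    refine (stdPowBasis K n k).ext fun j => ?_
    rw [LinearMap.smul_apply, LinearMap.id_apply]
    refine (rho_stdPowBasis K n k g j).trans ?_
    rw [Finset.sum_eq_single j]
    · simp [hg]
    · intro i _ hi
      obtain ⟨a, ha⟩ := Function.ne_iff.mp hi
      rw [Finset.prod_eq_zero (Finset.mem_univ a), zero_smul]
      simp [hg, Matrix.one_apply_ne ha]
    · intro h
      exact absurd (Finset.mem_univ _) h
  rw [this]
  rfl

/-- There are no morphisms between different tensor powers of the standard representation. -/
theorem stdPow_hom_eq_zero {k l : ℕ} (h : k ≠ l) (T : stdPow K n k ⟶ stdPow K n l) : T = 0 := by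
  apply lin_injective
  ext v
  have h2 : (2 : K) ≠ 0 := two_ne_zero
  let g : GL (Fin n) K := Matrix.GeneralLinearGroup.mkOfDetNeZero ((2 : K) • 1) (by
    rw [Matrix.det_smul, Matrix.det_one, mul_one]
    exact pow_ne_zero _ h2)
  have h1 := lin_comm T g v
  rw [rho_two K n k g rfl, rho_two K n l g rfl, map_smul, ← sub_eq_zero, ← sub_smul,
    smul_eq_zero, sub_eq_zero] at h1
  refine h1.resolve_left fun h3 => h ?_
  have h4 : (2 : ℕ) ^ k = 2 ^ l := by exact_mod_cast h3
  exact Nat.pow_right_injective le_rfl h4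

end FundamentalTheorem
end RepGL

/-! ### Permutations without long decreasing subsequences -/

namespace RepGL

section DecreasingChains

/-- There is a chain of length `m`, starting at `a`, along which `σ` decreases. -/
def HasChain {k : ℕ} (σ : Equiv.Perm (Fin k)) : ℕ → Fin k → Prop
  | 0, _ => True
  | m + 1, a => ∃ b, a < b ∧ σ b < σ a ∧ HasChain σ m b

variable {k : ℕ} (σ : Equiv.Perm (Fin k))

lemma HasChain.exists_strictMono {σ : Equiv.Perm (Fin k)} : ∀ {m : ℕ} {a : Fin k},
    HasChain σ m a → ∃ s : Fin (m + 1) → Fin k, StrictMono s ∧ StrictAnti (σ ∘ s) ∧ s 0 = a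
  | 0, a, _ => 
    ⟨fun _ => a, fun i j h => absurd h (by omega), fun i j h => absurd h (by omega), rfl⟩
  | m + 1, a, ⟨b, h1, h2, h3⟩ => by
    obtain ⟨s, hs, hs', rfl⟩ := h3.exists_strictMono
    refine ⟨Matrix.vecCons a s, strictMono_vecCons.mpr ⟨h1, hs⟩, ?_, rfl⟩
    have : σ ∘ Matrix.vecCons a s = Matrix.vecCons (σ a) (σ ∘ s) := by
      funext i
      cases i using Fin.cases <;> rfl
    rw [this]
    exact strictAnti_vecCons.mpr ⟨h2, hs'⟩

/-- Each point is coloured by the length of the longest decreasing chain starting there. If `a < b`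
had the same colour and `σ b < σ a`, then `a` could be put in front of the chain of `b`. -/
lemma exists_coloring {n : ℕ} (h : ∀ a, ¬ HasChain σ n a) :
    ∃ c : Fin k → Fin n, ∀ a b, a < b → c a = c b → σ a < σ b := by
  classical
  have h0 : ∀ a, ∃ m, ¬ HasChain σ m a := fun a => ⟨n, h a⟩
  have hpos : ∀ a, 0 < Nat.find (h0 a) := fun a =>
    (Nat.find_pos (h0 a)).mpr fun h => h trivial
  have hle : ∀ a, Nat.find (h0 a) ≤ n := fun a => Nat.find_le (h a)
  -- The least length without a chain lies between `1` and `n`; subtracting `1` gives the longest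
  -- length that occurs, an element of `Fin n`.
  refine ⟨fun a => ⟨Nat.find (h0 a) - 1, by have := hpos a; have := hle a; omega⟩,
    fun a b hab hc => ?_⟩
  by_contra hσ
  have h1 : σ b < σ a := lt_of_le_of_ne (not_lt.mp hσ) fun h => hab.ne' (σ.injective h)
  have h2 : HasChain σ (Nat.find (h0 b) - 1) b := by
    by_contra h3
    have := Nat.find_le (h := h0 b) h3
    have := hpos b
    omega
  have h3 : HasChain σ (Nat.find (h0 b) - 1 + 1) a := ⟨b, hab, h1, h2⟩
  have h4 : Nat.find (h0 a) - 1 = Nat.find (h0 b) - 1 := congrArg Fin.val hc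
  refine Nat.find_spec (h0 a) ?_
  have := hpos a
  rwa [show Nat.find (h0 a) = Nat.find (h0 b) - 1 + 1 by omega]

/-- `σ` is the lexicographically least permutation inducing its rearrangement of colours. If `i` is
the first place where `τ` differs and `τ i < σ i`, the point `σ⁻¹ (τ i)` has the colour of `i`. It
cannot come before `i`, where `τ` and `σ` agree, nor after `i`, where monotonicity on colours gives
`σ i < τ i`. -/
lemma eq_of_coloring {ι : Type*} (c : Fin k → ι) (hc : ∀ a b, a < b → c a = c b → σ a < σ b)
    (τ : Equiv.Perm (Fin k)) (h : c ∘ ⇑τ⁻¹ = c ∘ ⇑σ⁻¹) (hle : toLex ⇑τ ≤ toLex ⇑σ) : τ = σ := by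
  refine eq_of_le_of_not_lt (α := Lex (Fin k → Fin k)) hle ?_ |> fun h => Equiv.coe_fn_injective h
  rintro ⟨i, hi, hi'⟩
  replace hi : ∀ j < i, τ j = σ j := hi
  replace hi' : τ i < σ i := hi'
  have h1 : c (σ⁻¹ (τ i)) = c i := by
    have := congrFun h (τ i)
    simpa using this.symm
  rcases lt_trichotomy (σ⁻¹ (τ i)) i with hj | hj | hj
  · have := hi _ hj
    rw [show σ (σ⁻¹ (τ i)) = τ i from σ.apply_symm_apply _] at this
    exact hj.ne (τ.injective this)
  · rw [Equiv.Perm.inv_eq_iff_eq] at hj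
    exact hi'.ne hj
  · have := hc _ _ hj h1.symm
    rw [show σ (σ⁻¹ (τ i)) = τ i from σ.apply_symm_apply _] at this
    exact lt_asymm this hi'

/-- At the first point `i` moved by `ρ` one has `i < ρ i`, so the value of `σ` at `s i` is replaced
by a smaller one, while nothing changes before `s i`. -/
lemma mul_viaEmbedding_lt {n : ℕ} (s : Fin (n + 1) ↪ Fin k) (hs : StrictMono s)
    (hσ : StrictAnti (σ ∘ s)) (ρ : Equiv.Perm (Fin (n + 1))) (hρ : ρ ≠ 1) :
    toLex ⇑(σ * ρ.viaEmbedding s) < toLex ⇑σ := by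
  classical
  have hex : ∃ i, ρ i ≠ i := by
    by_contra! h
    exact hρ (Equiv.ext h)
  obtain ⟨i, hi, hmin⟩ := WellFounded.has_min (wellFounded_lt (α := Fin (n + 1)))
    {i | ρ i ≠ i} hex
  have hfix : ∀ j < i, ρ j = j := fun j hj => by
    by_contra h
    exact hmin j h hj
  refine ⟨s i, fun p hp => ?_, ?_⟩
  · change σ (ρ.viaEmbedding s p) = σ p
    by_cases hps : p ∈ Set.range s
    · obtain ⟨j, rfl⟩ := hps
      rw [Equiv.Perm.viaEmbedding_apply, hfix j (hs.lt_iff_lt.mp hp)]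
    · rw [Equiv.Perm.viaEmbedding_apply_of_notMem _ _ _ hps]
  · change σ (ρ.viaEmbedding s (s i)) < σ (s i)
    rw [Equiv.Perm.viaEmbedding_apply]
    refine hσ (lt_of_le_of_ne (not_lt.mp fun h => ?_) (Ne.symm hi))
    exact h.ne (ρ.injective (hfix _ h))

end DecreasingChains

/-! ### The second fundamental theorem -/

section Antisymmetrizer

universe u

variable (K : Type u) [Field K] [CharZero K] {C : Type*} [Category* C] [Preadditive C]
  [Linear K C] [MonoidalCategory C] [SymmetricCategory C]

variable {K} in
lemma sum_sign_permAct {X : C} {k : ℕ} (h : antisymmetrizer K X k = 0) :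
    ∑ σ : Equiv.Perm (Fin k), Equiv.Perm.sign σ • permAct X k σ = 0 :=
  (smul_eq_zero.mp h).resolve_left
    (inv_ne_zero (Nat.cast_ne_zero.mpr k.factorial_ne_zero))

/-- The permutation `1 × ρ`. -/
def iterShift {k : ℕ} (ρ : Equiv.Perm (Fin k)) : ∀ m : ℕ, Equiv.Perm (Fin (k + m))
  | 0 => ρ
  | m + 1 => permShift (k + m) (iterShift ρ m)

lemma iterShift_apply_of_lt {k : ℕ} (ρ : Equiv.Perm (Fin k)) : ∀ (m : ℕ) (a : Fin (k + m)),
    a.1 < m → iterShift ρ m a = a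
  | 0, _, h => absurd h (Nat.not_lt_zero _)
  | m + 1, a, h => by
    cases a using Fin.cases with
    | zero => exact permShift_zero _ _
    | succ a =>
      refine (permShift_succ _ _ a).trans (congrArg Fin.succ (iterShift_apply_of_lt ρ m a ?_))
      exact Nat.lt_of_succ_lt_succ h

lemma iterShift_apply_add {k : ℕ} (ρ : Equiv.Perm (Fin k)) : ∀ (m : ℕ) (a : Fin k),
    iterShift ρ m (a.addNat m) = (ρ a).addNat m
  | 0, _ => rfl
  | m + 1, a => (permShift_succ _ _ (a.addNat m)).trans
      (congrArg Fin.succ (iterShift_apply_add ρ m a))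

variable {K} [MonoidalPreadditive C]

/-- The antisymmetrizer relation on the last `k` places, obtained by tensoring on the left with
copies of `X`. -/
lemma sum_sign_iterShift {X : C} {k : ℕ} (h : antisymmetrizer K X k = 0) : ∀ m : ℕ,
    ∑ ρ : Equiv.Perm (Fin k), Equiv.Perm.sign ρ • permAct X (k + m) (iterShift ρ m) = 0
  | 0 => sum_sign_permAct h
  | m + 1 => by
    have h1 : ∀ ρ : Equiv.Perm (Fin k), Equiv.Perm.sign ρ •
        permAct X (k + (m + 1)) (iterShift ρ (m + 1)) =
        (tensorLeft X).map (Equiv.Perm.sign ρ • permAct X (k + m) (iterShift ρ m)) := by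
      intro ρ
      have h2 : permAct X (k + (m + 1)) (iterShift ρ (m + 1)) =
        (tensorLeft X).map (permAct X (k + m) (iterShift ρ m)) := permAct_permShift X _ _
      rcases Int.units_eq_one_or (Equiv.Perm.sign ρ) with h3 | h3
      · rw [h3, one_smul, one_smul, h2]
      · rw [h3, Units.neg_smul, Units.neg_smul, one_smul, one_smul, h2]
        exact ((tensorLeft X).map_neg).symm
    rw [Finset.sum_congr rfl fun ρ _ => h1 ρ]
    refine ((tensorLeft X).map_sum _ _).symm.trans ?_
    rw [sum_sign_iterShift h m]
    exact (tensorLeft X).map_zero _ _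

/-- The relation on arbitrary places is conjugate to the one on the last places, by any permutation
`π` that carries the latter to the image of `s`. -/
lemma sum_sign_viaEmbedding {X : C} {n k : ℕ} (h : antisymmetrizer K X n = 0)
    (s : Fin n ↪ Fin k) :
    ∑ ρ : Equiv.Perm (Fin n), Equiv.Perm.sign ρ • permAct X k (ρ.viaEmbedding s) = 0 := by
  classical
  obtain ⟨m, rfl⟩ : ∃ m, k = n + m := Nat.exists_eq_add_of_le
    (by simpa using Fintype.card_le_of_embedding s)
  have hinj : Function.Injective (fun a : Fin n => a.addNat m) := fun a b hab =>
    Fin.ext (by simpa using congrArg Fin.val hab)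
  let e : {x // x ∈ Set.range (fun a : Fin n => a.addNat m)} ≃ {x // x ∈ Set.range s} :=
    (Equiv.ofInjective _ hinj).symm.trans (Equiv.ofInjective _ s.injective)
  let π : Equiv.Perm (Fin (n + m)) := e.extendSubtype
  have hπ : ∀ a : Fin n, π (a.addNat m) = s a := fun a => by
    refine (e.extendSubtype_apply_of_mem _ ⟨a, rfl⟩).trans ?_
    change ((Equiv.ofInjective s s.injective) ((Equiv.ofInjective _ hinj).symm
      ⟨a.addNat m, a, rfl⟩)).1 = _
    rw [Equiv.ofInjective_apply]
    exact congrArg s (Equiv.ofInjective_symm_apply hinj a)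
  have hconj : ∀ ρ : Equiv.Perm (Fin n), ρ.viaEmbedding s = π * iterShift ρ m * π⁻¹ := by
    intro ρ
    rw [eq_mul_inv_iff_mul_eq]
    ext1 a
    change ρ.viaEmbedding s (π a) = π (iterShift ρ m a)
    by_cases ha : a.1 < m
    · rw [iterShift_apply_of_lt ρ m a ha, Equiv.Perm.viaEmbedding_apply_of_notMem]
      rintro ⟨b, hb⟩
      rw [← hπ] at hb
      have := congrArg Fin.val (π.injective hb)
      simp at this
      omega
    · obtain ⟨b, rfl⟩ : ∃ b : Fin n, a = b.addNat m :=
        ⟨⟨a.1 - m, by have := a.2; omega⟩, Fin.ext (by simp; omega)⟩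
      rw [iterShift_apply_add, hπ, hπ, Equiv.Perm.viaEmbedding_apply]
  have h1 := sum_sign_iterShift h m
  have h2 := congrArg (fun x => permAct X (n + m) π * x * permAct X (n + m) π⁻¹) h1
  rw [mul_zero, zero_mul, Finset.mul_sum, Finset.sum_mul] at h2
  rw [← h2]
  refine Finset.sum_congr rfl fun ρ _ => ?_
  rw [hconj, map_mul, map_mul, mul_smul_comm, smul_mul_assoc]

variable (K) in
-- Among `n + 1` indices from `Fin n` two coincide. Multiplying on the right with their
-- transposition changes the sign of each term and not the basis vector, so the sum equals its own
-- negative.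
lemma antisymmetrizer_stdRep (n : ℕ) : antisymmetrizer K (stdRep K n) (n + 1) = 0 := by
  have : ∑ σ : Equiv.Perm (Fin (n + 1)), Equiv.Perm.sign σ • permAct (stdRep K n) (n + 1) σ = 0 := by
    apply PolyRep.lin_injective
    refine (stdPowBasis K n (n + 1)).ext fun i => ?_
    obtain ⟨a, b, hab, hi⟩ := Fintype.exists_ne_map_eq_of_card_lt i (by simp)
    have h1 : ∀ σ : Equiv.Perm (Fin (n + 1)),
        PolyRep.lin (Equiv.Perm.sign σ • permAct (stdRep K n) (n + 1) σ)
          (stdPowBasis K n (n + 1) i) =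
        Equiv.Perm.sign σ • stdPowBasis K n (n + 1) (i ∘ ⇑σ⁻¹) := by
      intro σ
      rw [← permAct_stdPowBasis]
      rcases Int.units_eq_one_or (Equiv.Perm.sign σ) with h3 | h3
      · rw [h3, one_smul, one_smul]
      · rw [h3, Units.neg_smul, Units.neg_smul, one_smul, one_smul]
        rfl
    rw [PolyRep.lin_sum, LinearMap.sum_apply, Finset.sum_congr rfl fun σ _ => h1 σ]
    set S := ∑ σ : Equiv.Perm (Fin (n + 1)),
      Equiv.Perm.sign σ • stdPowBasis K n (n + 1) (i ∘ ⇑σ⁻¹) with hS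
    have h2 : S = -S := by
      conv_lhs => rw [hS]
      rw [hS, ← Finset.sum_neg_distrib]
      refine Fintype.sum_equiv (Equiv.mulRight (Equiv.swap a b)) _ _ fun σ => ?_
      have h3 : i ∘ ⇑(σ * Equiv.swap a b)⁻¹ = i ∘ ⇑σ⁻¹ := by
        funext x
        rw [mul_inv_rev, Equiv.swap_inv]
        change i (Equiv.swap a b (σ⁻¹ x)) = i (σ⁻¹ x)
        rcases eq_or_ne (σ⁻¹ x) a with h | h
        · rw [h, Equiv.swap_apply_left, hi]
        · rcases eq_or_ne (σ⁻¹ x) b with h' | h'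
          · rw [h', Equiv.swap_apply_right, hi]
          · rw [Equiv.swap_apply_of_ne_of_ne h h']
      rw [Equiv.coe_mulRight, h3, Equiv.Perm.sign_mul, Equiv.Perm.sign_swap hab, mul_neg_one,
        Units.neg_smul, neg_neg]
    have h4 : (2 : K) • S = 0 := by
      rw [two_smul]
      nth_rewrite 1 [h2]
      exact neg_add_cancel S
    exact (smul_eq_zero.mp h4).resolve_left two_ne_zero
  rw [antisymmetrizer, this, smul_zero]

/-- The relation used for straightening; it applies to `X` and to the standard representation alike.
-/
lemma linearCombination_mul_viaEmbedding {n k : ℕ} {X : C} (hX : antisymmetrizer K X n = 0)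
    (σ : Equiv.Perm (Fin k)) (s : Fin n ↪ Fin k) :
    Finsupp.linearCombination K (permAct X k) (∑ ρ : Equiv.Perm (Fin n),
      Equiv.Perm.sign ρ • Finsupp.single (σ * ρ.viaEmbedding s) 1) = 0 := by
  rw [map_sum]
  have h1 := congrArg (permAct X k σ * ·) (sum_sign_viaEmbedding hX s)
  simp only [mul_zero, Finset.mul_sum] at h1
  refine Eq.trans (Finset.sum_congr rfl fun ρ _ => ?_) h1
  rw [mul_smul_comm, ← map_mul]
  rcases Int.units_eq_one_or (Equiv.Perm.sign ρ) with h3 | h3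
  · rw [h3, one_smul, one_smul, Finsupp.linearCombination_single, one_smul]
  · rw [h3, Units.neg_smul, Units.neg_smul, one_smul, one_smul, map_neg,
      Finsupp.linearCombination_single, one_smul]

/-- The second fundamental theorem: a combination of permutations that vanishes on the tensor powers
of the standard `n`-dimensional representation vanishes on the tensor powers of every object whose
exterior power of degree `n + 1` vanishes. -/
theorem linearCombination_permAct_eq_zero {n k : ℕ} {X : C} (hX : antisymmetrizer K X (n + 1) = 0)
    (x : Equiv.Perm (Fin k) →₀ K)
    (hx : Finsupp.linearCombination K (permAct (stdRep K n) k) x = 0) :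
    Finsupp.linearCombination K (permAct X k) x = 0 := by
  classical
  -- `N` consists of the relations valid for both objects, and `G` of the permutations without a
  -- decreasing subsequence of length `n + 1`.
  let N : Submodule K (Equiv.Perm (Fin k) →₀ K) :=
    (Finsupp.linearCombination K (permAct (stdRep K n) k)).ker ⊓
      (Finsupp.linearCombination K (permAct X k)).ker
  let G : Set (Equiv.Perm (Fin k)) := {σ | ∀ a, ¬ HasChain σ n a}
  -- Straightening, by induction on the lexicographic order: if `σ` decreases along `n + 1` places,
  -- the relation on these places expresses `σ` modulo `N` by smaller permutations.
  have hsingle : ∀ f : Lex (Fin k → Fin k), ∀ σ : Equiv.Perm (Fin k), toLex ⇑σ = f →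
      Finsupp.single σ 1 ∈ N ⊔ Finsupp.supported K K G := by
    intro f
    induction f using WellFoundedLT.induction with
    | ind f ih =>
    rintro σ rfl
    by_cases hσ : σ ∈ G
    · exact Submodule.mem_sup_right (Finsupp.single_mem_supported K _ hσ)
    · simp only [G, Set.mem_ofPred_eq, not_forall, not_not] at hσ
      obtain ⟨a, ha⟩ := hσ
      obtain ⟨s, hs, hs', -⟩ := ha.exists_strictMono
      let s' : Fin (n + 1) ↪ Fin k := ⟨s, hs.injective⟩
      let y : Equiv.Perm (Fin k) →₀ K := ∑ ρ : Equiv.Perm (Fin (n + 1)),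
        Equiv.Perm.sign ρ • Finsupp.single (σ * ρ.viaEmbedding s') 1
      have hyN : y ∈ N := ⟨linearCombination_mul_viaEmbedding (antisymmetrizer_stdRep K n) σ s',
        linearCombination_mul_viaEmbedding hX σ s'⟩
      have hone : (1 : Equiv.Perm (Fin (n + 1))).viaEmbedding s' = 1 :=
        map_one (Equiv.Perm.viaEmbeddingHom s')
      have h1 : Finsupp.single σ 1 = y - ∑ ρ ∈ Finset.univ.erase 1,
          Equiv.Perm.sign ρ • Finsupp.single (σ * ρ.viaEmbedding s') (1 : K) := by
        rw [eq_sub_iff_add_eq]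
        rw [show y = _ from (Finset.add_sum_erase _ _ (Finset.mem_univ (1 : Equiv.Perm (Fin (n + 1))))).symm]
        rw [hone, Equiv.Perm.sign_one, one_smul, mul_one]
      rw [h1]
      refine Submodule.sub_mem _ (Submodule.mem_sup_left hyN) (Submodule.sum_mem _ fun ρ hρ => ?_)
      have h2 := ih _ (mul_viaEmbedding_lt σ s' hs hs' ρ (Finset.ne_of_mem_erase hρ)) _ rfl
      rcases Int.units_eq_one_or (Equiv.Perm.sign ρ) with h3 | h3
      · rwa [h3, one_smul]
      · rw [h3, Units.neg_smul, one_smul]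
        exact Submodule.neg_mem _ h2
  have htop : x ∈ N ⊔ Finsupp.supported K K G := by
    rw [← Finsupp.sum_single x]
    refine Submodule.sum_mem _ fun σ _ => ?_
    have := Submodule.smul_mem _ (x σ) (hsingle _ σ rfl)
    rwa [Finsupp.smul_single, smul_eq_mul, mul_one] at this
  obtain ⟨ν, hν, y, hy, rfl⟩ := Submodule.mem_sup.mp htop
  have hyV : Finsupp.linearCombination K (permAct (stdRep K n) k) y = 0 := by
    have h1 : Finsupp.linearCombination K (permAct (stdRep K n) k) ν = 0 := hν.1
    rwa [map_add, h1, zero_add] at hx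
  suffices hy0 : y = 0 by
    rw [hy0, add_zero]
    exact hν.2
  by_contra hne
  -- Linear independence of `G` on the standard tensor power: for the largest `σ` in the support,
  -- the colouring of `σ` provides a basis vector `c` to test on.
  obtain ⟨σ, hσ, hmax⟩ := Finset.exists_max_image y.support (fun σ => toLex ⇑σ)
    (Finsupp.support_nonempty_iff.mpr hne)
  obtain ⟨c, hc⟩ := exists_coloring σ (hy hσ)
  -- The coefficient at `c ∘ σ⁻¹` receives a contribution from `σ` only: any other `τ` in the
  -- support is at most `σ`, and `eq_of_coloring` excludes it.
  have h1 := congrArg (fun T => (stdPowBasis K n k).repr (PolyRep.lin T (stdPowBasis K n k c))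
    (c ∘ ⇑σ⁻¹)) hyV
  rw [Finsupp.linearCombination_apply, Finsupp.sum, PolyRep.lin_sum, LinearMap.sum_apply, map_sum,
    Finsupp.finsetSum_apply, PolyRep.lin_zero, LinearMap.zero_apply, map_zero,
    Finset.sum_eq_single σ] at h1
  · rw [PolyRep.lin_smul, LinearMap.smul_apply, permAct_stdPowBasis, map_smul,
      Module.Basis.repr_self, Finsupp.smul_apply, Finsupp.single_eq_same, smul_eq_mul, mul_one] at h1
    exact (Finsupp.mem_support_iff.mp hσ) h1
  · intro τ hτ hne
    rw [PolyRep.lin_smul, LinearMap.smul_apply, permAct_stdPowBasis, map_smul,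
      Module.Basis.repr_self, Finsupp.smul_apply, Finsupp.single_eq_of_ne, smul_zero]
    exact fun h => hne (eq_of_coloring σ c hc τ h.symm (hmax τ hτ))
  · exact fun h => absurd hσ h

end Antisymmetrizer
end RepGL

/-! ### From the fundamental theorems to a functor on words -/

namespace RepGL

section Words

universe u

variable (K : Type u) [Field K] {C : Type*} [Category* C] [Preadditive C]
  [Linear K C] [MonoidalCategory C] [SymmetricCategory C]

/-- Evaluation of combinations of formal morphisms. -/
noncomputable def evLin (X : C) (w u : Word) : (FHom w u →₀ K) →ₗ[K] (w.ev X ⟶ u.ev X) :=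
  Finsupp.linearCombination K (FHom.ev X)

lemma evLin_single (X : C) {w u : Word} (f : FHom w u) (r : K) :
    evLin K X w u (Finsupp.single f r) = r • f.ev X :=
  Finsupp.linearCombination_single _ _ _

/-- The identification of endomorphisms of a tensor power with morphisms of words. -/
noncomputable def wordHom (X : C) (w u : Word) (h : w.len 0 = u.len 0) :
    (tensorPow X (w.len 0) ⟶ tensorPow X (w.len 0)) ≃ₗ[K] (w.ev X ⟶ u.ev X) where
  toFun f := (normIso X w).hom ≫ f ≫ eqToHom (by rw [h]) ≫ (normIso X u).inv
  invFun f := (normIso X w).inv ≫ f ≫ (normIso X u).hom ≫ eqToHom (by rw [h])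
  map_add' f g := by simp
  map_smul' r f := by simp
  left_inv f := by simp
  right_inv f := by simp

lemma eq_wordHom {X : C} {w u : Word} (h : w.len 0 = u.len 0) {f : w.ev X ⟶ u.ev X}
    {σ : tensorPow X (w.len 0) ⟶ tensorPow X (w.len 0)}
    (hf : f ≫ (normIso X u).hom = (normIso X w).hom ≫ σ ≫ eqToHom (by rw [h])) :
    f = wordHom K X w u h σ := by
  change f = (normIso X w).hom ≫ σ ≫ eqToHom (by rw [h]) ≫ (normIso X u).inv
  rw [← Category.comp_id f, ← (normIso X u).hom_inv_id, reassoc_of% hf]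

variable {A : Type*} [Category* A] [Preadditive A]
  [Linear K A] [MonoidalCategory A] [SymmetricCategory A] {V : A}

/-- The first fundamental theorem in terms of words: after normalisation, a morphism is a
combination of permutations if the lengths agree, and zero otherwise. -/
lemma evLin_surjective
    (hspan : ∀ (k : ℕ) (T : tensorPow V k ⟶ tensorPow V k),
      T ∈ Submodule.span K (Set.range (permAct V k)))
    (hzero : ∀ {k l : ℕ}, k ≠ l → ∀ T : tensorPow V k ⟶ tensorPow V l, T = 0) (w u : Word) :
    Function.Surjective (evLin K V w u) := by
  intro T
  by_cases h : w.len 0 = u.len 0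
  · obtain ⟨S, rfl⟩ := (wordHom K V w u h).surjective T
    have hS := hspan _ S
    change _ ∈ LinearMap.range (evLin K V w u)
    induction hS using Submodule.span_induction with
    | mem x hx =>
      obtain ⟨σ, rfl⟩ := hx
      obtain ⟨f, hf, -⟩ := FHom.exists_of_perm V V w u h σ
      exact ⟨_, (evLin_single K _ f 1).trans ((one_smul _ _).trans (eq_wordHom K h hf))⟩
    | zero => rw [map_zero]; exact Submodule.zero_mem _
    | add x y _ _ hx hy => rw [map_add]; exact Submodule.add_mem _ hx hy
    | smul r x _ hx => rw [map_smul]; exact Submodule.smul_mem _ _ hx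
  · have h0 := hzero h ((normIso V w).inv ≫ T ≫ (normIso V u).hom)
    refine ⟨0, ?_⟩
    rw [map_zero]
    calc 0 = (normIso _ w).hom ≫ ((normIso _ w).inv ≫ T ≫ (normIso _ u).hom) ≫
          (normIso _ u).inv := by rw [h0, Limits.zero_comp, Limits.comp_zero]
      _ = T := by simp

lemma evLin_eq_wordHom (X : C) {w u : Word} (h : w.len 0 = u.len 0)
    (σ : FHom w u → Equiv.Perm (Fin (w.len 0)))
    (hσ : ∀ f, f.ev X = wordHom K X w u h (permAct X _ (σ f))) (x : FHom w u →₀ K) :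
    evLin K X w u x = wordHom K _ w u h
      (Finsupp.linearCombination K (permAct X (w.len 0)) (Finsupp.mapDomain σ x)) := by
  rw [Finsupp.linearCombination_mapDomain]
  induction x using Finsupp.induction_linear with
  | zero => simp only [map_zero]
  | add x y hx hy => simp only [map_add, hx, hy]
  | single f r =>
    rw [evLin_single, Finsupp.linearCombination_single, hσ]
    exact (map_smul _ _ _).symm

/-- The second fundamental theorem in terms of words: formal morphisms evaluate to the same
permutations in both categories, so relations transfer. -/
lemma evLin_eq_zero {X : C} (hker : ∀ (k : ℕ) (x : Equiv.Perm (Fin k) →₀ K),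
      Finsupp.linearCombination K (permAct V k) x = 0 →
      Finsupp.linearCombination K (permAct X k) x = 0) {w u : Word}
    (x : FHom w u →₀ K) (hx : evLin K V w u x = 0) : evLin K X w u x = 0 := by
  by_cases h : w.len 0 = u.len 0
  · have h1 : ∀ f : FHom w u, ∃ σ : Equiv.Perm (Fin (w.len 0)),
        f.ev V = wordHom K _ w u h (permAct V _ σ) ∧
        f.ev X = wordHom K _ w u h (permAct X _ σ) := by
      intro f
      obtain ⟨_, σ, h1, h2⟩ := f.exists_perm V X
      exact ⟨σ, eq_wordHom K h h1, eq_wordHom K h h2⟩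
    choose σ hV hX using h1
    rw [evLin_eq_wordHom K V h σ hV, LinearEquiv.map_eq_zero_iff] at hx
    rw [evLin_eq_wordHom K X h σ hX, hker _ _ hx, map_zero]
  -- There is no formal morphism between words of different lengths.
  · obtain rfl : x = 0 := by
      ext f
      exact absurd (f.exists_perm X X).1 h
    rw [map_zero]

/-- A functor defined on words, obtained from the fundamental theorems. -/
theorem exists_wordFunctor [MonoidalPreadditive C] [MonoidalLinear K C] [MonoidalPreadditive A]
    [MonoidalLinear K A] {X : C}
    (hspan : ∀ (k : ℕ) (T : tensorPow V k ⟶ tensorPow V k),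
      T ∈ Submodule.span K (Set.range (permAct V k)))
    (hzero : ∀ {k l : ℕ}, k ≠ l → ∀ T : tensorPow V k ⟶ tensorPow V l, T = 0)
    (hker : ∀ (k : ℕ) (x : Equiv.Perm (Fin k) →₀ K),
      Finsupp.linearCombination K (permAct V k) x = 0 →
      Finsupp.linearCombination K (permAct X k) x = 0) : Nonempty (WordFunctor K V X) := by
  have hsurj := evLin_surjective K hspan hzero
  -- The functor lifts a morphism to a combination of formal morphisms and evaluates it at `X`. By
  -- `evLin_eq_zero` the result does not depend on the linear section chosen here, and by
  -- bilinearity the laws need checking on formal morphisms only.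
  choose s hs using fun w u : Word => (evLin K V w u).exists_rightInverse_of_surjective
    (LinearMap.range_eq_top.mpr (hsurj w u))
  have key : ∀ {w u : Word} (x : FHom w u →₀ K),
      (evLin K X w u ∘ₗ s w u) (evLin K V w u x) = evLin K X w u x := by
    intro w u x
    rw [LinearMap.comp_apply, ← sub_eq_zero, ← map_sub]
    apply evLin_eq_zero K hker
    rw [map_sub, ← LinearMap.comp_apply, hs, LinearMap.id_apply, sub_self]
  have keyf : ∀ {w u : Word} (f : FHom w u),
      (evLin K X w u ∘ₗ s w u) (f.ev V) = f.ev X := by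
    intro w u f
    have := key (Finsupp.single f 1)
    rwa [evLin_single, evLin_single, one_smul, one_smul] at this
  refine ⟨{ map := fun {w u} => evLin K X w u ∘ₗ s w u, map_ev := keyf, map_comp := ?_,
            map_tensor := ?_ }⟩
  · intro w u v f g
    obtain ⟨x, rfl⟩ := hsurj _ _ f
    obtain ⟨y, rfl⟩ := hsurj _ _ g
    induction x using Finsupp.induction_linear with
    | zero => simp only [map_zero, Limits.zero_comp]
    | add x x' hx hx' => simp only [map_add, Preadditive.add_comp, hx, hx']
    | single f r =>
      induction y using Finsupp.induction_linear with
      | zero => simp only [map_zero, Limits.comp_zero]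
      | add y y' hy hy' => simp only [map_add, Preadditive.comp_add, hy, hy']
      | single g t =>
        rw [evLin_single, evLin_single, map_smul, map_smul, keyf, keyf]
        simp only [Linear.smul_comp, Linear.comp_smul, map_smul]
        exact congrArg (fun z => t • r • z) (keyf (f.comp g))
  · intro w w' u u' f g
    obtain ⟨x, rfl⟩ := hsurj _ _ f
    obtain ⟨y, rfl⟩ := hsurj _ _ g
    induction x using Finsupp.induction_linear with
    | zero => simp only [map_zero, MonoidalPreadditive.zero_tensor]
    | add x x' hx hx' => simp only [map_add, MonoidalPreadditive.add_tensor, hx, hx']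
    | single f r =>
      induction y using Finsupp.induction_linear with
      | zero => simp only [map_zero, MonoidalPreadditive.tensor_zero]
      | add y y' hy hy' => simp only [map_add, MonoidalPreadditive.tensor_add, hy, hy']
      | single g t =>
        rw [evLin_single, evLin_single, map_smul, map_smul, keyf, keyf]
        simp only [MonoidalCategory.tensorHom_def, MonoidalLinear.smul_whiskerRight, MonoidalLinear.whiskerLeft_smul,
          Linear.smul_comp, Linear.comp_smul, map_smul]
        simp only [← MonoidalCategory.tensorHom_def]
        exact congrArg (fun z => t • r • z) (keyf (f.tensor g))

end Words

section StandardRepresentation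

universe u

variable {K : Type u} [Field K] [CharZero K] {n : ℕ} {C : Type*} [Category* C] [Preadditive C]
  [Linear K C] [MonoidalCategory C] [SymmetricCategory C] [MonoidalPreadditive C]
  [MonoidalLinear K C]

theorem exists_wordFunctor_stdRep {X : C} (hX : antisymmetrizer K X (n + 1) = 0) :
    Nonempty (WordFunctor K (stdRep K n) X) :=
  exists_wordFunctor K (mem_span_permAct K n) (stdPow_hom_eq_zero K n)
    fun _ => linearCombination_permAct_eq_zero hX

end StandardRepresentation
end RepGL

/-! ### Complete reducibility of polynomial representations -/

namespace RepGL

section Retracts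

variable {R : Type*} [Ring R] {F P W : Type*} [AddCommGroup F] [Module R F] [AddCommGroup P]
  [Module R P] [AddCommGroup W] [Module R W]

/-- A module is a retract of a semisimple module if it is a subquotient. -/
lemma exists_retract_of_ker_le [IsSemisimpleModule R P] (α : F →ₗ[R] P) (β : F →ₗ[R] W)
    (hβ : Function.Surjective β) (h : α.ker ≤ β.ker) :
    ∃ (s : W →ₗ[R] P) (L : P →ₗ[R] W), ∀ w, L (s w) = w := by
  -- `β` factors through the range of `α`. Semisimplicity of `P` extends this factor to `P` and then
  -- splits the resulting surjection.
  let L₀ : α.range →ₗ[R] W := (α.ker.liftQ β h) ∘ₗ α.quotKerEquivRange.symm.toLinearMap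
  obtain ⟨L, hL⟩ := IsSemisimpleModule.extension_property α.range.subtype
    α.range.injective_subtype L₀
  have hLα : ∀ x, L (α x) = β x := by
    intro x
    have h1 : L (α x) = L₀ ⟨α x, x, rfl⟩ := LinearMap.congr_fun hL ⟨α x, x, rfl⟩
    have h2 : α.quotKerEquivRange.symm ⟨α x, x, rfl⟩ = α.ker.mkQ x :=
      α.quotKerEquivRange_symm_apply_image x ⟨x, rfl⟩
    rw [h1]
    change α.ker.liftQ β h (α.quotKerEquivRange.symm ⟨α x, x, rfl⟩) = β x
    rw [h2]
    exact α.ker.liftQ_apply β x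
  obtain ⟨s, hs⟩ := IsSemisimpleModule.lifting_property L (fun w => by
    obtain ⟨x, rfl⟩ := hβ w
    exact ⟨α x, hLα x⟩) LinearMap.id
  exact ⟨s, L, LinearMap.congr_fun hs⟩

end Retracts

section CompleteReducibility

universe u

variable (K : Type u) [Field K] (n : ℕ)

/-- Products of matrix entries. -/
def entryProd {k : ℕ} (f : Fin k → Fin n × Fin n) (g : GL (Fin n) K) : K :=
  ∏ a, g.1 (f a).1 (f a).2

lemma mem_closure_entries {h : GL (Fin n) K → K} (hh : h ∈ Submonoid.closure
    (Set.range fun (ij : Fin n × Fin n) (g : GL (Fin n) K) => g.1 ij.1 ij.2)) :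
    ∃ (k : ℕ) (f : Fin k → Fin n × Fin n), h = entryProd K n f := by
  induction hh using Submonoid.closure_induction with
  | mem x hx =>
    obtain ⟨ij, rfl⟩ := hx
    exact ⟨1, fun _ => ij, funext fun g => by simp [entryProd]⟩
  | one => exact ⟨0, Fin.elim0, funext fun g => by simp [entryProd]⟩
  | mul x y _ _ hx hy =>
    obtain ⟨k, f, rfl⟩ := hx
    obtain ⟨l, f', rfl⟩ := hy
    exact ⟨k + l, Fin.append f f', funext fun g => by simp [entryProd, Fin.prod_univ_add]⟩

lemma mem_span_entryProd {h : GL (Fin n) K → K} (hh : h ∈ polyFun K n) :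
    h ∈ Submodule.span K (Set.range fun q : Σ k, (Fin k → Fin n × Fin n) => entryProd K n q.2) := by
  have h1 : h ∈ Subalgebra.toSubmodule (polyFun K n) := hh
  rw [polyFun, Algebra.adjoin_eq_span] at h1
  refine Submodule.span_mono ?_ h1
  intro x hx
  obtain ⟨k, f, rfl⟩ := mem_closure_entries K n hx
  exact ⟨⟨k, f⟩, rfl⟩

variable {K n}

/-- The evaluation of a function on an element of the group algebra. -/
noncomputable def pairing {Γ : Type*} [Group Γ] (r : MonoidAlgebra K Γ) : (Γ → K) →ₗ[K] K where
  toFun h := r.coeff.sum fun g c => c * h g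
  map_add' h h' := by
    simp only [Pi.add_apply, mul_add]
    exact Finsupp.sum_add
  map_smul' t h := by
    simp only [Pi.smul_apply, smul_eq_mul, RingHom.id_apply]
    rw [Finsupp.mul_sum]
    exact Finsupp.sum_congr fun g _ => by ring

lemma apply_asAlgebraHom {Γ W : Type*} [Group Γ] [AddCommGroup W] [Module K W]
    (ρ : Representation K Γ W) (r : MonoidAlgebra K Γ) (φ : Module.Dual K W) (w : W) :
    φ (ρ.asAlgebraHom r w) = pairing r fun g => φ (ρ g w) := by
  rw [Representation.asAlgebraHom_def, MonoidAlgebra.lift_apply, Finsupp.sum, LinearMap.sum_apply,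
    map_sum]
  refine Finset.sum_congr rfl fun g _ => ?_
  rw [LinearMap.smul_apply, map_smul, smul_eq_mul]

/-- The representation underlying an object of `PolyRep`. -/
noncomputable abbrev PolyRep.rep (W : PolyRep K n) :
    Representation K (GL (Fin n) K) W.obj := W.obj.ρ

/-- A homomorphism of modules over the group algebra, as a morphism of representations. -/
lemma exists_lin_eq (W U : PolyRep K n) :
    letI := repModule (PolyRep.rep W)
    letI := repModule (PolyRep.rep U)
    ∀ φ : W.obj →ₗ[MonoidAlgebra K (GL (Fin n) K)] U.obj,
      ∃ f : W ⟶ U, ∀ v, PolyRep.lin f v = φ v := by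
  let _ := repModule (PolyRep.rep W)
  let _ := repModule (PolyRep.rep U)
  intro φ
  have := repModule_isScalarTower (PolyRep.rep W)
  have := repModule_isScalarTower (PolyRep.rep U)
  exact ⟨PolyRep.ofLin (φ.restrictScalars K) (map_rho_of_linear (τ := (PolyRep.rep W)) (τ' := (PolyRep.rep U)) φ),
    fun _ => rfl⟩

/-- The group algebra element acts by zero on the tensor powers of degree less than `d`. -/
def ActsZero (r : MonoidAlgebra K (GL (Fin n) K)) (d : ℕ) : Prop :=
  ∀ k < d, (PolyRep.rep (stdPow K n k)).asAlgebraHom r = 0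

/-- Products of `k` matrix entries are the matrix coefficients of the `k`-th tensor power. -/
lemma pairing_entryProd {r : MonoidAlgebra K (GL (Fin n) K)} {k : ℕ}
    (h : (PolyRep.rep (stdPow K n k)).asAlgebraHom r = 0) (f : Fin k → Fin n × Fin n) :
    pairing r (entryProd K n f) = 0 := by
  classical
  let b := stdPowBasis K n k
  have h1 := apply_asAlgebraHom (PolyRep.rep (stdPow K n k)) r (b.coord fun a => (f a).1)
    (b fun a => (f a).2)
  rw [h, LinearMap.zero_apply, map_zero] at h1
  rw [h1]
  congr 1
  funext g
  have h2 : (stdPow K n k).obj.ρ g (b fun a => (f a).2) = _ := rho_stdPowBasis K n k g _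
  rw [h2, map_sum, Finset.sum_eq_single (fun a => (f a).1)]
  · rw [map_smul, show stdPowBasis K n k (fun a => (f a).1) = b (fun a => (f a).1) from rfl,
      Module.Basis.coord_apply, b.repr_self, Finsupp.single_eq_same, smul_eq_mul, mul_one]
    rfl
  · intro i _ hi
    rw [map_smul, show stdPowBasis K n k i = b i from rfl,
      Module.Basis.coord_apply, b.repr_self, Finsupp.single_eq_of_ne hi.symm, smul_zero]
  · intro h
    exact absurd (Finset.mem_univ _) h

/-- A polynomial function is a combination of finitely many products of entries, so only finitely
many tensor powers matter. -/
lemma exists_degree {h : GL (Fin n) K → K} (hh : h ∈ polyFun K n) :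
    ∃ d, ∀ r : MonoidAlgebra K (GL (Fin n) K), ActsZero r d → pairing r h = 0 := by
  have h1 := mem_span_entryProd K n hh
  clear hh
  induction h1 using Submodule.span_induction with
  | mem x hx =>
    obtain ⟨⟨k, f⟩, rfl⟩ := hx
    exact ⟨k + 1, fun r hr => pairing_entryProd (hr k (Nat.lt_succ_self k)) f⟩
  | zero => exact ⟨0, fun r _ => map_zero _⟩
  | add x y _ _ hx hy =>
    obtain ⟨d, hd⟩ := hx
    obtain ⟨d', hd'⟩ := hy
    refine ⟨max d d', fun r hr => ?_⟩
    rw [map_add, hd r fun k hk => hr k (lt_max_of_lt_left hk),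
      hd' r fun k hk => hr k (lt_max_of_lt_right hk), add_zero]
  | smul t x _ hx =>
    obtain ⟨d, hd⟩ := hx
    exact ⟨d, fun r hr => by rw [map_smul, hd r hr, smul_zero]⟩

variable [CharZero K]

open PolyRep

/-- Schur–Weyl duality: the group elements span the commutant of the permutations, so the symmetric
group provides the semisimplicity. -/
lemma isSemisimpleModule_stdPow (k : ℕ) :
    letI := repModule (PolyRep.rep (stdPow K n k))
    IsSemisimpleModule (MonoidAlgebra K (GL (Fin n) K)) (stdPow K n k).obj := by
  refine isSemisimpleModule_of_commutant (permRep K n k) (PolyRep.rep (stdPow K n k)) ?_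
    (mem_span_rho_of_commute_perm K n k)
  exact fun g σ v => (lin_comm (permAct (stdRep K n) k σ) g v).symm

/-- Every polynomial representation is a retract of a sum of tensor powers of the standard
representation. -/
theorem exists_retract_stdPow (W : PolyRep K n) : ∃ (ι : Type) (_ : Fintype ι) (k : ι → ℕ)
    (i : ∀ q, W ⟶ stdPow K n (k q)) (e : ∀ q, stdPow K n (k q) ⟶ W),
    ∑ q, i q ≫ e q = 𝟙 W := by
  classical
  let Γ := GL (Fin n) K
  let w := Module.finBasis K W.obj
  have hd : ∀ ij : Fin (Module.finrank K W.obj) × Fin (Module.finrank K W.obj), ∃ d,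
      ∀ r : MonoidAlgebra K Γ, ActsZero r d →
        pairing r (fun g => w.coord ij.1 (W.obj.ρ g (w ij.2))) = 0 :=
    fun ij => exists_degree (W.property _ _)
  choose d hd using hd
  let D := Finset.univ.sup d
  -- One bound for all matrix coefficients of `W`: what acts by zero on the tensor powers of degree
  -- less than `D` acts by zero on `W`.
  have hD : ∀ r : MonoidAlgebra K Γ, ActsZero r D → (PolyRep.rep W).asAlgebraHom r = 0 := by
    intro r hr
    refine w.ext fun j => w.ext_elem fun i => ?_
    rw [LinearMap.zero_apply, map_zero, Finsupp.zero_apply, ← Module.Basis.coord_apply,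
      apply_asAlgebraHom]
    exact hd (i, j) r fun k hk => hr k (hk.trans_le (Finset.le_sup (f := d) (Finset.mem_univ _)))
  -- An index consists of a generator of `W`, a degree below `D` and a basis vector of that tensor
  -- power. The map `α` lets each component of a tuple of group algebra elements act on all these
  -- basis vectors, so its kernel consists of tuples that act by zero in all degrees below `D`; by
  -- `hD` they are killed by `β`.
  let ι : Type := Fin (Module.finrank K W.obj) × Σ k : Fin D, (Fin k → Fin n)
  let U : ι → Type u := fun q => (stdPow K n q.2.1).obj
  let iU : ∀ q : ι, AddCommGroup (U q) := fun q =>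
    inferInstanceAs (AddCommGroup (stdPow K n q.2.1).obj)
  let mU : ∀ q : ι, Module (MonoidAlgebra K Γ) (U q) := fun q =>
    repModule (PolyRep.rep (stdPow K n q.2.1))
  have sU : ∀ q : ι, IsSemisimpleModule (MonoidAlgebra K Γ) (U q) := fun q =>
    isSemisimpleModule_stdPow _
  let mW : Module (MonoidAlgebra K Γ) W.obj := repModule (PolyRep.rep W)
  let β : (Fin (Module.finrank K W.obj) → MonoidAlgebra K Γ) →ₗ[MonoidAlgebra K Γ] W.obj :=
    Fintype.linearCombination (MonoidAlgebra K Γ) w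
  let α : (Fin (Module.finrank K W.obj) → MonoidAlgebra K Γ) →ₗ[MonoidAlgebra K Γ] (∀ q, U q) :=
    LinearMap.pi fun q => (LinearMap.toSpanSingleton (MonoidAlgebra K Γ) (U q)
      (stdPowBasis K n q.2.1 q.2.2)) ∘ₗ LinearMap.proj q.1
  have hβ : ∀ x, β x = ∑ j, (PolyRep.rep W).asAlgebraHom (x j) (w j) := fun x => rfl
  obtain ⟨s, L, hsL⟩ := exists_retract_of_ker_le α β (fun v => by
    refine ⟨fun j => w.repr v j • 1, ?_⟩
    rw [hβ]
    conv_rhs => rw [← w.sum_repr v]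
    refine Finset.sum_congr rfl fun j _ => ?_
    rw [map_smul, map_one]
    rfl) (fun x hx => by
    rw [LinearMap.mem_ker, hβ]
    refine Finset.sum_eq_zero fun j _ => ?_
    rw [hD (x j) fun k hk => ?_, LinearMap.zero_apply]
    exact (stdPowBasis K n k).ext fun i => congrFun (LinearMap.mem_ker.mp hx) ⟨j, ⟨k, hk⟩, i⟩)
  choose i hi using fun q : ι => exists_lin_eq W (stdPow K n q.2.1) (LinearMap.proj q ∘ₗ s)
  choose e he using fun q : ι => exists_lin_eq (stdPow K n q.2.1) W
    (L ∘ₗ LinearMap.single _ U q)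
  refine ⟨ι, inferInstance, fun q => q.2.1, i, e, lin_injective (LinearMap.ext fun v => ?_)⟩
  rw [lin_sum, LinearMap.sum_apply]
  have h1 : ∀ q, lin (i q ≫ e q) v = L (Pi.single q (s v q)) := by
    intro q
    rw [lin_comp, LinearMap.comp_apply, he, hi]
    rfl
  rw [Finset.sum_congr rfl fun q _ => h1 q, ← map_sum, Finset.univ_sum_single, hsL]
  rfl

lemma nonempty_wordPresentation (W : PolyRep K n) :
    Nonempty (WordPresentation (stdRep K n) W) := by
  obtain ⟨ι, hι, k, i, e, h⟩ := exists_retract_stdPow W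
  refine ⟨{ ι := ι, word := fun q => Word.pow (k q), inc := fun q => i q ≫ (powIso _ _).inv,
            ret := fun q => (powIso _ _).hom ≫ e q, sum_eq := ?_ }⟩
  rw [← h]
  exact Finset.sum_congr rfl fun q _ => by
    rw [Category.assoc, Iso.inv_hom_id_assoc]

end CompleteReducibility

/-! ### Part (a): the functor on polynomial representations -/

section PartOne

open Limits

universe u

/-- A polynomial representation category maps to every category, by a functor that takes the standard
representation to a given object whose exterior power of degree `n + 1` vanishes. -/
theorem exists_braided_functor {K : Type u} [Field K] [CharZero K] (n : ℕ) {C : Type*}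
    [Category* C] [Preadditive C] [Linear K C] [HasFiniteBiproducts C] [IsIdempotentComplete C]
    [MonoidalCategory C] [SymmetricCategory C] [MonoidalPreadditive C] [MonoidalLinear K C] (X : C)
    (hX : IsZero (extPow K X (n + 1))) :
    ∃ (F : PolyRep K n ⥤ C) (_ : F.Braided), F.Additive ∧ F.Linear K ∧
      Nonempty (F.obj (stdRep K n) ≅ X) := by
  obtain ⟨i, e, -, h⟩ := extPow_spec K X (n + 1)
  have h0 : antisymmetrizer K X (n + 1) = 0 := by
    rw [← h, hX.eq_zero_of_tgt e, zero_comp]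
  exact (exists_wordFunctor_stdRep h0).some.exists_braided nonempty_wordPresentation

end PartOne
end RepGL

/-! ### Frames: a characterisation of the extended action -/

namespace RepGL

section Frames

open MonoidalLeftAction Filter

variable {B : Type*} [Category* B] [MonoidalCategory B] {P Q : ObjectProperty B}
  [P.IsMonoidal] [Q.IsMonoidal] {M : Type*} [Category* M] [MonoidalLeftAction P.FullSubcategory M]

namespace Frame

/-- A tensor product with an object of the big category, if it lies in the small category. -/
abbrev tw (a : P.FullSubcategory) (W : Q.FullSubcategory) (h : P (a.obj ⊗ W.obj)) :
    P.FullSubcategory := ⟨a.obj ⊗ W.obj, h⟩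

/-- Functoriality of `tw` in the first variable. -/
abbrev twL {a a' : P.FullSubcategory} (f : a ⟶ a') (W : Q.FullSubcategory)
    (h : P (a.obj ⊗ W.obj)) (h' : P (a'.obj ⊗ W.obj)) : tw a W h ⟶ tw a' W h' :=
  ObjectProperty.homMk (f.hom ▷ W.obj)

/-- Functoriality of `tw` in the second variable. -/
abbrev twR (a : P.FullSubcategory) {W W' : Q.FullSubcategory} (g : W ⟶ W')
    (h : P (a.obj ⊗ W.obj)) (h' : P (a.obj ⊗ W'.obj)) : tw a W h ⟶ tw a W' h' :=
  ObjectProperty.homMk (a.obj ◁ g.hom)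

/-- Compatibility of `tw` with tensor products in the first variable. -/
abbrev twA (b a : P.FullSubcategory) (W : Q.FullSubcategory) (h : P (a.obj ⊗ W.obj))
    (h' : P ((b.obj ⊗ a.obj) ⊗ W.obj)) : tw (b ⊗ a) W h' ≅ b ⊗ tw a W h :=
  P.isoMk (α_ b.obj a.obj W.obj)

/-- Compatibility of `tw` with tensor products in the second variable. -/
abbrev twB (a : P.FullSubcategory) (W W' : Q.FullSubcategory) (h : P (a.obj ⊗ W.obj))
    (h' : P ((a.obj ⊗ W.obj) ⊗ W'.obj)) (h'' : P (a.obj ⊗ (W.obj ⊗ W'.obj))) :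
    tw (tw a W h) W' h' ≅ tw a (W ⊗ W') h'' :=
  P.isoMk (α_ a.obj W.obj W'.obj)

end Frame

open RepGL.Frame

/-- An object `Y` which behaves like the result of letting `W` act on `m`: tensor products `a ⊗ W` in
the small category act on `m` as `a` acts on `Y`. -/
structure Frame (δ : ℕ → P.FullSubcategory) (W : Q.FullSubcategory) (m Y : M) where
  /-- the objects `a` which are considered -/
  S : P.FullSubcategory → Prop
  le : ∀ {a}, S a → P (a.obj ⊗ W.obj)
  tensor : ∀ {a} (b), S a → S (b ⊗ a)
  iso : ∀ {a b}, (a ≅ b) → S a → S b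
  large : ∀ V, Q V → ∀ᶠ l in atTop, ∀ h : P ((δ l).obj ⊗ V), S ⟨(δ l).obj ⊗ V, h⟩
  /-- the identification -/
  q : ∀ a (h : S a), a ⊙ₗ Y ≅ tw a W (le h) ⊙ₗ m
  nat : ∀ {a a'} (f : a ⟶ a') (h : S a) (h' : S a'),
    f ⊵ₗ Y ≫ (q a' h').hom = (q a h).hom ≫ twL f W (le h) (le h') ⊵ₗ m
  equi : ∀ (b a) (h : S a), (αₗ b a Y).hom ≫ b ⊴ₗ (q a h).hom =
    (q (b ⊗ a) (tensor b h)).hom ≫ (twA b a W (le h) (le (tensor b h))).hom ⊵ₗ m ≫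
      (αₗ b (tw a W (le h)) m).hom

namespace Frame

variable {δ : ℕ → P.FullSubcategory}

/-- The morphism `h` corresponds to the morphisms `g` and `f` on the object `a`. -/
def EqAt {W W' : Q.FullSubcategory} {m m' Y Y' : M} (φ : Frame δ W m Y) (φ' : Frame δ W' m' Y')
    (g : W ⟶ W') (f : m ⟶ m') (k : Y ⟶ Y') (a : P.FullSubcategory) : Prop :=
  ∀ (h : φ.S a) (h' : φ'.S a), a ⊴ₗ k ≫ (φ'.q a h').hom =
    (φ.q a h).hom ≫ twR a g (φ.le h) (φ'.le h') ⊵ₗ m ≫ tw a W' (φ'.le h') ⊴ₗ f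

/-- The morphism `h` corresponds to the morphisms `g` and `f`. -/
def IsMap {W W' : Q.FullSubcategory} {m m' Y Y' : M} (φ : Frame δ W m Y) (φ' : Frame δ W' m' Y')
    (g : W ⟶ W') (f : m ⟶ m') (k : Y ⟶ Y') : Prop := ∀ a, EqAt φ φ' g f k a

variable {W W' W'' : Q.FullSubcategory} {m m' m'' Y Y' Y'' : M} {φ : Frame δ W m Y}
  {φ' : Frame δ W' m' Y'} {φ'' : Frame δ W'' m'' Y''} {g : W ⟶ W'} {g' : W' ⟶ W''} {f : m ⟶ m'}
  {f' : m' ⟶ m''} {k : Y ⟶ Y'} {k' : Y' ⟶ Y''}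

/-- By `equi`, the compatibility at `b ⊗ a` is the image under `b` of the compatibility at `a`. It
can thus be multiplied by any `b`, and cancelled if `b` acts faithfully. -/
lemma EqAt.tensor_iff (a b : P.FullSubcategory) (h : φ.S a) (h' : φ'.S a) :
    EqAt φ φ' g f k (b ⊗ a) ↔ b ⊴ₗ (a ⊴ₗ k ≫ (φ'.q a h').hom) =
      b ⊴ₗ ((φ.q a h).hom ≫ twR a g (φ.le h) (φ'.le h') ⊵ₗ m ≫ tw a W' (φ'.le h') ⊴ₗ f) := by
  have h1 : (b ⊗ a) ⊴ₗ k ≫ (φ'.q (b ⊗ a) (φ'.tensor b h')).hom ≫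
      (twA b a W' (φ'.le h') (φ'.le (φ'.tensor b h'))).hom ⊵ₗ m' ≫
        (αₗ b (tw a W' (φ'.le h')) m').hom =
      (αₗ b a Y).hom ≫ b ⊴ₗ (a ⊴ₗ k ≫ (φ'.q a h').hom) := by
    rw [← φ'.equi b a h']
    simp
  have h3 : ((b ◁ twR a g (φ.le h) (φ'.le h')) : b ⊗ tw a W (φ.le h) ⟶ b ⊗ tw a W' (φ'.le h'))
      ⊵ₗ m ≫ (αₗ b (tw a W' (φ'.le h')) m).hom =
      (αₗ b (tw a W (φ.le h)) m).hom ≫ b ⊴ₗ (twR a g (φ.le h) (φ'.le h') ⊵ₗ m) := by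
    rw [whiskerLeft_actionHomLeft]
    simp only [Category.assoc, Iso.inv_hom_id, Category.comp_id]
  have h4 : (twA b a W (φ.le h) (φ.le (φ.tensor b h))).hom ≫
        (b ◁ twR a g (φ.le h) (φ'.le h') : b ⊗ tw a W (φ.le h) ⟶ b ⊗ tw a W' (φ'.le h')) =
      twR (b ⊗ a) g (φ.le (φ.tensor b h)) (φ'.le (φ'.tensor b h')) ≫
        (twA b a W' (φ'.le h') (φ'.le (φ'.tensor b h'))).hom := by
    ext
    simp
  have h5 : tw (b ⊗ a) W' (φ'.le (φ'.tensor b h')) ⊴ₗ f ≫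
      (twA b a W' (φ'.le h') (φ'.le (φ'.tensor b h'))).hom ⊵ₗ m' =
      (twA b a W' (φ'.le h') (φ'.le (φ'.tensor b h'))).hom ⊵ₗ m ≫
      (b ⊗ tw a W' (φ'.le h')) ⊴ₗ f := action_exchange _ _
  have h2 : ((φ.q (b ⊗ a) (φ.tensor b h)).hom ≫
      twR (b ⊗ a) g (φ.le (φ.tensor b h)) (φ'.le (φ'.tensor b h')) ⊵ₗ m ≫
      tw (b ⊗ a) W' (φ'.le (φ'.tensor b h')) ⊴ₗ f) ≫
      (twA b a W' (φ'.le h') (φ'.le (φ'.tensor b h'))).hom ⊵ₗ m' ≫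
        (αₗ b (tw a W' (φ'.le h')) m').hom =
      (αₗ b a Y).hom ≫ b ⊴ₗ ((φ.q a h).hom ≫ twR a g (φ.le h) (φ'.le h') ⊵ₗ m ≫
        tw a W' (φ'.le h') ⊴ₗ f) := by
    rw [actionHomRight_comp, reassoc_of% φ.equi b a h, actionHomRight_comp, ← reassoc_of% h3,
      ← comp_actionHomLeft_assoc, h4, comp_actionHomLeft_assoc]
    simp only [Category.assoc]
    rw [reassoc_of% h5]
    simp
  constructor
  · intro H
    rw [← cancel_epi (αₗ b a Y).hom, ← h1, ← h2, reassoc_of% H (φ.tensor b h) (φ'.tensor b h')]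
    simp only [Category.assoc]
  · intro H _ _
    rw [← cancel_mono ((twA b a W' (φ'.le h') (φ'.le (φ'.tensor b h'))).hom ⊵ₗ m' ≫
        (αₗ b (tw a W' (φ'.le h')) m').hom)]
    rw [h2, ← H, ← h1]
    simp only [Category.assoc]

lemma EqAt.of_iso {a b : P.FullSubcategory} (e : a ≅ b) (H : EqAt φ φ' g f k a) :
    EqAt φ φ' g f k b := by
  intro h h'
  have ha := φ.iso e.symm h
  have ha' := φ'.iso e.symm h'
  rw [← cancel_epi (e.hom ⊵ₗ Y)]
  have h1 : twL e.hom W (φ.le ha) (φ.le h) ≫ twR b g (φ.le h) (φ'.le h') =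
      twR a g (φ.le ha) (φ'.le ha') ≫ twL e.hom W' (φ'.le ha') (φ'.le h') := by
    ext
    simp [whisker_exchange]
  rw [← action_exchange_assoc, φ'.nat e.hom ha' h', reassoc_of% H ha ha',
    reassoc_of% φ.nat e.hom ha h, ← comp_actionHomLeft_assoc, h1, comp_actionHomLeft_assoc,
    action_exchange]

end Frame

end Frames
end RepGL

/-! ### Frames for composites, for the given action and for the unit -/

namespace RepGL

section FrameConstructions

open MonoidalLeftAction Filter RepGL.Frame

variable {B : Type*} [Category* B] [MonoidalCategory B]
  {P Q : ObjectProperty B} [P.IsMonoidal] [Q.IsMonoidal] {M : Type*} [Category* M]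
  [MonoidalLeftAction P.FullSubcategory M] {δ : ℕ → P.FullSubcategory}

namespace Frame

/-- The action of an isomorphism. -/
@[simps]
def actIso {A : Type*} [Category* A] [MonoidalCategory A] [MonoidalLeftAction A M] {a b : A}
    (e : a ≅ b) (m : M) : a ⊙ₗ m ≅ b ⊙ₗ m where
  hom := e.hom ⊵ₗ m
  inv := e.inv ⊵ₗ m
  hom_inv_id := hom_inv_actionHomLeft e m
  inv_hom_id := inv_hom_actionHomLeft e m

variable {W W' : Q.FullSubcategory} {m Y Y' : M}

/-- The frame for an iterated action. -/
@[simps]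
def compFrame [P.IsClosedUnderIsomorphisms] (φ : Frame δ W Y' Y) (φ' : Frame δ W' m Y') :
    Frame δ (W ⊗ W') m Y where
  -- Both stages have to be admissible: first `a` moves past `W`, then `a ⊗ W` moves past `W'`.
  S a := ∃ h : φ.S a, φ'.S (tw a W (φ.le h))
  le h := P.prop_of_iso (α_ _ _ _) (φ'.le h.2)
  tensor {a} b h := ⟨φ.tensor b h.1, φ'.iso (twA b a W (φ.le h.1) _).symm (φ'.tensor b h.2)⟩
  iso {a b} e h := ⟨φ.iso e h.1, φ'.iso (P.isoMk (whiskerRightIso (P.ι.mapIso e) W.obj)) h.2⟩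
  large V hV := by
    -- The second stage needs `(δ l ⊗ V) ⊗ W`, which is covered by largeness of `φ'` for `V ⊗ W`.
    filter_upwards [φ.large V hV, φ'.large (V ⊗ W.obj) (Q.prop_tensor hV W.2)] with l h h' hl
    exact ⟨h hl, φ'.iso (P.isoMk (α_ _ _ _).symm)
      (h' (P.prop_of_iso (α_ _ _ _) (φ.le (h hl))))⟩
  q a h := φ.q a h.1 ≪≫ φ'.q (tw a W (φ.le h.1)) h.2 ≪≫
    actIso (twB a W W' (φ.le h.1) (φ'.le h.2) (P.prop_of_iso (α_ _ _ _) (φ'.le h.2))) m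
  nat := by
    rintro a a' f ⟨h₁, h₂⟩ ⟨h₁', h₂'⟩
    simp only [Iso.trans_hom, actIso_hom, Category.assoc]
    rw [reassoc_of% φ.nat f h₁ h₁', reassoc_of% φ'.nat (twL f W (φ.le h₁) (φ.le h₁')) h₂ h₂',
      ← comp_actionHomLeft, ← comp_actionHomLeft]
    congr 3
    ext
    exact MonoidalCategory.associator_naturality_left f.hom W.obj W'.obj
  equi := by
    rintro b a ⟨h₁, h₂⟩
    simp only [Iso.trans_hom, actIso_hom, Category.assoc, actionHomRight_comp]
    have h₃ := φ'.tensor b h₂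
    have h₄ := φ'.iso (twA b a W (φ.le h₁) (φ.le (φ.tensor b h₁))).symm h₃
    have e1 := φ'.nat (twA b a W (φ.le h₁) (φ.le (φ.tensor b h₁))).hom h₄ h₃
    rw [reassoc_of% φ.equi b a h₁, reassoc_of% φ'.equi b _ h₂, reassoc_of% e1]
    have e2 : (αₗ b (tw (tw a W (φ.le h₁)) W' (φ'.le h₂)) m).hom ≫
        b ⊴ₗ ((twB a W W' (φ.le h₁) (φ'.le h₂)
          (P.prop_of_iso (α_ _ _ _) (φ'.le h₂))).hom ⊵ₗ m) =
        (b ◁ (twB a W W' (φ.le h₁) (φ'.le h₂)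
          (P.prop_of_iso (α_ _ _ _) (φ'.le h₂))).hom) ⊵ₗ m ≫ (αₗ b _ m).hom := by
      rw [whiskerLeft_actionHomLeft]
      simp only [Category.assoc, Iso.inv_hom_id, Category.comp_id]
    rw [e2]
    simp only [← comp_actionHomLeft_assoc]
    congr 4
    ext
    exact pentagon _ _ _ _

/-- The frame for the action of an object of the small category. -/
@[simps]
def actFrame (hPQ : P ≤ Q) (a : P.FullSubcategory) (m : M) :
    Frame δ ((ObjectProperty.ιOfLE hPQ).obj a) m (a ⊙ₗ m) where
  S _ := True
  le {b} _ := P.prop_tensor b.2 a.2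
  tensor _ _ := trivial
  iso _ _ := trivial
  large _ _ := Eventually.of_forall fun _ _ => trivial
  q b _ := (αₗ b a m).symm
  nat := by
    intro b b' f h h'
    rw [Iso.symm_hom, Iso.symm_hom, Iso.comp_inv_eq, Category.assoc]
    exact actionHomLeft_action f a m
  equi := by
    intro b c h
    rw [Iso.symm_hom, Iso.symm_hom, Iso.eq_inv_comp]
    rw [← Category.assoc, ← associator_actionHom b c a m, Category.assoc, Category.assoc,
      actionHomRight_hom_inv, Category.comp_id]
    rfl

/-- The frame for the action of the unit. -/
@[simps]
def unitFrame (m : M) : Frame δ (𝟙_ Q.FullSubcategory) m m where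
  S _ := True
  le {b} _ := P.prop_tensor b.2 P.prop_unit
  tensor _ _ := trivial
  iso _ _ := trivial
  large _ _ := Eventually.of_forall fun _ _ => trivial
  q b _ := actIso (P.isoMk (ρ_ b.obj).symm) m
  nat := by
    intro a a' f h h'
    rw [actIso_hom, actIso_hom, ← comp_actionHomLeft, ← comp_actionHomLeft]
    congr 1
    ext
    exact rightUnitor_inv_naturality f.hom
  equi := by
    intro b a h
    rw [actIso_hom, actIso_hom, ← comp_actionHomLeft_assoc]
    have h1 : (P.isoMk (ρ_ (b ⊗ a).obj).symm).hom ≫ (twA b a (𝟙_ Q.FullSubcategory)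
        (P.prop_tensor a.2 P.prop_unit) (P.prop_tensor (b ⊗ a).2 P.prop_unit)).hom =
        b ◁ (P.isoMk (ρ_ a.obj).symm : a ≅ tw a (𝟙_ Q.FullSubcategory)
          (P.prop_tensor a.2 P.prop_unit)).hom := by
      ext
      exact (MonoidalCategory.whiskerLeft_rightUnitor_inv b.obj a.obj).symm
    rw [h1, whiskerLeft_actionHomLeft]
    simp only [Category.assoc, Iso.inv_hom_id, Category.comp_id]

end Frame

end FrameConstructions

/-! ### Existence and uniqueness of maps of frames -/

section FrameMaps

open MonoidalLeftAction Filter RepGL.Frame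

variable {B : Type*} [Category* B] [MonoidalCategory B] [SymmetricCategory B]
  {P Q : ObjectProperty B} [P.IsMonoidal] [Q.IsMonoidal] {M : Type*} [Category* M]
  [MonoidalLeftAction P.FullSubcategory M] {δ : ℕ → P.FullSubcategory}
  [hδ : ∀ l, ((curriedAction P.FullSubcategory M).obj (δ l)).IsEquivalence]

lemma actionHomRight_injective (d : P.FullSubcategory)
    [((curriedAction P.FullSubcategory M).obj d).Faithful] {m m' : M} {f g : m ⟶ m'}
    (h : d ⊴ₗ f = d ⊴ₗ g) : f = g :=
  ((curriedAction P.FullSubcategory M).obj d).map_injective h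

namespace Frame

lemma eventually_S {W : Q.FullSubcategory} {m Y : M} (φ : Frame δ W m Y) :
    ∀ᶠ l in atTop, φ.S (δ l) := by
  filter_upwards [φ.large (𝟙_ B) Q.prop_unit] with l hl
  exact φ.iso (P.isoMk (ρ_ _)) (hl (P.prop_tensor (δ l).2 P.prop_unit))

variable {W W' W'' : Q.FullSubcategory} {m m' m'' Y Y' Y'' : M} {φ : Frame δ W m Y}
  {φ' : Frame δ W' m' Y'} {φ'' : Frame δ W'' m'' Y''} {g : W ⟶ W'} {g' : W' ⟶ W''} {f : m ⟶ m'}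
  {f' : m' ⟶ m''} {k : Y ⟶ Y'} {k' : Y' ⟶ Y''}

/-- From `d` the compatibility passes to `a ⊗ d`, through the braiding to `d ⊗ a`, and from there to
`a` by cancelling the faithful `d`. -/
lemma EqAt.isMap {d : P.FullSubcategory} [((curriedAction P.FullSubcategory M).obj d).Faithful]
    (h : φ.S d) (h' : φ'.S d) (H : EqAt φ φ' g f k d) : IsMap φ φ' g f k := fun a ha ha' =>
  actionHomRight_injective d ((EqAt.tensor_iff a d ha ha').mp
    (EqAt.of_iso (β_ a d) ((EqAt.tensor_iff d a h h').mpr (congrArg (a ⊴ₗ ·) (H h h')))))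

lemma isMap_of_eventually (H : ∀ᶠ l in atTop, EqAt φ φ' g f k (δ l)) : IsMap φ φ' g f k := by
  obtain ⟨l, h1, h2, h3⟩ := (φ.eventually_S.and (φ'.eventually_S.and H)).exists
  exact h3.isMap h1 h2

/-- At an admissible `δ l` the compatibility determines `δ l ⊴ₗ k`, and `δ l` acts faithfully. -/
lemma IsMap.eq {k₁ k₂ : Y ⟶ Y'} (h₁ : IsMap φ φ' g f k₁) (h₂ : IsMap φ φ' g f k₂) : k₁ = k₂ := by
  obtain ⟨l, h, h'⟩ := (φ.eventually_S.and φ'.eventually_S).exists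
  refine actionHomRight_injective (δ l) ?_
  rw [← cancel_mono (φ'.q (δ l) h').hom, h₁ _ h h', h₂ _ h h']

-- At an admissible `δ l` the required value of `δ l ⊴ₗ k` can be written down, and it has a
-- preimage because `δ l` acts fully.
variable (φ φ' g f) in
lemma exists_isMap : ∃ k, IsMap φ φ' g f k := by
  obtain ⟨l, h, h'⟩ := (φ.eventually_S.and φ'.eventually_S).exists
  obtain ⟨k, hk⟩ := ((curriedAction P.FullSubcategory M).obj (δ l)).map_surjective
    ((φ.q (δ l) h).hom ≫ twR (δ l) g (φ.le h) (φ'.le h') ⊵ₗ m ≫ tw (δ l) W' (φ'.le h') ⊴ₗ f ≫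
      (φ'.q (δ l) h').inv)
  replace hk : δ l ⊴ₗ k = (φ.q (δ l) h).hom ≫ twR (δ l) g (φ.le h) (φ'.le h') ⊵ₗ m ≫
      tw (δ l) W' (φ'.le h') ⊴ₗ f ≫ (φ'.q (δ l) h').inv := hk
  refine ⟨k, EqAt.isMap h h' fun _ _ => ?_⟩
  rw [hk]
  simp only [Category.assoc, Iso.inv_hom_id, Category.comp_id]

variable (φ φ' g f) in
/-- The morphism corresponding to given morphisms. -/
noncomputable def map : Y ⟶ Y' := (exists_isMap φ φ' g f).choose

variable (φ φ' g f) in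
lemma map_isMap : IsMap φ φ' g f (map φ φ' g f) := (exists_isMap φ φ' g f).choose_spec

omit [SymmetricCategory B] hδ in
lemma isMap_id : IsMap φ φ (𝟙 W) (𝟙 m) (𝟙 Y) := by
  intro a h _
  have : twR a (𝟙 W) (φ.le h) (φ.le h) = 𝟙 _ := by
    ext
    exact whiskerLeft_id _ _
  rw [this]
  simp

/-- Pasting at `a` requires `a` to be admissible for the middle frame as well; this holds at `δ l`
for large `l`, which suffices. -/
lemma IsMap.comp (h₁ : IsMap φ φ' g f k) (h₂ : IsMap φ' φ'' g' f' k') :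
    IsMap φ φ'' (g ≫ g') (f ≫ f') (k ≫ k') := by
  apply isMap_of_eventually
  filter_upwards [φ'.eventually_S] with l h' h h''
  have : twR (δ l) (g ≫ g') (φ.le h) (φ''.le h'') =
      twR (δ l) g (φ.le h) (φ'.le h') ≫ twR (δ l) g' (φ'.le h') (φ''.le h'') := by
    ext
    exact whiskerLeft_comp _ _ _
  rw [this, actionHomRight_comp, Category.assoc, h₂ _ h' h'', reassoc_of% h₁ _ h h',
    comp_actionHomLeft, actionHomRight_comp, action_exchange_assoc]
  simp only [Category.assoc]

lemma IsMap.congr {g₁ : W ⟶ W'} {f₁ : m ⟶ m'} (h : IsMap φ φ' g f k) (hg : g = g₁) (hf : f = f₁) :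
    IsMap φ φ' g₁ f₁ k := by
  subst hg hf
  exact h

/-- Two objects with the same properties are isomorphic. -/
noncomputable def mapIso (φ : Frame δ W m Y) (φ' : Frame δ W m Y') : Y ≅ Y' where
  hom := map φ φ' (𝟙 W) (𝟙 m)
  inv := map φ' φ (𝟙 W) (𝟙 m)
  hom_inv_id := (((map_isMap φ φ' _ _).comp (map_isMap φ' φ _ _)).congr (Category.comp_id _)
    (Category.comp_id _)).eq isMap_id
  inv_hom_id := (((map_isMap φ' φ _ _).comp (map_isMap φ φ' _ _)).congr (Category.comp_id _)
    (Category.comp_id _)).eq isMap_id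

lemma mapIso_hom_isMap (φ : Frame δ W m Y) (φ' : Frame δ W m Y') :
    IsMap φ φ' (𝟙 W) (𝟙 m) (mapIso φ φ').hom := map_isMap _ _ _ _

lemma mapIso_inv_isMap (φ : Frame δ W m Y) (φ' : Frame δ W m Y') :
    IsMap φ' φ (𝟙 W) (𝟙 m) (mapIso φ φ').inv := map_isMap _ _ _ _

end Frame

end FrameMaps
end RepGL

/-! ### Exchange of acting objects and existence of frames -/

namespace RepGL

section ActionExchange

open MonoidalLeftAction RepGL.Frame

lemma exch_tensor_left {B : Type*} [Category* B] [MonoidalCategory B] [BraidedCategory B]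
    (b a d W : B) : exch (b ⊗ a) d W ≫ d ◁ (α_ b a W).hom =
      (α_ b a (d ⊗ W)).hom ≫ b ◁ exch a d W ≫ exch b d (a ⊗ W) := by
  simp only [exch, BraidedCategory.braiding_tensor_left_hom]
  monoidal

variable {A : Type*} [Category* A] [MonoidalCategory A] {M : Type*} [Category* M]
  [MonoidalLeftAction A M]

lemma assoc_actionHomRight_left (b : A) {c c' : A} (f : c ⟶ c') (Y : M) :
    (αₗ b c Y).hom ≫ b ⊴ₗ (f ⊵ₗ Y) = (b ◁ f) ⊵ₗ Y ≫ (αₗ b c' Y).hom := by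
  rw [whiskerLeft_actionHomLeft]
  simp only [Category.assoc, Iso.inv_hom_id, Category.comp_id]

lemma assoc_actionHomRight_right (a b : A) {Y Y' : M} (f : Y ⟶ Y') :
    (αₗ a b Y).hom ≫ a ⊴ₗ (b ⊴ₗ f) = (a ⊗ b) ⊴ₗ f ≫ (αₗ a b Y').hom := by
  rw [tensor_actionHomRight]
  simp only [Category.assoc, Iso.inv_hom_id, Category.comp_id]

lemma assoc_actionHomLeft {a a' : A} (f : a ⟶ a') (b : A) (Y : M) :
    (αₗ a b Y).hom ≫ f ⊵ₗ (b ⊙ₗ Y) = (f ▷ b) ⊵ₗ Y ≫ (αₗ a' b Y).hom := by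
  rw [actionHomLeft_action, Iso.hom_inv_id_assoc]

variable [SymmetricCategory A]

lemma exch_whiskerLeft_braiding (d b a : A) :
    exch d b a ≫ b ◁ (β_ d a).hom = (β_ d (b ⊗ a)).hom ≫ (α_ b a d).hom := by
  simp [exch, BraidedCategory.braiding_tensor_right_hom]

/-- The exchange of two acting objects. -/
def actExch (d a : A) (Y : M) : d ⊙ₗ a ⊙ₗ Y ≅ a ⊙ₗ d ⊙ₗ Y :=
  (αₗ d a Y).symm ≪≫ actIso (β_ d a) Y ≪≫ αₗ a d Y

lemma actExch_hom (d a : A) (Y : M) :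
    (actExch d a Y).hom = (αₗ d a Y).inv ≫ (β_ d a).hom ⊵ₗ Y ≫ (αₗ a d Y).hom := rfl

lemma actExch_natural (d a : A) {Y Y' : M} (f : Y ⟶ Y') :
    d ⊴ₗ (a ⊴ₗ f) ≫ (actExch d a Y').hom = (actExch d a Y).hom ≫ a ⊴ₗ (d ⊴ₗ f) := by
  rw [← cancel_epi (αₗ d a Y).hom, reassoc_of% assoc_actionHomRight_right]
  simp only [actExch_hom, Category.assoc, Iso.hom_inv_id_assoc]
  rw [assoc_actionHomRight_right, action_exchange_assoc]

lemma actExch_natural_left (d : A) {a a' : A} (f : a ⟶ a') (Y : M) :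
    d ⊴ₗ (f ⊵ₗ Y) ≫ (actExch d a' Y).hom = (actExch d a Y).hom ≫ f ⊵ₗ (d ⊙ₗ Y) := by
  rw [← cancel_epi (αₗ d a Y).hom, reassoc_of% assoc_actionHomRight_left d]
  simp only [actExch_hom, Category.assoc, Iso.hom_inv_id_assoc]
  rw [assoc_actionHomLeft, ← comp_actionHomLeft_assoc, ← comp_actionHomLeft_assoc,
    BraidedCategory.braiding_naturality_right]

/-- Translates the exchange on `M` into `exch` in the acting category, where the braid identities
are available. -/
lemma assoc_actExch (d b x : A) (Y : M) :
    (αₗ d (b ⊗ x) Y).hom ≫ d ⊴ₗ (αₗ b x Y).hom ≫ (actExch d b (x ⊙ₗ Y)).hom =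
      exch d b x ⊵ₗ Y ≫ (αₗ b (d ⊗ x) Y).hom ≫ b ⊴ₗ (αₗ d x Y).hom := by
  rw [← cancel_epi ((α_ d b x).hom ⊵ₗ Y), ← comp_actionHomLeft_assoc, exch,
    Iso.hom_inv_id_assoc, comp_actionHomLeft_assoc, associator_actionHom]
  have := associator_actionHom d b x Y
  rw [reassoc_of% this, actExch_hom, Iso.hom_inv_id_assoc, reassoc_of% assoc_actionHomLeft]

/-- The hexagon axiom, seen through the action. -/
lemma actExch_tensor (d b a : A) (Y : M) :
    d ⊴ₗ (αₗ b a Y).hom ≫ (actExch d b (a ⊙ₗ Y)).hom ≫ b ⊴ₗ (actExch d a Y).hom =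
      (actExch d (b ⊗ a) Y).hom ≫ (αₗ b a (d ⊙ₗ Y)).hom := by
  rw [← cancel_epi (αₗ d (b ⊗ a) Y).hom, reassoc_of% assoc_actExch, actExch_hom d a,
    ← actionHomRight_comp, Iso.hom_inv_id_assoc, actionHomRight_comp,
    reassoc_of% assoc_actionHomRight_left b, ← comp_actionHomLeft_assoc, exch_whiskerLeft_braiding,
    comp_actionHomLeft_assoc, associator_actionHom, actExch_hom]
  simp only [Category.assoc, Iso.hom_inv_id_assoc]

end ActionExchange

section FrameExistence

open MonoidalLeftAction Filter RepGL.Frame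

variable {B : Type*} [Category* B] [MonoidalCategory B] [SymmetricCategory B]
  {P Q : ObjectProperty B} [P.IsMonoidal] [Q.IsMonoidal] {M : Type*} [Category* M]
  [MonoidalLeftAction P.FullSubcategory M] {δ : ℕ → P.FullSubcategory}
  [hδ : ∀ l, ((curriedAction P.FullSubcategory M).obj (δ l)).IsEquivalence]
  [P.IsClosedUnderIsomorphisms]

namespace Frame

/-- The exchange, for `tw`. -/
abbrev twX (a d : P.FullSubcategory) (W : Q.FullSubcategory) (h : P (a.obj ⊗ W.obj))
    (h' : P (d.obj ⊗ W.obj)) : a ⊗ tw d W h' ⟶ d ⊗ tw a W h :=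
  ObjectProperty.homMk (exch a.obj d.obj W.obj)

lemma twX_natural {a a' : P.FullSubcategory} (f : a ⟶ a') (d : P.FullSubcategory)
    (W : Q.FullSubcategory) (h : P (a.obj ⊗ W.obj)) (h₁ : P (a'.obj ⊗ W.obj))
    (h' : P (d.obj ⊗ W.obj)) : f ▷ tw d W h' ≫ twX a' d W h₁ h' =
      twX a d W h h' ≫ d ◁ twL f W h h₁ := by
  ext
  change f.hom ▷ (d.obj ⊗ W.obj) ≫ exch a'.obj d.obj W.obj =
    exch a.obj d.obj W.obj ≫ d.obj ◁ f.hom ▷ W.obj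
  simp [exch, ← comp_whiskerRight_assoc]

/-- The hexagon axiom again; symmetry of the braiding enters in cancelling two opposite exchanges of
`d` and `b`. -/
lemma twX_tensor (b a d : P.FullSubcategory) (W : Q.FullSubcategory) (h : P (a.obj ⊗ W.obj))
    (h' : P (d.obj ⊗ W.obj)) (h'' : P ((b.obj ⊗ a.obj) ⊗ W.obj)) :
    (α_ b a (tw d W h')).hom ≫ b ◁ twX a d W h h' =
      twX (b ⊗ a) d W h'' h' ≫ d ◁ (twA b a W h h'').hom ≫ exch d b (tw a W h) := by
  ext
  change (α_ b.obj a.obj (d.obj ⊗ W.obj)).hom ≫ b.obj ◁ exch a.obj d.obj W.obj =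
    exch (b.obj ⊗ a.obj) d.obj W.obj ≫ d.obj ◁ (α_ b.obj a.obj W.obj).hom ≫
      exch d.obj b.obj (a.obj ⊗ W.obj)
  rw [← Category.assoc (exch _ _ _), exch_tensor_left]
  simp only [Category.assoc, exch_exch, Category.comp_id]

/-- With `d = δ l` such that `d ⊗ W` lies in the small category, `Y` is a preimage of `(d ⊗ W) · m`
under the equivalence given by `d`. The isomorphism `q a` is determined by its image under `d`,
namely `d·a·Y ≅ a·d·Y ≅ a·(d ⊗ W)·m ≅ d·(a ⊗ W)·m`, and the axioms are checked after applying the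
faithful `d`. -/
theorem nonempty (hlarge : ∀ V, Q V → ∀ᶠ l in atTop, P ((δ l).obj ⊗ V)) (W : Q.FullSubcategory)
    (m : M) : ∃ Y : M, Nonempty (Frame δ W m Y) := by
  obtain ⟨l, hd⟩ := (hlarge W.obj W.property).exists
  generalize hdl : δ l = d at hd
  have hT : ((curriedAction P.FullSubcategory M).obj d).IsEquivalence := hdl ▸ hδ l
  let T := (curriedAction P.FullSubcategory M).obj d
  let Y : M := T.objPreimage (tw d W hd ⊙ₗ m)
  let ε : d ⊙ₗ Y ≅ tw d W hd ⊙ₗ m := T.objObjPreimageIso (tw d W hd ⊙ₗ m)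
  let p (a : P.FullSubcategory) (h : P (a.obj ⊗ W.obj)) :
      d ⊙ₗ (a ⊙ₗ Y) ≅ d ⊙ₗ (tw a W h ⊙ₗ m) :=
    actExch d a Y ≪≫ ((curriedAction P.FullSubcategory M).obj a).mapIso ε ≪≫
      (αₗ a (tw d W hd) m).symm ≪≫ actIso (P.isoMk ⟨exch a.obj d.obj W.obj,
        exch d.obj a.obj W.obj, exch_exch _ _ _, exch_exch _ _ _⟩) m ≪≫ αₗ d (tw a W h) m
  have hp : ∀ a h, (p a h).hom = (actExch d a Y).hom ≫ a ⊴ₗ ε.hom ≫ (αₗ a (tw d W hd) m).inv ≫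
      twX a d W h hd ⊵ₗ m ≫ (αₗ d (tw a W h) m).hom := fun a h => rfl
  let q (a : P.FullSubcategory) (h : P (a.obj ⊗ W.obj)) : a ⊙ₗ Y ≅ tw a W h ⊙ₗ m :=
    T.preimageIso (p a h)
  have hq : ∀ a h, d ⊴ₗ (q a h).hom = (actExch d a Y).hom ≫ a ⊴ₗ ε.hom ≫
      (αₗ a (tw d W hd) m).inv ≫ twX a d W h hd ⊵ₗ m ≫ (αₗ d (tw a W h) m).hom := fun a h =>
    (T.map_preimage (p a h).hom).trans (hp a h)
  have tens : ∀ {a} (b : P.FullSubcategory), P (a.obj ⊗ W.obj) → P ((b ⊗ a).obj ⊗ W.obj) :=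
    fun b h => P.prop_of_iso (α_ _ _ _).symm (P.prop_tensor b.2 h)
  refine ⟨Y, ⟨{
    S := fun a => P (a.obj ⊗ W.obj)
    le := id
    tensor := tens
    iso := fun e h => P.prop_of_iso (whiskerRightIso (P.ι.mapIso e) W.obj) h
    large := fun V hV => (hlarge (V ⊗ W.obj) (Q.prop_tensor hV W.2)).mono fun l hl _ =>
      P.prop_of_iso (α_ _ _ _).symm hl
    q := q
    nat := ?_
    equi := ?_ }⟩⟩
  · intro a a' f h h'
    apply actionHomRight_injective d
    rw [actionHomRight_comp, actionHomRight_comp, hq, hq, reassoc_of% actExch_natural_left,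
      ← action_exchange_assoc]
    simp only [Category.assoc]
    rw [assoc_actionHomRight_left d, ← comp_actionHomLeft_assoc, ← twX_natural f d W h h' hd,
      comp_actionHomLeft_assoc, actionHomLeft_action]
    simp only [Category.assoc, Iso.hom_inv_id_assoc]
  · intro b a h
    apply actionHomRight_injective d
    -- The exchange turns `d ⊴ₗ (b ⊴ₗ q)` into `b ⊴ₗ (d ⊴ₗ q)`, where the formula `hq` applies.
    rw [← cancel_mono (actExch d b (tw a W h ⊙ₗ m)).hom]
    simp only [actionHomRight_comp, Category.assoc]
    rw [actExch_natural, hq, hq]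
    simp only [actionHomRight_comp, Category.assoc]
    rw [reassoc_of% actExch_tensor, reassoc_of% assoc_actionHomRight_right, reassoc_of% assoc_actionHomRight_left d,
      assoc_actExch]
    have e1 : (αₗ b a (tw d W hd ⊙ₗ m)).hom ≫ b ⊴ₗ (αₗ a (tw d W hd) m).inv =
        (αₗ (b ⊗ a) (tw d W hd) m).inv ≫ (α_ b a (tw d W hd)).hom ⊵ₗ m ≫
          (αₗ b (a ⊗ tw d W hd) m).hom := by
      rw [Iso.eq_inv_comp, ← Category.assoc, ← associator_actionHom]
      simp only [Category.assoc, actionHomRight_hom_inv, Category.comp_id]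
    rw [reassoc_of% e1, reassoc_of% assoc_actionHomRight_left b, ← comp_actionHomLeft_assoc,
      twX_tensor b a d W h hd (tens b h)]
    simp only [comp_actionHomLeft_assoc]

end Frame

end FrameExistence
end RepGL

/-! ### Coherence morphisms as maps of frames -/

namespace RepGL

section FrameCalculus

open MonoidalLeftAction Filter RepGL.Frame

variable {B : Type*} [Category* B] [MonoidalCategory B]
  {P Q : ObjectProperty B} [P.IsMonoidal] [Q.IsMonoidal] {M : Type*} [Category* M]
  [MonoidalLeftAction P.FullSubcategory M] {δ : ℕ → P.FullSubcategory}

namespace Frame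

/-- This and the following lemmas exhibit the structure morphisms of the given action, and
identities of `Y`, as the maps of frames over the structure morphisms of the acting category. With
uniqueness they yield the coherence of the extended action and its comparison with the given one. -/
lemma isMap_unitFrame {m m' : M} (f : m ⟶ m') :
    IsMap (Q := Q) (δ := δ) (unitFrame m) (unitFrame m') (𝟙 _) f f := by
  intro a h h'
  have : twR a (𝟙 (𝟙_ Q.FullSubcategory)) (P.prop_tensor a.2 P.prop_unit)
      (P.prop_tensor a.2 P.prop_unit) = 𝟙 _ := by
    ext
    exact whiskerLeft_id _ _
  rw [this, id_actionHomLeft, Category.id_comp]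
  exact action_exchange _ _

lemma isMap_actFrame (hPQ : P ≤ Q) {a a' : P.FullSubcategory} (g : a ⟶ a') {m m' : M}
    (f : m ⟶ m') :
    IsMap (δ := δ) (actFrame hPQ a m) (actFrame hPQ a' m') ((ObjectProperty.ιOfLE hPQ).map g) f
      (g ⊵ₗ m ≫ a' ⊴ₗ f) := by
  intro b h h'
  change b ⊴ₗ (g ⊵ₗ m ≫ a' ⊴ₗ f) ≫ (αₗ b a' m').inv =
    (αₗ b a m).inv ≫ (b ◁ g) ⊵ₗ m ≫ (b ⊗ a') ⊴ₗ f
  rw [Iso.comp_inv_eq, Category.assoc,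
    Category.assoc, Iso.eq_inv_comp, actionHomRight_comp, reassoc_of% assoc_actionHomRight_left,
    assoc_actionHomRight_right]

lemma isMap_actFrame_unit (hPQ : P ≤ Q) (m : M) :
    IsMap (δ := δ) (actFrame hPQ (𝟙_ _) m) (unitFrame m) (ObjectProperty.homMk (𝟙 (𝟙_ B))) (𝟙 m)
      (λₗ m).hom := by
  intro b h h'
  have e : b ◁ 𝟙 (𝟙_ P.FullSubcategory) = 𝟙 _ := whiskerLeft_id _ _
  change b ⊴ₗ (λₗ m).hom ≫ (ρ_ b).inv ⊵ₗ m =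
    (αₗ b (𝟙_ _) m).inv ≫ (b ◁ 𝟙 (𝟙_ _)) ⊵ₗ m ≫ (b ⊗ 𝟙_ _) ⊴ₗ 𝟙 m
  rw [e, id_actionHomLeft, Category.id_comp, actionHomRight_id, Category.comp_id,
    ← cancel_epi (αₗ b (𝟙_ _) m).hom, Iso.hom_inv_id, ← rightUnitor_actionHom_assoc]
  exact hom_inv_actionHomLeft (ρ_ b) m

variable [P.IsClosedUnderIsomorphisms]

lemma isMap_actFrame_tensor (hPQ : P ≤ Q) (a b : P.FullSubcategory) (m : M) :
    IsMap (δ := δ) (actFrame hPQ (a ⊗ b) m)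
      (compFrame (actFrame hPQ a (b ⊙ₗ m)) (actFrame hPQ b m))
      (ObjectProperty.homMk (𝟙 (a.obj ⊗ b.obj))) (𝟙 m) (αₗ a b m).hom := by
  intro c h h'
  have e : c ◁ 𝟙 (a ⊗ b) = 𝟙 _ := whiskerLeft_id _ _
  change c ⊴ₗ (αₗ a b m).hom ≫ (αₗ c a (b ⊙ₗ m)).inv ≫ (αₗ (c ⊗ a) b m).inv ≫
      (α_ c a b).hom ⊵ₗ m =
    (αₗ c (a ⊗ b) m).inv ≫ (c ◁ 𝟙 (a ⊗ b)) ⊵ₗ m ≫ (c ⊗ (a ⊗ b)) ⊴ₗ 𝟙 m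
  rw [e, id_actionHomLeft, Category.id_comp, actionHomRight_id, Category.comp_id,
    ← cancel_epi (αₗ c (a ⊗ b) m).hom, ← cancel_epi ((α_ c a b).hom ⊵ₗ m),
    associator_actionHom_assoc, Iso.hom_inv_id_assoc, Iso.hom_inv_id_assoc, Iso.hom_inv_id,
    Category.comp_id]

variable {W W' W'' : Q.FullSubcategory} {m m' Y Y' Y'' : M}

lemma isMap_compFrame_unitFrame_left (φ : Frame δ W m Y) :
    IsMap (compFrame (unitFrame Y) φ) φ (λ_ W).hom (𝟙 m) (𝟙 Y) := by
  rintro a ⟨h₁, h₂⟩ h'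
  have e := φ.nat (P.isoMk (ρ_ a.obj).symm : a ≅ tw a (𝟙_ Q.FullSubcategory)
    (P.prop_tensor a.2 P.prop_unit)).hom h' h₂
  change a ⊴ₗ 𝟙 Y ≫ (φ.q a h').hom = ((P.isoMk (ρ_ a.obj).symm).hom ⊵ₗ Y ≫
    (φ.q _ h₂).hom ≫ (twB a (𝟙_ _) W (P.prop_tensor a.2 P.prop_unit) (φ.le h₂)
      (P.prop_of_iso (α_ _ _ _) (φ.le h₂))).hom ⊵ₗ m) ≫ twR a (λ_ W).hom
      (P.prop_of_iso (α_ _ _ _) (φ.le h₂)) (φ.le h') ⊵ₗ m ≫ _ ⊴ₗ 𝟙 m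
  rw [actionHomRight_id, actionHomRight_id, Category.comp_id, Category.id_comp]
  simp only [Category.assoc]
  rw [reassoc_of% e, ← comp_actionHomLeft, ← comp_actionHomLeft]
  refine (Category.comp_id _).symm.trans (congrArg ((φ.q a h').hom ≫ ·) ?_)
  refine (id_actionHomLeft _ _).symm.trans (congrArg (· ⊵ₗ m) ?_)
  ext
  change 𝟙 (a.obj ⊗ W.obj) = (ρ_ a.obj).inv ▷ W.obj ≫ (α_ a.obj (𝟙_ B) W.obj).hom ≫
    a.obj ◁ (λ_ W.obj).hom
  simp

lemma isMap_compFrame_unitFrame_right (φ : Frame δ W m Y) :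
    IsMap (compFrame φ (unitFrame m)) φ (ρ_ W).hom (𝟙 m) (𝟙 Y) := by
  rintro a ⟨h₁, h₂⟩ h'
  have h₃ : P (a.obj ⊗ (W.obj ⊗ 𝟙_ B)) :=
    P.prop_of_iso (α_ _ _ _) (P.prop_tensor (tw a W (φ.le h₁)).2 P.prop_unit)
  have e : (P.isoMk (ρ_ (tw a W (φ.le h₁)).obj).symm).hom ≫ (twB a W (𝟙_ _) (φ.le h₁)
      (P.prop_tensor (tw a W (φ.le h₁)).2 P.prop_unit) h₃).hom ≫
      twR a (ρ_ W).hom h₃ (φ.le h') = 𝟙 (tw a W (φ.le h₁)) := by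
    ext
    change (ρ_ (a.obj ⊗ W.obj)).inv ≫ (α_ a.obj W.obj (𝟙_ B)).hom ≫ a.obj ◁ (ρ_ W.obj).hom = 𝟙 _
    simp
  change a ⊴ₗ 𝟙 Y ≫ (φ.q a h').hom = ((φ.q a h₁).hom ≫
    (P.isoMk (ρ_ (tw a W (φ.le h₁)).obj).symm).hom ⊵ₗ m ≫ (twB a W (𝟙_ _) (φ.le h₁)
      (P.prop_tensor (tw a W (φ.le h₁)).2 P.prop_unit) h₃).hom ⊵ₗ m) ≫ twR a (ρ_ W).hom
      h₃ (φ.le h') ⊵ₗ m ≫ _ ⊴ₗ 𝟙 m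
  rw [actionHomRight_id, actionHomRight_id, Category.comp_id, Category.id_comp]
  simp only [Category.assoc]
  rw [← comp_actionHomLeft, ← comp_actionHomLeft, e, id_actionHomLeft, Category.comp_id]

lemma isMap_compFrame_assoc (φ : Frame δ W Y' Y) (φ' : Frame δ W' Y'' Y')
    (φ'' : Frame δ W'' m Y'') :
    IsMap (compFrame (compFrame φ φ') φ'') (compFrame φ (compFrame φ' φ'')) (α_ W W' W'').hom
      (𝟙 m) (𝟙 Y) := by
  rintro a ⟨⟨h₁, h₂⟩, h₃⟩ ⟨h₁', h₂', h₃'⟩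
  have i₁ : P (a.obj ⊗ (W.obj ⊗ W'.obj)) := P.prop_of_iso (α_ _ _ _) (φ'.le h₂)
  have i₂ : P (a.obj ⊗ ((W.obj ⊗ W'.obj) ⊗ W''.obj)) := P.prop_of_iso (α_ _ _ _) (φ''.le h₃)
  have i₃ : P ((a.obj ⊗ W.obj) ⊗ (W'.obj ⊗ W''.obj)) := P.prop_of_iso (α_ _ _ _) (φ''.le h₃')
  have i₄ : P (a.obj ⊗ (W.obj ⊗ (W'.obj ⊗ W''.obj))) := P.prop_of_iso (α_ _ _ _) i₃
  have e := φ''.nat (twB a W W' (φ.le h₁) (φ'.le h₂) i₁).hom h₃' h₃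
  have e' : twL (twB a W W' (φ.le h₁) (φ'.le h₂) i₁).hom W'' (φ''.le h₃') (φ''.le h₃) ≫
      (twB a (W ⊗ W') W'' i₁ (φ''.le h₃) i₂).hom ≫ twR a (α_ W W' W'').hom i₂ i₄ =
      (twB (tw a W (φ.le h₁)) W' W'' (φ'.le h₂) (φ''.le h₃') i₃).hom ≫
        (twB a W (W' ⊗ W'') (φ.le h₁) i₃ i₄).hom := by
    ext
    exact pentagon _ _ _ _
  change a ⊴ₗ 𝟙 Y ≫ (φ.q a h₁).hom ≫ ((φ'.q _ h₂).hom ≫ (φ''.q _ h₃').hom ≫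
      (twB (tw a W (φ.le h₁)) W' W'' (φ'.le h₂) (φ''.le h₃') i₃).hom ⊵ₗ m) ≫
      (twB a W (W' ⊗ W'') (φ.le h₁) i₃ i₄).hom ⊵ₗ m =
    (((φ.q a h₁).hom ≫ (φ'.q _ h₂).hom ≫ (twB a W W' (φ.le h₁) (φ'.le h₂) i₁).hom ⊵ₗ Y'') ≫
      (φ''.q _ h₃).hom ≫ (twB a (W ⊗ W') W'' i₁ (φ''.le h₃) i₂).hom ⊵ₗ m) ≫
      twR a (α_ W W' W'').hom i₂ i₄ ⊵ₗ m ≫ _ ⊴ₗ 𝟙 m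
  rw [actionHomRight_id, actionHomRight_id, Category.comp_id, Category.id_comp]
  simp only [Category.assoc]
  rw [reassoc_of% e]
  simp only [← comp_actionHomLeft]
  rw [e']

end Frame

end FrameCalculus

section FrameTensor

open MonoidalLeftAction Filter RepGL.Frame

variable {B : Type*} [Category* B] [MonoidalCategory B] [SymmetricCategory B]
  {P Q : ObjectProperty B} [P.IsMonoidal] [Q.IsMonoidal] {M : Type*} [Category* M]
  [MonoidalLeftAction P.FullSubcategory M] {δ : ℕ → P.FullSubcategory}
  [hδ : ∀ l, ((curriedAction P.FullSubcategory M).obj (δ l)).IsEquivalence]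
  [P.IsClosedUnderIsomorphisms]

namespace Frame

/-- The two squares are pasted along `(δ l ⊗ W₂) · Y₁'`, so `δ l ⊗ W₂` must be admissible for `φ₁'`;
it is so for large `l`. -/
lemma IsMap.tensor {W₁ W₁' W₂ W₂' : Q.FullSubcategory} {m₁ m₂ Y₁ Y₁' Y₂ Y₂' : M}
    {φ₁ : Frame δ W₁ Y₁' Y₁} {φ₁' : Frame δ W₁' m₁ Y₁'} {φ₂ : Frame δ W₂ Y₂' Y₂}
    {φ₂' : Frame δ W₂' m₂ Y₂'} {g : W₁ ⟶ W₂} {g' : W₁' ⟶ W₂'} {f : m₁ ⟶ m₂} {k : Y₁' ⟶ Y₂'}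
    {h : Y₁ ⟶ Y₂} (hh : IsMap φ₁ φ₂ g k h) (hk : IsMap φ₁' φ₂' g' f k) :
    IsMap (compFrame φ₁ φ₁') (compFrame φ₂ φ₂') (g ⊗ₘ g') f h := by
  apply isMap_of_eventually
  filter_upwards [φ₁'.large W₂.obj W₂.2] with l hl
  rintro ⟨h₁, h₁'⟩ ⟨h₂, h₂'⟩
  have h₃ := hl (φ₂.le h₂)
  have i₁ := P.prop_of_iso (α_ _ _ _) (φ₁'.le h₁')
  have i₂ := P.prop_of_iso (α_ _ _ _) (φ₂'.le h₂')
  have e := φ₁'.nat (twR (δ l) g (φ₁.le h₁) (φ₂.le h₂)) h₁' h₃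
  have e' : twL (twR (δ l) g (φ₁.le h₁) (φ₂.le h₂)) W₁' (φ₁'.le h₁') (φ₁'.le h₃) ≫
      twR (tw (δ l) W₂ (φ₂.le h₂)) g' (φ₁'.le h₃) (φ₂'.le h₂') ≫
      (twB (δ l) W₂ W₂' (φ₂.le h₂) (φ₂'.le h₂') i₂).hom =
      (twB (δ l) W₁ W₁' (φ₁.le h₁) (φ₁'.le h₁') i₁).hom ≫ twR (δ l) (g ⊗ₘ g') i₁ i₂ := by
    ext
    change ((δ l).obj ◁ g.hom) ▷ W₁'.obj ≫ ((δ l).obj ⊗ W₂.obj) ◁ g'.hom ≫ (α_ _ _ _).hom =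
      (α_ _ _ _).hom ≫ (δ l).obj ◁ (g.hom ⊗ₘ g'.hom)
    simp [MonoidalCategory.tensorHom_def]
  change δ l ⊴ₗ h ≫ (φ₂.q _ h₂).hom ≫ (φ₂'.q _ h₂').hom ≫
      (twB (δ l) W₂ W₂' (φ₂.le h₂) (φ₂'.le h₂') i₂).hom ⊵ₗ m₂ =
    ((φ₁.q _ h₁).hom ≫ (φ₁'.q _ h₁').hom ≫
      (twB (δ l) W₁ W₁' (φ₁.le h₁) (φ₁'.le h₁') i₁).hom ⊵ₗ m₁) ≫
      twR (δ l) (g ⊗ₘ g') i₁ i₂ ⊵ₗ m₁ ≫ _ ⊴ₗ f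
  simp only [Category.assoc]
  rw [reassoc_of% hh _ h₁ h₂, reassoc_of% hk _ h₃ h₂', reassoc_of% e, action_exchange]
  simp only [← comp_actionHomLeft_assoc, Category.assoc]
  rw [e']

end Frame

end FrameTensor
end RepGL

/-! ### The action of the big category -/

namespace RepGL

section FrameAction

open MonoidalLeftAction Filter RepGL.Frame

variable {B : Type*} [Category* B] [MonoidalCategory B] [SymmetricCategory B]
  {P Q : ObjectProperty B} [P.IsMonoidal] [Q.IsMonoidal] {M : Type*} [Category* M]
  [MonoidalLeftAction P.FullSubcategory M] {δ : ℕ → P.FullSubcategory}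
  [hδ : ∀ l, ((curriedAction P.FullSubcategory M).obj (δ l)).IsEquivalence]
  [P.IsClosedUnderIsomorphisms]
  (Φ : ∀ (W : Q.FullSubcategory) (m : M), Σ Y : M, Frame δ W m Y)

namespace Frame

/-- The action of the big category given by a choice of frames. -/
@[reducible]
noncomputable def action : MonoidalLeftAction Q.FullSubcategory M where
  actionObj W m := (Φ W m).1
  actionHomLeft {W W'} g m := map (Φ W m).2 (Φ W' m).2 g (𝟙 m)
  actionHomRight W {m m'} f := map (Φ W m).2 (Φ W m').2 (𝟙 W) f
  actionHom {W W' m m'} g f := map (Φ W m).2 (Φ W' m').2 g f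
  actionAssocIso W W' m := mapIso (Φ (W ⊗ W') m).2
    (compFrame (Φ W (Φ W' m).1).2 (Φ W' m).2)
  actionUnitIso m := mapIso (Φ (𝟙_ _) m).2 (unitFrame m)
  -- Each axiom is an instance of `IsMap.eq`: both sides are maps of frames over the same pair of
  -- morphisms.
  actionHom_def {W W' m m'} g f := (map_isMap _ _ g f).eq
    (((map_isMap _ (Φ W' m).2 g (𝟙 m)).comp (map_isMap _ _ (𝟙 W') f)).congr
      (Category.comp_id g) (Category.id_comp f))
  actionHomRight_id W m := (map_isMap _ _ _ _).eq isMap_id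
  id_actionHomLeft W m := (map_isMap _ _ _ _).eq isMap_id
  actionHom_comp g₁ g₂ f₁ f₂ := (map_isMap _ _ _ _).eq
    ((map_isMap _ _ _ _).comp (map_isMap _ _ _ _))
  actionAssocIso_hom_naturality g g' f :=
    IsMap.eq (((map_isMap _ _ _ _).comp (mapIso_hom_isMap _ _)).congr (Category.comp_id _)
      (Category.comp_id _)) (((mapIso_hom_isMap _ _).comp
        ((map_isMap _ _ _ _).tensor (map_isMap _ _ _ _))).congr (Category.id_comp _)
          (Category.id_comp _))
  actionUnitIso_hom_naturality {m m'} f :=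
    IsMap.eq (((mapIso_hom_isMap (Φ (𝟙_ _) m).2 (unitFrame m)).comp (isMap_unitFrame f)).congr
      (Category.comp_id _) (Category.id_comp _))
      (((map_isMap _ _ _ _).comp (mapIso_hom_isMap _ _)).congr (Category.comp_id _)
        (Category.comp_id _))
  whiskerLeft_actionHomLeft W {W₁ W₂} g m :=
    (map_isMap _ _ _ _).eq ((((mapIso_hom_isMap _ _).comp
      (((map_isMap (Φ W (Φ W₁ m).1).2 (Φ W (Φ W₂ m).1).2 (𝟙 W) _).tensor
        (map_isMap (Φ W₁ m).2 (Φ W₂ m).2 g (𝟙 m))).comp (mapIso_inv_isMap _ _)))).congr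
        (by simp) (by simp))
  whiskerRight_actionHomLeft {W₁ W₂} W g m :=
    (map_isMap _ _ _ _).eq ((((mapIso_hom_isMap _ _).comp
      (((map_isMap (Φ W₁ (Φ W m).1).2 (Φ W₂ (Φ W m).1).2 g (𝟙 _)).tensor
        (isMap_id (φ := (Φ W m).2))).comp (mapIso_inv_isMap _ _)))).congr
        (by simp) (by simp))
  associator_actionHom W₁ W₂ W₃ m := by
    refine IsMap.eq (φ := (Φ ((W₁ ⊗ W₂) ⊗ W₃) m).2)
      (φ' := compFrame (Φ W₁ (Φ W₂ (Φ W₃ m).1).1).2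
        (compFrame (Φ W₂ (Φ W₃ m).1).2 (Φ W₃ m).2)) (g := (α_ W₁ W₂ W₃).hom) (f := 𝟙 m) ?_ ?_
    · exact ((map_isMap _ (Φ (W₁ ⊗ W₂ ⊗ W₃) m).2 _ _).comp ((mapIso_hom_isMap _
        (compFrame (Φ W₁ (Φ (W₂ ⊗ W₃) m).1).2 (Φ (W₂ ⊗ W₃) m).2)).comp
        ((map_isMap (Φ W₁ (Φ (W₂ ⊗ W₃) m).1).2 (Φ W₁ (Φ W₂ (Φ W₃ m).1).1).2 (𝟙 W₁) _).tensor
          (mapIso_hom_isMap (Φ (W₂ ⊗ W₃) m).2 (compFrame (Φ W₂ (Φ W₃ m).1).2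
            (Φ W₃ m).2))))).congr
        (by rw [Category.id_comp, MonoidalCategory.id_tensorHom_id, Category.comp_id]) (by simp)
    · have h := ((mapIso_hom_isMap (Φ ((W₁ ⊗ W₂) ⊗ W₃) m).2
        (compFrame (Φ (W₁ ⊗ W₂) (Φ W₃ m).1).2 (Φ W₃ m).2)).comp
        (((mapIso_hom_isMap (Φ (W₁ ⊗ W₂) (Φ W₃ m).1).2 (compFrame (Φ W₁ (Φ W₂ (Φ W₃ m).1).1).2
          (Φ W₂ (Φ W₃ m).1).2)).tensor (isMap_id (φ := (Φ W₃ m).2))).comp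
            (isMap_compFrame_assoc _ _ _))).congr (g₁ := (α_ W₁ W₂ W₃).hom) (f₁ := 𝟙 m)
            (by rw [Category.id_comp, MonoidalCategory.id_tensorHom_id, Category.id_comp])
            (by simp)
      rwa [Category.comp_id] at h
  leftUnitor_actionHom W m := by
    have h := ((mapIso_hom_isMap (Φ (𝟙_ _ ⊗ W) m).2
      (compFrame (Φ (𝟙_ _) (Φ W m).1).2 (Φ W m).2)).comp
      (((mapIso_hom_isMap (Φ (𝟙_ _) (Φ W m).1).2 (unitFrame _)).tensor
        (isMap_id (φ := (Φ W m).2))).comp (isMap_compFrame_unitFrame_left _))).congr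
        (g₁ := (λ_ W).hom) (f₁ := 𝟙 m)
        (by rw [Category.id_comp, MonoidalCategory.id_tensorHom_id, Category.id_comp]) (by simp)
    rw [Category.comp_id] at h
    exact (map_isMap _ _ _ _).eq h
  rightUnitor_actionHom W m := by
    have h := ((mapIso_hom_isMap (Φ (W ⊗ 𝟙_ _) m).2
      (compFrame (Φ W (Φ (𝟙_ _) m).1).2 (Φ (𝟙_ _) m).2)).comp
      (((map_isMap (Φ W (Φ (𝟙_ _) m).1).2 (Φ W m).2 (𝟙 W) _).tensor
        (mapIso_hom_isMap (Φ (𝟙_ _) m).2 (unitFrame m))).comp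
          (isMap_compFrame_unitFrame_right _))).congr
        (g₁ := (ρ_ W).hom) (f₁ := 𝟙 m)
        (by rw [Category.id_comp, MonoidalCategory.id_tensorHom_id, Category.id_comp]) (by simp)
    rw [Category.comp_id] at h
    exact (map_isMap _ _ _ _).eq h

end Frame

end FrameAction
end RepGL

/-! ### Linearity of the extended action and comparison with the given one -/

namespace RepGL

section Extension

open MonoidalLeftAction Filter RepGL.Frame

attribute [local instance] endofunctorMonoidalCategory

variable {B : Type*} [Category* B] [MonoidalCategory B] [SymmetricCategory B]
  {P Q : ObjectProperty B} [P.IsMonoidal] [Q.IsMonoidal] {M : Type*} [Category* M]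
  [MonoidalLeftAction P.FullSubcategory M] {δ : ℕ → P.FullSubcategory}

namespace Frame

section Linear

variable [Preadditive B] [Preadditive M] {W W' : Q.FullSubcategory} {m m' Y Y' : M} {φ : Frame δ W m Y} {φ' : Frame δ W' m' Y'}

lemma IsMap.add_left (K : Type*) [Semiring K] [Linear K B] [MonoidalPreadditive B]
    [Linear K M] [LinearLeftAction K P.FullSubcategory M] {g₁ g₂ : W ⟶ W'} {f : m ⟶ m'} {k₁ k₂ : Y ⟶ Y'} (h₁ : IsMap φ φ' g₁ f k₁)
    (h₂ : IsMap φ φ' g₂ f k₂) : IsMap φ φ' (g₁ + g₂) f (k₁ + k₂) := by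
  intro a h h'
  have e : twR a (g₁ + g₂) (φ.le h) (φ'.le h') =
      twR a g₁ (φ.le h) (φ'.le h') + twR a g₂ (φ.le h) (φ'.le h') := by
    ext
    exact MonoidalPreadditive.whiskerLeft_add _ _
  rw [e, LinearLeftAction.actionHomLeft_add K, LinearLeftAction.actionHomRight_add K,
    Preadditive.add_comp, Preadditive.add_comp, Preadditive.comp_add, h₁ a h h', h₂ a h h']

lemma IsMap.smul_left {K : Type*} [Semiring K] [Linear K B] [MonoidalPreadditive B]
    [MonoidalLinear K B] [Linear K M] [LinearLeftAction K P.FullSubcategory M] {g : W ⟶ W'} {f : m ⟶ m'} {k : Y ⟶ Y'} (h₁ : IsMap φ φ' g f k) (r : K) :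
    IsMap φ φ' (r • g) f (r • k) := by
  intro a h h'
  have e : twR a (r • g) (φ.le h) (φ'.le h') = r • twR a g (φ.le h) (φ'.le h') := by
    ext
    exact MonoidalLinear.whiskerLeft_smul _ _ _
  rw [e, LinearLeftAction.actionHomLeft_smul, LinearLeftAction.actionHomRight_smul,
    Linear.smul_comp, Linear.smul_comp, Linear.comp_smul, h₁ a h h']

lemma IsMap.add_right (K : Type*) [Semiring K] [Linear K B]
    [Linear K M] [LinearLeftAction K P.FullSubcategory M] {g : W ⟶ W'} {f₁ f₂ : m ⟶ m'} {k₁ k₂ : Y ⟶ Y'} (h₁ : IsMap φ φ' g f₁ k₁)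
    (h₂ : IsMap φ φ' g f₂ k₂) : IsMap φ φ' g (f₁ + f₂) (k₁ + k₂) := by
  intro a h h'
  rw [LinearLeftAction.actionHomRight_add K, LinearLeftAction.actionHomRight_add K,
    Preadditive.add_comp, Preadditive.comp_add, Preadditive.comp_add, h₁ a h h', h₂ a h h']

lemma IsMap.smul_right {K : Type*} [Semiring K] [Linear K B]
    [Linear K M] [LinearLeftAction K P.FullSubcategory M] {g : W ⟶ W'} {f : m ⟶ m'} {k : Y ⟶ Y'} (h₁ : IsMap φ φ' g f k) (r : K) :
    IsMap φ φ' g (r • f) (r • k) := by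
  intro a h h'
  rw [LinearLeftAction.actionHomRight_smul, LinearLeftAction.actionHomRight_smul,
    Linear.smul_comp, Linear.comp_smul, Linear.comp_smul, h₁ a h h']

end Linear

variable [hδ : ∀ l, ((curriedAction P.FullSubcategory M).obj (δ l)).IsEquivalence]
  [P.IsClosedUnderIsomorphisms]
  (Φ : ∀ (W : Q.FullSubcategory) (m : M), Σ Y : M, Frame δ W m Y)

lemma action_linear (K : Type*) [Semiring K] [Preadditive B] [Linear K B] [MonoidalPreadditive B]
    [MonoidalLinear K B] [Preadditive M] [Linear K M] [LinearLeftAction K P.FullSubcategory M] :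
    letI := action Φ
    LinearLeftAction K Q.FullSubcategory M :=
  letI := action Φ
  { actionHomLeft_add := fun _ _ _ =>
      (map_isMap _ _ _ _).eq (IsMap.add_left K (map_isMap _ _ _ _) (map_isMap _ _ _ _))
    actionHomLeft_smul := fun r _ _ _ _ =>
      (map_isMap _ _ _ _).eq (IsMap.smul_left (map_isMap _ _ _ _) r)
    actionHomRight_add := fun _ _ _ _ _ =>
      (map_isMap _ _ _ _).eq (IsMap.add_right K (map_isMap _ _ _ _) (map_isMap _ _ _ _))
    actionHomRight_smul := fun r _ _ _ _ =>
      (map_isMap _ _ _ _).eq (IsMap.smul_right (map_isMap _ _ _ _) r) }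

/-- The comparison of the action of the big category with the action of the small category. -/
noncomputable def actionComparison (hPQ : P ≤ Q) :
    letI := action Φ
    ObjectProperty.ιOfLE hPQ ⋙ curriedActionMop Q.FullSubcategory M ≅
      curriedActionMop P.FullSubcategory M :=
  letI := action Φ
  NatIso.ofComponents (fun a => (NatIso.ofComponents
    (fun m => mapIso (Φ ((ObjectProperty.ιOfLE hPQ).obj a) m).2 (actFrame hPQ a m))
    (fun {m m'} f => by
      have h₁ := ((map_isMap (Φ ((ObjectProperty.ιOfLE hPQ).obj a) m).2
        (Φ ((ObjectProperty.ιOfLE hPQ).obj a) m').2 (𝟙 _) f).comp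
          (mapIso_hom_isMap _ (actFrame hPQ a m'))).congr (Category.comp_id _) (Category.comp_id _)
      have h₂ := ((mapIso_hom_isMap (Φ ((ObjectProperty.ιOfLE hPQ).obj a) m).2
        (actFrame hPQ a m)).comp (isMap_actFrame hPQ (𝟙 a) f)).congr
          (Category.comp_id _) (Category.id_comp _)
      rw [id_actionHomLeft, Category.id_comp] at h₂
      exact h₁.eq h₂) :
      (curriedAction Q.FullSubcategory M).obj ((ObjectProperty.ιOfLE hPQ).obj a) ≅
        (curriedAction P.FullSubcategory M).obj a).mop)
    (fun {a a'} g => by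
      apply MonoidalOpposite.hom_ext
      ext m
      have h₁ := ((map_isMap (Φ ((ObjectProperty.ιOfLE hPQ).obj a) m).2
        (Φ ((ObjectProperty.ιOfLE hPQ).obj a') m).2 ((ObjectProperty.ιOfLE hPQ).map g) (𝟙 m)).comp
          (mapIso_hom_isMap _ (actFrame hPQ a' m))).congr (Category.comp_id _) (Category.comp_id _)
      have h₂ := ((mapIso_hom_isMap (Φ ((ObjectProperty.ιOfLE hPQ).obj a) m).2
        (actFrame hPQ a m)).comp (isMap_actFrame hPQ g (𝟙 m))).congr
          (Category.id_comp _) (Category.id_comp _)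
      rw [actionHomRight_id, Category.comp_id] at h₂
      exact h₁.eq h₂)

/-- Both conditions compare maps between frames for one object, once the inverse structure
isomorphisms are moved to the appropriate side. -/
lemma actionComparison_isMonoidal (hPQ : P ≤ Q) :
    letI := action Φ
    NatTrans.IsMonoidal (actionComparison Φ hPQ).hom := by
  let _ := action Φ
  refine ⟨?_, ?_⟩
  · apply MonoidalOpposite.hom_ext
    ext m
    let φ := (Φ (𝟙_ _) m).2
    have h := (((mapIso_hom_isMap φ (actFrame hPQ (𝟙_ _) m)).comp
      (isMap_actFrame_unit hPQ m)).congr (g₁ := 𝟙 _) (Category.id_comp _) (Category.id_comp _)).eq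
      (mapIso_hom_isMap φ (unitFrame m))
    change ((mapIso φ (unitFrame m)).inv ≫ map φ φ (𝟙 _) (𝟙 m)) ≫
      (mapIso φ (actFrame hPQ (𝟙_ _) m)).hom = (λₗ m).inv
    -- The middle factor comes from the unit comparison of the inclusion, which is an identity.
    rw [(map_isMap φ φ (𝟙 _) (𝟙 m)).eq isMap_id, Category.comp_id, Iso.inv_comp_eq,
      Iso.eq_comp_inv, h]
  · intro a b
    apply MonoidalOpposite.hom_ext
    ext m
    let a' := (ObjectProperty.ιOfLE hPQ).obj a
    let b' := (ObjectProperty.ιOfLE hPQ).obj b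
    let φ := (Φ (a' ⊗ b') m).2
    let ψ := compFrame (Φ a' (Φ b' m).1).2 (Φ b' m).2
    let θ := (mapIso (Φ b' m).2 (actFrame hPQ b m)).hom
    change ((mapIso φ ψ).inv ≫ map φ φ (𝟙 _) (𝟙 m)) ≫
      (mapIso φ (actFrame hPQ (a ⊗ b) m)).hom =
      ((mapIso (Φ a' (Φ b' m).1).2 (actFrame hPQ a (Φ b' m).1)).hom ≫ a ⊴ₗ θ) ≫ (αₗ a b m).inv
    rw [(map_isMap φ φ (𝟙 _) (𝟙 m)).eq isMap_id, Category.comp_id, Iso.eq_comp_inv]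
    have h₁ := ((mapIso_inv_isMap φ ψ).comp ((mapIso_hom_isMap φ (actFrame hPQ (a ⊗ b) m)).comp
      (isMap_actFrame_tensor hPQ a b m))).congr (g₁ := 𝟙 _) (f₁ := 𝟙 m)
        ((Category.id_comp _).trans (Category.id_comp _)) (by simp)
    have h₂ := (isMap_actFrame (δ := δ) hPQ (𝟙 a) θ)
    rw [id_actionHomLeft, Category.id_comp] at h₂
    have h₃ := (((mapIso_hom_isMap (Φ a' (Φ b' m).1).2 (actFrame hPQ a (Φ b' m).1)).comp h₂).congr
      (g₁ := 𝟙 _) (Category.id_comp _) (Category.id_comp _)).tensor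
        (mapIso_hom_isMap (Φ b' m).2 (actFrame hPQ b m))
    rw [Category.assoc]
    exact h₁.eq (h₃.congr (MonoidalCategory.id_tensorHom_id _ _) rfl)

end Frame

end Extension
end RepGL

/-! ### Actions pulled back along a functor, and their extension -/

namespace RepGL

section ActionAlongFunctor

open MonoidalLeftAction Filter

attribute [local instance] endofunctorMonoidalCategory

section Equivalences

variable {A : Type*} [Category* A] [MonoidalCategory A] {M : Type*} [Category* M]
  [MonoidalLeftAction A M]

lemma isEquivalence_unit_action : ((curriedAction A M).obj (𝟙_ A)).IsEquivalence :=
  Functor.isEquivalence_of_iso (actionUnitNatIso A M).symm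

lemma isEquivalence_tensor_action (a b : A) [((curriedAction A M).obj a).IsEquivalence]
    [((curriedAction A M).obj b).IsEquivalence] :
    ((curriedAction A M).obj (a ⊗ b)).IsEquivalence :=
  Functor.isEquivalence_of_iso (F := (curriedAction A M).obj b ⋙ (curriedAction A M).obj a)
    (NatIso.ofComponents (fun m => (αₗ a b m).symm) fun {m m'} f => by
      change a ⊴ₗ b ⊴ₗ f ≫ (αₗ a b m').inv = (αₗ a b m).inv ≫ (a ⊗ b) ⊴ₗ f
      simp)

lemma isEquivalence_tensorPow_action (a : A) (h : ((curriedAction A M).obj a).IsEquivalence) :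
    ∀ l : ℕ, ((curriedAction A M).obj (tensorPow a l)).IsEquivalence
  | 0 => isEquivalence_unit_action
  | l + 1 =>
    have := isEquivalence_tensorPow_action a h l
    isEquivalence_tensor_action a (tensorPow a l)

end Equivalences

variable {B : Type*} [Category* B] [MonoidalCategory B] [SymmetricCategory B]
  {P Q : ObjectProperty B} [P.IsMonoidal] [Q.IsMonoidal] [P.IsClosedUnderIsomorphisms]
  {C : Type*} [Category* C] [MonoidalCategory C] {M : Type*} [Category* M]
  [MonoidalLeftAction C M]

/-- The action of a monoidal category given by a monoidal functor to a category that acts. -/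
@[reducible]
def pullbackAction {A : Type*} [Category* A] [MonoidalCategory A] (F : A ⥤ C) [F.Monoidal]
    (M : Type*) [Category* M] [MonoidalLeftAction C M] : MonoidalLeftAction A M :=
  actionOfMonoidalFunctorToEndofunctorMop (F ⋙ curriedActionMop C M)

lemma pullbackAction_linear {A : Type*} [Category* A] [MonoidalCategory A] (F : A ⥤ C)
    [F.Monoidal] (K : Type*) [Semiring K] [Preadditive A] [Linear K A] [Preadditive C] [Linear K C]
    [F.Additive] [F.Linear K] [Preadditive M] [Linear K M] [LinearLeftAction K C M] :
    letI := pullbackAction F M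
    LinearLeftAction K A M :=
  letI := pullbackAction F M
  { actionHomLeft_add := fun _ _ m =>
      (congrArg (fun t => t ⊵ₗ m) F.map_add).trans (LinearLeftAction.actionHomLeft_add K _ _ m)
    actionHomLeft_smul := fun r _ _ f m =>
      (congrArg (fun t => t ⊵ₗ m) (F.map_smul r f)).trans
        (LinearLeftAction.actionHomLeft_smul r _ m)
    actionHomRight_add := fun a _ _ f g =>
      LinearLeftAction.actionHomRight_add (A := C) K (F.obj a) f g
    actionHomRight_smul := fun r a _ _ f =>
      LinearLeftAction.actionHomRight_smul (A := C) r (F.obj a) f }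

/-- The pulled back action is given by the composite functor. -/
def pullbackActionIso {A : Type*} [Category* A] [MonoidalCategory A] (F : A ⥤ C) [F.Monoidal]
    (M : Type*) [Category* M] [MonoidalLeftAction C M] :
    letI := pullbackAction F M
    curriedActionMop A M ≅ F ⋙ curriedActionMop C M :=
  letI := pullbackAction F M
  .refl _

lemma pullbackActionIso_isMonoidal {A : Type*} [Category* A] [MonoidalCategory A] (F : A ⥤ C)
    [F.Monoidal] :
    letI := pullbackAction F M
    NatTrans.IsMonoidal (pullbackActionIso F M).hom := by
  let _ := pullbackAction F M
  refine ⟨?_, ?_⟩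
  · exact Category.comp_id _
  · intro a b
    refine (Category.comp_id _).trans ?_
    apply MonoidalOpposite.hom_ext
    ext m
    change _ = (𝟙 _ ≫ (F.obj a) ⊴ₗ (𝟙 (F.obj b ⊙ₗ m))) ≫ _
    rw [actionHomRight_id, Category.comp_id]
    exact (Category.id_comp _).symm

/-- The abstract form of part (b): the object `d` acts invertibly, and its high powers multiply
every object of the big category into the small one. The frames are taken with respect to the powers
of `d`. -/
theorem exists_action_extension (K : Type*) [Semiring K] [Preadditive B] [Linear K B]
    [MonoidalPreadditive B] [MonoidalLinear K B] [Preadditive C] [Linear K C] [Preadditive M]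
    [Linear K M] [LinearLeftAction K C M] (hPQ : P ≤ Q) (F : P.FullSubcategory ⥤ C) [F.Monoidal]
    [F.Additive] [F.Linear K] (d : P.FullSubcategory)
    (hd : ((curriedAction C M).obj (F.obj d)).IsEquivalence)
    (hlarge : ∀ V, Q V → ∀ᶠ l in atTop, P ((tensorPow d l).obj ⊗ V)) :
    ∃ _ : MonoidalLeftAction Q.FullSubcategory M,
      LinearLeftAction K Q.FullSubcategory M ∧ ActionExtends M (ObjectProperty.ιOfLE hPQ) F := by
  let _ := pullbackAction F M
  have := pullbackAction_linear (M := M) F K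
  have hδ : ∀ l, ((curriedAction P.FullSubcategory M).obj (tensorPow d l)).IsEquivalence :=
    isEquivalence_tensorPow_action d hd
  choose Y φ using Frame.nonempty (M := M) (Q := Q) hlarge
  let Φ : ∀ (W : Q.FullSubcategory) (m : M), Σ Y : M, Frame (tensorPow d) W m Y :=
    fun W m => ⟨Y W m, (φ W m).some⟩
  let _ := Frame.action Φ
  have := Frame.actionComparison_isMonoidal Φ hPQ
  have := pullbackActionIso_isMonoidal (M := M) F
  exact ⟨Frame.action Φ, Frame.action_linear Φ K,
    Frame.actionComparison Φ hPQ ≪≫ pullbackActionIso F M,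
    inferInstanceAs (NatTrans.IsMonoidal (_ ≫ _))⟩

end ActionAlongFunctor
end RepGL

/-! ### Braided functors, tensor powers and exterior powers -/

namespace RepGL

section TensorPowerFunctor

open Functor.LaxMonoidal

variable {A C : Type*} [Category* A] [MonoidalCategory A] [SymmetricCategory A] [Category* C]
  [MonoidalCategory C] [SymmetricCategory C] (F : A ⥤ C) [F.Braided]

/-- The exchange of the first two factors commutes with the tensorators, by their associativity and
by compatibility with the braiding. -/
lemma exch_μ (V W Y : A) :
    exch (F.obj V) (F.obj W) (F.obj Y) ≫ F.obj W ◁ μ F V Y ≫ μ F W (V ⊗ Y) =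
      F.obj V ◁ μ F W Y ≫ μ F V (W ⊗ Y) ≫ F.map (exch V W Y) := by
  simp only [exch, Category.assoc, F.map_comp]
  rw [associativity_inv_assoc, ← associativity, ← μ_natural_left_assoc,
    ← comp_whiskerRight_assoc, ← comp_whiskerRight_assoc, Functor.LaxBraided.braided]

lemma exch_tensorHom {V W Y V' W' Y' : C} (f : V ⟶ V') (g : W ⟶ W') (h : Y ⟶ Y') :
    exch V W Y ≫ (g ⊗ₘ (f ⊗ₘ h)) = (f ⊗ₘ (g ⊗ₘ h)) ≫ exch V' W' Y' := by
  simp only [exch, Category.assoc, ← associator_naturality]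
  rw [associator_inv_naturality_assoc, ← tensorHom_id, ← tensorHom_id,
    tensorHom_comp_tensorHom_assoc, tensorHom_comp_tensorHom_assoc,
    BraidedCategory.braiding_naturality, Category.id_comp, Category.comp_id]

lemma exch_map {V W Y : A} {V' W' Y' : C} (f : V' ⟶ F.obj V) (g : W' ⟶ F.obj W)
    (h : Y' ⟶ F.obj Y) :
    exch V' W' Y' ≫ (g ⊗ₘ ((f ⊗ₘ h) ≫ μ F V Y)) ≫ μ F W (V ⊗ Y) =
      ((f ⊗ₘ ((g ⊗ₘ h) ≫ μ F W Y)) ≫ μ F V (W ⊗ Y)) ≫ F.map (exch V W Y) := by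
  have h1 : ∀ {S S' T T' U : C} (a : S ⟶ S') (b : T ⟶ T') (c : T' ⟶ U),
      (a ⊗ₘ (b ≫ c)) = (a ⊗ₘ b) ≫ S' ◁ c := fun a b c => by
    rw [← id_tensorHom, tensorHom_comp_tensorHom, Category.comp_id]
  rw [h1, h1, Category.assoc, Category.assoc, Category.assoc, ← exch_μ, ← Category.assoc,
    exch_tensorHom, Category.assoc]

lemma whiskerLeft_map {V Y : A} {V' Y' : C} (f : V' ⟶ F.obj V) (h : Y' ⟶ F.obj Y) (a : Y' ⟶ Y')
    (b : Y ⟶ Y) (hab : a ≫ h = h ≫ F.map b) :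
    V' ◁ a ≫ (f ⊗ₘ h) ≫ μ F V Y = ((f ⊗ₘ h) ≫ μ F V Y) ≫ F.map (V ◁ b) := by
  rw [Category.assoc, ← μ_natural_right, ← Category.assoc, ← Category.assoc]
  congr 1
  rw [← id_tensorHom, ← id_tensorHom, tensorHom_comp_tensorHom, tensorHom_comp_tensorHom, hab,
    Category.id_comp, Category.comp_id]

/-- A braided functor commutes with tensor powers. -/
def mapTensorPow {V : A} {X : C} (e : X ≅ F.obj V) : ∀ k : ℕ, tensorPow X k ≅ F.obj (tensorPow V k)
  | 0 => Functor.Monoidal.εIso F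
  | k + 1 => (e ⊗ᵢ mapTensorPow e k) ≪≫ Functor.Monoidal.μIso F V (tensorPow V k)

lemma exchAt_mapTensorPow {V : A} {X : C} (e : X ≅ F.obj V) : ∀ k i : ℕ,
    exchAt X k i ≫ (mapTensorPow F e k).hom = (mapTensorPow F e k).hom ≫ F.map (exchAt V k i)
  | 0, _ => by
    change 𝟙 _ ≫ _ = _ ≫ F.map (𝟙 _)
    simp
  | 1, 0 => by
    change 𝟙 _ ≫ _ = _ ≫ F.map (𝟙 _)
    simp
  | k + 2, 0 => exch_map F e.hom e.hom (mapTensorPow F e k).hom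
  | k + 1, i + 1 => by
    rw [exchAt_succ, exchAt_succ]
    exact whiskerLeft_map F e.hom _ _ _ (exchAt_mapTensorPow e k i)

lemma permAct_mapTensorPow {V : A} {X : C} (e : X ≅ F.obj V) (k : ℕ) (σ : Equiv.Perm (Fin k)) :
    permAct X k σ ≫ (mapTensorPow F e k).hom =
      (mapTensorPow F e k).hom ≫ F.map (permAct V k σ) := by
  have h1 : permAct X k 1 ≫ (mapTensorPow F e k).hom =
      (mapTensorPow F e k).hom ≫ F.map (permAct V k 1) := by
    rw [map_one, map_one, End.one_def, End.one_def, F.map_id, Category.id_comp, Category.comp_id]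
  cases k with
  | zero => rwa [Subsingleton.elim σ 1]
  | succ k =>
    have hσ : σ ∈ Submonoid.closure
        (Set.range fun i : Fin k ↦ Equiv.swap i.castSucc i.succ) := by
      rw [Equiv.Perm.mclosure_swap_castSucc_succ]; trivial
    induction hσ using Submonoid.closure_induction with
    | mem x hx =>
      obtain ⟨j, rfl⟩ := hx
      dsimp only
      rw [permAct_swap, permAct_swap]
      exact exchAt_mapTensorPow F e _ _
    | one => exact h1
    | mul x y _ _ hx hy =>
      rw [map_mul, map_mul, End.mul_def, End.mul_def, F.map_comp, Category.assoc, hx,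
        ← Category.assoc, hy, Category.assoc]

variable (K : Type*) [Field K] [Preadditive A] [Linear K A] [Preadditive C] [Linear K C]
  [F.Additive] [F.Linear K]

lemma antisymmetrizer_mapTensorPow {V : A} {X : C} (e : X ≅ F.obj V) (k : ℕ) :
    antisymmetrizer K X k ≫ (mapTensorPow F e k).hom =
      (mapTensorPow F e k).hom ≫ F.map (antisymmetrizer K V k) := by
  unfold antisymmetrizer
  rw [F.map_smul, Linear.smul_comp, Linear.comp_smul, F.map_sum, Preadditive.sum_comp,
    Preadditive.comp_sum]
  congr 1
  refine Finset.sum_congr rfl fun σ _ => ?_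
  rcases Int.units_eq_one_or (Equiv.Perm.sign σ) with h | h
  · rw [h, one_smul, one_smul, permAct_mapTensorPow]
  · rw [h, Units.neg_smul, Units.neg_smul, one_smul, one_smul]
    refine (Preadditive.neg_comp _ _).trans ?_
    rw [permAct_mapTensorPow]
    refine (Preadditive.comp_neg _ _).symm.trans ?_
    rw [← F.map_neg]

/-- A braided linear functor commutes with exterior powers. -/
lemma nonempty_extPow_iso [CharZero K] [IsIdempotentComplete C] {V : A} {X : C}
    (e : X ≅ F.obj V) (k : ℕ) {Y : A} (i : Y ⟶ tensorPow V k) (p : tensorPow V k ⟶ Y)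
    (hip : i ≫ p = 𝟙 Y) (hpi : p ≫ i = antisymmetrizer K V k) :
    Nonempty (extPow K X k ≅ F.obj Y) := by
  obtain ⟨j, q, hjq, hqj⟩ := extPow_spec K X k
  let θ := mapTensorPow F e k
  -- The antisymmetrizer at `X` is conjugate by `θ` to the image under `F` of the one at `V`;
  -- objects splitting conjugate idempotents are isomorphic.
  have h1 : (q ≫ j) ≫ θ.hom = θ.hom ≫ F.map p ≫ F.map i := by
    rw [hqj, ← F.map_comp, hpi]
    exact antisymmetrizer_mapTensorPow F K e k
  have h2 : F.map i ≫ F.map p = 𝟙 _ := by rw [← F.map_comp, hip, F.map_id]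
  have h3 : θ.inv ≫ q ≫ j = F.map p ≫ F.map i ≫ θ.inv := by
    rw [Iso.inv_comp_eq, ← Category.assoc, ← Category.assoc, Iso.eq_comp_inv, h1, Category.assoc]
  refine ⟨⟨j ≫ θ.hom ≫ F.map p, F.map i ≫ θ.inv ≫ q, ?_, ?_⟩⟩
  · have h4 : j ≫ (θ.hom ≫ F.map p ≫ F.map i) ≫ θ.inv ≫ q = 𝟙 _ := by
      rw [← h1]
      simp only [Category.assoc, Iso.hom_inv_id_assoc]
      rw [reassoc_of% hjq, hjq]
    simpa only [Category.assoc] using h4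
  · have h4 : F.map i ≫ (θ.inv ≫ q ≫ j) ≫ θ.hom ≫ F.map p = 𝟙 _ := by
      rw [h3]
      simp only [Category.assoc, Iso.inv_hom_id_assoc]
      rw [reassoc_of% h2, h2]
    simpa only [Category.assoc] using h4

end TensorPowerFunctor
end RepGL

/-! ### Twisting by powers of the determinant -/

namespace RepGL

section Determinant

open PolyRep Filter

universe u

variable {K : Type u} [Field K] {n : ℕ}

lemma hasCoeffIn_of_hom (A : Subalgebra K (GL (Fin n) K → K)) {V W : FDRep K (GL (Fin n) K)}
    (e : V ≅ W) (hV : hasCoeffIn A V) : hasCoeffIn A W := fun f w => by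
  let L : V →ₗ[K] W := e.hom.hom.hom.hom
  let L' : W →ₗ[K] V := e.inv.hom.hom.hom
  have h1 : ∀ w, L (L' w) = w := fun w => congrArg (fun t => t.hom.hom.hom w) e.inv_hom_id
  have h2 : ∀ g v, L (V.ρ g v) = W.ρ g (L v) := fun g v =>
    congrArg (fun t => t.hom.hom v) (e.hom.comm g)
  have h3 : (fun g => f (W.ρ g w)) = fun g => (f.comp L) (V.ρ g (L' w)) := by
    funext g
    rw [LinearMap.comp_apply, h2, h1]
  rw [h3]
  exact hV _ _

instance (A : Subalgebra K (GL (Fin n) K → K)) : (hasCoeffIn A).IsClosedUnderIsomorphisms :=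
  ⟨fun e h => hasCoeffIn_of_hom A e h⟩

lemma det_mem_polyFun : (fun g : GL (Fin n) K => g.1.det) ∈ polyFun K n := by
  have h : (fun g : GL (Fin n) K => g.1.det) = ∑ σ : Equiv.Perm (Fin n),
      ((Equiv.Perm.sign σ : ℤ) : K) • ∏ i, fun g : GL (Fin n) K => g.1 (σ i) i := by
    funext g
    rw [Matrix.det_apply', Finset.sum_apply]
    refine Finset.sum_congr rfl fun σ _ => ?_
    rw [Pi.smul_apply, Finset.prod_apply, smul_eq_mul]
  rw [h]
  exact Subalgebra.sum_mem _ fun σ _ => Subalgebra.smul_mem _ (Subalgebra.prod_mem _ fun i _ =>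
    Algebra.subset_adjoin (Set.mem_range_self (σ i, i))) _

/-- The functions with this property contain the generators and form an algebra; formulating it for
all large `l` makes sums immediate. -/
lemma eventually_det_pow_mul_mem {f : GL (Fin n) K → K} (hf : f ∈ regFun K n) :
    ∀ᶠ l : ℕ in atTop, (fun g : GL (Fin n) K => g.1.det) ^ l * f ∈ polyFun K n := by
  set D : GL (Fin n) K → K := fun g => g.1.det with hD
  have hDp : ∀ l : ℕ, D ^ l ∈ polyFun K n := fun l => Subalgebra.pow_mem _ det_mem_polyFun l
  have hp : ∀ f ∈ polyFun K n, ∀ᶠ l : ℕ in atTop, D ^ l * f ∈ polyFun K n :=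
    fun f hf => Eventually.of_forall fun l => Subalgebra.mul_mem _ (hDp l) hf
  induction hf using Algebra.adjoin_induction with
  | mem f hf =>
    rcases hf with hf | hf
    · exact hp f (Algebra.subset_adjoin hf)
    · obtain rfl := hf
      filter_upwards [eventually_ge_atTop 1] with l hl
      obtain ⟨m, rfl⟩ := Nat.exists_eq_add_of_le' hl
      have h : D ^ (m + 1) * (fun g : GL (Fin n) K => (g.1.det)⁻¹) = D ^ m := by
        funext g
        have : g.1.det ≠ 0 := (Matrix.isUnits_det_units g).ne_zero
        simp only [Pi.mul_apply, Pi.pow_apply, hD, pow_succ, mul_assoc, mul_inv_cancel₀ this,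
          mul_one]
      rw [h]
      exact hDp m
  | algebraMap r => exact hp _ (Subalgebra.algebraMap_mem _ r)
  | add f g _ _ hf hg =>
    filter_upwards [hf, hg] with l h1 h2
    rw [mul_add]
    exact Subalgebra.add_mem _ h1 h2
  | mul f g _ _ hf hg =>
    obtain ⟨N, hN⟩ := eventually_atTop.mp hf
    obtain ⟨N', hN'⟩ := eventually_atTop.mp hg
    -- For a product the thresholds add up, because each factor consumes its own power of the
    -- determinant.
    filter_upwards [eventually_ge_atTop (N + N')] with l hl
    obtain ⟨m, rfl⟩ := Nat.exists_eq_add_of_le hl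
    have h : D ^ (N + N' + m) * (f * g) = (D ^ N * f) * (D ^ (N' + m) * g) := by ring
    rw [h]
    exact Subalgebra.mul_mem _ (hN N le_rfl) (hN' _ (by omega))

/-- One exponent serves all coefficients, since they are combinations of the finitely many
coefficients in a basis. -/
lemma eventually_det_pow_mul_coeff_mem (V : FDRep K (GL (Fin n) K))
    (hV : hasCoeffIn (regFun K n) V) : ∀ᶠ l : ℕ in atTop, ∀ (f : Module.Dual K V) (v : V),
      (fun g : GL (Fin n) K => g.1.det) ^ l * (fun g => f (V.ρ g v)) ∈ polyFun K n := by
  let b := Module.finBasis K V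
  have h := eventually_all.mpr fun i => eventually_all.mpr fun j =>
    eventually_det_pow_mul_mem (hV (b.coord i) (b j))
  filter_upwards [h] with l hl f v
  have e : (fun g : GL (Fin n) K => g.1.det) ^ l * (fun g => f (V.ρ g v)) =
      ∑ i, ∑ j, (f (b i) * b.repr v j) • ((fun g : GL (Fin n) K => g.1.det) ^ l *
        (fun g => b.coord i (V.ρ g (b j)))) := by
    have h1 : ∀ g, f (V.ρ g v) = ∑ i, ∑ j, (f (b i) * b.repr v j) * b.coord i (V.ρ g (b j)) := by
      intro g
      conv_lhs => rw [← b.sum_repr v, map_sum, map_sum]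
      rw [Finset.sum_comm]
      refine Finset.sum_congr rfl fun j _ => ?_
      rw [map_smul, map_smul]
      conv_lhs => rw [← b.sum_repr (V.ρ g (b j)), map_sum]
      rw [smul_eq_mul, Finset.mul_sum]
      refine Finset.sum_congr rfl fun i _ => ?_
      rw [map_smul, smul_eq_mul, Module.Basis.coord_apply]
      ring
    funext g
    rw [Pi.mul_apply, h1, Finset.mul_sum, Finset.sum_apply]
    refine Finset.sum_congr rfl fun i _ => ?_
    rw [Finset.mul_sum, Finset.sum_apply]
    refine Finset.sum_congr rfl fun j _ => ?_
    rw [Pi.smul_apply, Pi.mul_apply, smul_eq_mul]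
    ring
  rw [e]
  exact Subalgebra.sum_mem _ fun i _ => Subalgebra.sum_mem _ fun j _ =>
    Subalgebra.smul_mem _ (hl i j) _

variable (K n)

/-- The action of `GL n K` on `K` by the determinant. -/
def detRho : Representation K (GL (Fin n) K) K :=
  (Algebra.lmul K K).toMonoidHom.comp (Matrix.detMonoidHom.comp (Units.coeHom _))

lemma detRho_apply (g : GL (Fin n) K) (v : K) : detRho K n g v = g.1.det * v := rfl

/-- The determinant representation. -/
noncomputable def detRep : PolyRep K n where
  obj := FDRep.of (detRho K n)
  property := fun f v => by
    change (fun g => f (detRho K n g v)) ∈ polyFun K n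
    have h : (fun g : GL (Fin n) K => f (detRho K n g v)) =
        f v • fun g : GL (Fin n) K => g.1.det := by
      funext g
      rw [detRho_apply, ← smul_eq_mul, map_smul, Pi.smul_apply, smul_eq_mul, smul_eq_mul, mul_comm]
    rw [h]
    exact Subalgebra.smul_mem _ det_mem_polyFun _

lemma rho_tensorPow_detRep (g : GL (Fin n) K) : ∀ (l : ℕ) (v : (tensorPow (detRep K n) l).obj),
    (tensorPow (detRep K n) l).obj.ρ g v = g.1.det ^ l • v
  | 0, v => by
    rw [pow_zero, one_smul]
    rfl
  | l + 1, v => by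
    change TensorProduct.map ((detRep K n).obj.ρ g) ((tensorPow (detRep K n) l).obj.ρ g) v = _
    have h1 : (detRep K n).obj.ρ g = g.1.det • LinearMap.id := rfl
    have h2 : (tensorPow (detRep K n) l).obj.ρ g = g.1.det ^ l • LinearMap.id :=
      LinearMap.ext (rho_tensorPow_detRep g l)
    rw [h1, h2, TensorProduct.map_smul_left, TensorProduct.map_smul_right, TensorProduct.map_id,
      smul_smul, ← pow_succ']
    rfl

/-- A rational representation is polynomial after twisting with a large power of the
determinant. -/
theorem eventually_hasCoeffIn_polyFun (V : FDRep K (GL (Fin n) K))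
    (hV : hasCoeffIn (regFun K n) V) :
    ∀ᶠ l in atTop, hasCoeffIn (polyFun K n) ((tensorPow (detRep K n) l).obj ⊗ V) := by
  filter_upwards [eventually_det_pow_mul_coeff_mem V hV] with l hl f x
  let T := (tensorPow (detRep K n) l).obj
  change (fun g => f (TensorProduct.map (T.ρ g) (V.ρ g) x)) ∈ polyFun K n
  revert f x
  change ∀ (f : Module.Dual K (TensorProduct K T V)) (x : TensorProduct K T V), _
  intro f x
  induction x using TensorProduct.induction_on with
  | zero =>
    simp only [map_zero]
    exact Subalgebra.zero_mem _
  | add x y hx hy =>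
    simp only [map_add]
    exact Subalgebra.add_mem _ hx hy
  | tmul t v =>
    have e : (fun g => f (TensorProduct.map (T.ρ g) (V.ρ g) (t ⊗ₜ[K] v))) =
        (fun g : GL (Fin n) K => g.1.det) ^ l *
          (fun g => (f.comp (TensorProduct.mk K T V t)) (V.ρ g v)) := by
      funext g
      rw [TensorProduct.map_tmul, rho_tensorPow_detRep, ← TensorProduct.smul_tmul', map_smul]
      rfl
    rw [e]
    exact hl _ _

end Determinant
end RepGL

/-! ### The determinant as the top exterior power -/

namespace RepGL

section DeterminantRetract

open PolyRep

universe u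

variable (K : Type u) [Field K] {n : ℕ}

/-- The sign of a permutation, extended by zero to all maps. -/
def signFun (j : Fin n → Fin n) : K := ((1 : Matrix (Fin n) (Fin n) K).submatrix id j).det

lemma prod_one_apply {k m : ℕ} (i j : Fin k → Fin m) :
    ∏ a, (1 : Matrix (Fin m) (Fin m) K) (i a) (j a) = if j = i then 1 else 0 := by
  split_ifs with h
  · rw [h]
    exact Finset.prod_eq_one fun a _ => Matrix.one_apply_eq _
  · obtain ⟨a, ha⟩ := Function.ne_iff.mp h
    exact Finset.prod_eq_zero (Finset.mem_univ a) (Matrix.one_apply_ne ha.symm)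

lemma signFun_eq (j : Fin n → Fin n) : signFun K j =
    ∑ σ : Equiv.Perm (Fin n), ((Equiv.Perm.sign σ : ℤ) : K) * if j = σ then 1 else 0 := by
  rw [signFun, Matrix.det_apply']
  exact Finset.sum_congr rfl fun σ _ => congrArg _ (prod_one_apply K (fun a => σ a) j)

lemma sum_signFun_smul {T : Type*} [AddCommGroup T] [Module K T] (t : (Fin n → Fin n) → T) :
    ∑ j, signFun K j • t j = ∑ σ : Equiv.Perm (Fin n), ((Equiv.Perm.sign σ : ℤ) : K) • t σ := by
  simp_rw [signFun_eq, Finset.sum_smul]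
  rw [Finset.sum_comm]
  refine Finset.sum_congr rfl fun σ _ => ?_
  rw [Finset.sum_eq_single (⇑σ) (fun j _ h => by rw [if_neg h, mul_zero, zero_smul])
    (fun h => absurd (Finset.mem_univ _) h), if_pos rfl, mul_one]

/-- Multiplicativity of the determinant, for `g` times the identity matrix with columns selected by
`j`. -/
lemma sum_signFun_mul_prod_left (g : Matrix (Fin n) (Fin n) K) (j : Fin n → Fin n) :
    ∑ i, signFun K i * ∏ a, g (i a) (j a) = g.det * signFun K j := by
  have h := sum_signFun_smul K fun i => ∏ a, g (i a) (j a)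
  simp only [smul_eq_mul] at h
  rw [h, signFun, ← Matrix.det_mul, Matrix.det_apply']
  refine Finset.sum_congr rfl fun σ _ => ?_
  congr 1
  refine Finset.prod_congr rfl fun a _ => ?_
  simp [Matrix.mul_apply, Matrix.one_apply]

lemma signFun_eq_transpose (i : Fin n → Fin n) :
    signFun K i = ((1 : Matrix (Fin n) (Fin n) K).submatrix i id).det := by
  rw [signFun, ← Matrix.det_transpose, Matrix.transpose_submatrix, Matrix.transpose_one]

lemma sum_signFun_mul_prod_right (g : Matrix (Fin n) (Fin n) K) (i : Fin n → Fin n) :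
    ∑ j, signFun K j * ∏ a, g (i a) (j a) = signFun K i * g.det := by
  rw [mul_comm]
  have h := sum_signFun_mul_prod_left K g.transpose i
  rwa [Matrix.det_transpose] at h

/-- Only permutations contribute, each with the square of its sign; this fixes the factor `1 / n!`
in `detProj`. -/
lemma sum_signFun_mul_signFun : ∑ j : Fin n → Fin n, signFun K j * signFun K j = n.factorial := by
  have h := sum_signFun_smul K (signFun K (n := n))
  simp only [smul_eq_mul] at h
  rw [h]
  have h1 : ∀ σ : Equiv.Perm (Fin n), ((Equiv.Perm.sign σ : ℤ) : K) * signFun K σ = 1 := by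
    intro σ
    have h2 : signFun K σ = ((Equiv.Perm.sign σ : ℤ) : K) := by
      rw [signFun, Matrix.det_permute', Matrix.det_one, mul_one]
    rw [h2, ← Int.cast_mul, ← Units.val_mul, Int.units_mul_self, Units.val_one, Int.cast_one]
  rw [Finset.sum_congr rfl fun σ _ => h1 σ, Finset.sum_const, Finset.card_univ, Fintype.card_perm,
    Fintype.card_fin, nsmul_one]

/-- Multiplicativity of the determinant once more: the left side expands the determinant of the
matrix whose entry at `(a, b)` tells whether `i a = j b`. -/
lemma sum_sign_mul_comp (i j : Fin n → Fin n) :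
    ∑ σ : Equiv.Perm (Fin n), ((Equiv.Perm.sign σ : ℤ) : K) * (if j ∘ ⇑σ⁻¹ = i then 1 else 0) =
      signFun K j * signFun K i := by
  rw [mul_comm, signFun_eq_transpose, signFun, ← Matrix.det_mul, Matrix.det_apply']
  refine Finset.sum_congr rfl fun σ _ => ?_
  congr 1
  have h : ∀ a, ((1 : Matrix (Fin n) (Fin n) K).submatrix i id *
      (1 : Matrix (Fin n) (Fin n) K).submatrix id j) (σ a) a =
      (1 : Matrix (Fin n) (Fin n) K) ((i ∘ σ) a) (j a) := fun a => by
    simp [Matrix.mul_apply, Matrix.one_apply]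
  rw [Finset.prod_congr rfl fun a _ => h a, prod_one_apply]
  refine if_congr ?_ rfl rfl
  constructor
  · rintro rfl
    funext a
    simp
  · rintro rfl
    funext a
    simp

variable (n)

/-- The inclusion of the determinant representation in a tensor power of the standard
representation. -/
noncomputable def detIncl : detRep K n ⟶ stdPow K n n :=
  ofLin (LinearMap.toSpanSingleton K (stdPow K n n).obj (∑ j, signFun K j • stdPowBasis K n n j) :
      K →ₗ[K] (stdPow K n n).obj) fun g (v : K) => by
    change (g.1.det * v : K) • _ = (stdPow K n n).obj.ρ g (v • _)
    rw [map_smul, mul_comm, mul_smul, map_sum]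
    congr 1
    simp_rw [map_smul, rho_stdPowBasis, Finset.smul_sum, smul_smul]
    rw [Finset.sum_comm]
    refine Finset.sum_congr rfl fun i _ => ?_
    rw [← Finset.sum_smul, sum_signFun_mul_prod_right, mul_comm]

lemma lin_detIncl (v : K) :
    lin (detIncl K n) v = v • ∑ j, signFun K j • stdPowBasis K n n j := rfl

/-- The projection of a tensor power of the standard representation to the determinant
representation. -/
noncomputable def detProj : stdPow K n n ⟶ detRep K n :=
  ofLin ((stdPowBasis K n n).constr K fun j => ((n.factorial : K)⁻¹ * signFun K j : K)) fun g v => by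
    let L : (stdPow K n n).obj →ₗ[K] K :=
      (stdPowBasis K n n).constr K fun j => ((n.factorial : K)⁻¹ * signFun K j : K)
    have hL : ∀ j, L (stdPowBasis K n n j) = (n.factorial : K)⁻¹ * signFun K j := fun j =>
      (stdPowBasis K n n).constr_basis K _ j
    have h : L.comp ((stdPow K n n).obj.ρ g) = (g.1.det • L : (stdPow K n n).obj →ₗ[K] K) := by
      refine (stdPowBasis K n n).ext fun j => ?_
      rw [LinearMap.comp_apply, rho_stdPowBasis, map_sum, LinearMap.smul_apply, hL, smul_eq_mul,
        mul_left_comm, ← sum_signFun_mul_prod_left, Finset.mul_sum]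
      refine Finset.sum_congr rfl fun i _ => ?_
      rw [map_smul, hL, smul_eq_mul]
      ring
    exact LinearMap.congr_fun h v

lemma lin_detProj (j : Fin n → Fin n) : lin (detProj K n) (stdPowBasis K n n j) =
    ((n.factorial : K)⁻¹ * signFun K j : K) :=
  (stdPowBasis K n n).constr_basis K _ j

lemma lin_antisymmetrizer (j : Fin n → Fin n) :
    lin (antisymmetrizer K (stdRep K n) n) (stdPowBasis K n n j) =
      (n.factorial : K)⁻¹ • ∑ σ : Equiv.Perm (Fin n), ((Equiv.Perm.sign σ : ℤ) : K) •
        stdPowBasis K n n (j ∘ ⇑σ⁻¹) := by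
  unfold antisymmetrizer
  rw [lin_smul, LinearMap.smul_apply, lin_sum, LinearMap.sum_apply]
  congr 1
  refine Finset.sum_congr rfl fun σ _ => ?_
  rw [← permAct_stdPowBasis]
  rcases Int.units_eq_one_or (Equiv.Perm.sign σ) with h | h
  · rw [h, one_smul, Units.val_one, Int.cast_one, one_smul]
  · rw [h, Units.neg_smul, one_smul, Units.val_neg, Units.val_one, Int.cast_neg, Int.cast_one,
      neg_smul, one_smul]
    rfl

/-- By `sum_sign_mul_comp` the matrix of the antisymmetrizer is `1 / n!` times the rank one matrix
`signFun j * signFun i`, so it factors through the determinant. -/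
lemma detProj_detIncl : detProj K n ≫ detIncl K n = antisymmetrizer K (stdRep K n) n := by
  apply lin_injective
  refine (stdPowBasis K n n).ext fun j => ?_
  rw [lin_antisymmetrizer, lin_comp, LinearMap.comp_apply, lin_detProj]
  erw [lin_detIncl]
  rw [mul_smul]
  congr 1
  have h : ∀ i, stdPowBasis K n n i =
      ∑ l, (if i = l then (1 : K) else 0) • stdPowBasis K n n l := fun i => by
    simp
  calc signFun K j • ∑ i, signFun K i • stdPowBasis K n n i
      = ∑ i, (∑ σ : Equiv.Perm (Fin n), ((Equiv.Perm.sign σ : ℤ) : K) *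
          (if j ∘ ⇑σ⁻¹ = i then 1 else 0)) • stdPowBasis K n n i := by
        simp_rw [Finset.smul_sum, smul_smul, sum_sign_mul_comp]
    _ = _ := by
        simp_rw [Finset.sum_smul]
        rw [Finset.sum_comm]
        refine Finset.sum_congr rfl fun σ _ => ?_
        simp_rw [mul_smul]
        rw [← Finset.smul_sum, ← h]

variable [CharZero K]

lemma detIncl_detProj : detIncl K n ≫ detProj K n = 𝟙 _ := by
  let p : (stdPow K n n).obj →ₗ[K] K := lin (detProj K n)
  have hp : ∀ j, p (stdPowBasis K n n j) = (n.factorial : K)⁻¹ * signFun K j := lin_detProj K n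
  have h : p (∑ j, signFun K j • stdPowBasis K n n j) = 1 := by
    simp_rw [map_sum, map_smul, hp, smul_eq_mul, mul_left_comm]
    rw [← Finset.mul_sum, sum_signFun_mul_signFun,
      inv_mul_cancel₀ (Nat.cast_ne_zero.mpr n.factorial_ne_zero)]
  refine lin_injective (LinearMap.ext fun (v : K) => ?_)
  change p (v • ∑ j, signFun K j • stdPowBasis K n n j) = v
  rw [map_smul, h, smul_eq_mul, mul_one]

/-- A braided linear functor takes the determinant representation to the exterior power of the
image of the standard representation. -/
lemma nonempty_extPow_iso_detRep {C : Type*} [Category* C] [Preadditive C] [Linear K C]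
    [MonoidalCategory C] [SymmetricCategory C] [IsIdempotentComplete C] (F : PolyRep K n ⥤ C)
    [F.Braided] [F.Additive] [F.Linear K] {X : C} (e : X ≅ F.obj (stdRep K n)) :
    Nonempty (extPow K X n ≅ F.obj (detRep K n)) :=
  nonempty_extPow_iso F K e n (detIncl K n) (detProj K n) (detIncl_detProj K n)
    (detProj_detIncl K n)

end DeterminantRetract
end RepGL

theorem mainTheorem5 {K : Type*} [Field K] [CharZero K] (n : ℕ)
    {C : Type*} [Category* C] [Preadditive C] [Linear K C] [Limits.HasFiniteBiproducts C]
    [IsIdempotentComplete C] [MonoidalCategory C] [SymmetricCategory C] [MonoidalPreadditive C]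
    [MonoidalLinear K C] (X : C) (hX : Limits.IsZero (RepGL.extPow K X (n + 1))) :
    (∃ (F : RepGL.PolyRep K n ⥤ C) (_ : F.Braided), F.Additive ∧ F.Linear K ∧
      Nonempty (F.obj (RepGL.stdRep K n) ≅ X)) ∧
    ∀ (F : RepGL.PolyRep K n ⥤ C) [F.Braided] [F.Additive] [F.Linear K],
      Nonempty (F.obj (RepGL.stdRep K n) ≅ X) →
      ∀ {M : Type*} [Category* M] [Preadditive M] [Linear K M] [IsIdempotentComplete M]
        [MonoidalLeftAction C M] [RepGL.LinearLeftAction K C M],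
        ((MonoidalLeftAction.curriedAction C M).obj (RepGL.extPow K X n)).IsEquivalence →
        ∃ _ : MonoidalLeftAction (RepGL.RatRep K n) M,
          RepGL.LinearLeftAction K (RepGL.RatRep K n) M ∧
          RepGL.ActionExtends M (RepGL.polyToRat K n) F := by
  refine ⟨RepGL.exists_braided_functor n X hX, fun F _ _ _ ⟨e⟩ M _ _ _ _ _ _ hM => ?_⟩
  -- The determinant goes to `∧^n X` under `F`, so it acts by an equivalence.
  obtain ⟨e'⟩ := RepGL.nonempty_extPow_iso_detRep K n F e.symm
  exact RepGL.exists_action_extension K _ F (RepGL.detRep K n)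
    (Functor.isEquivalence_of_iso ((MonoidalLeftAction.curriedAction C M).mapIso e'))
    (RepGL.eventually_hasCoeffIn_polyFun K n)
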